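/- Logarithms written $\log$ are to base $2$, $H_2(p)=-p\log p-(1-p)\log(1-p)$ is the binary entropy function, $H_2^{-1}:[0,1]\to[0,\tfrac12]$ is the inverse of its restriction to $[0,\tfrac12]$, and for $0\le\delta<\tfrac12$ $$\kappa_Z(\delta)=\sup_{0<r<1-H_2(\delta)} r\Bigl(1-\frac{\delta}{H_2^{-1}(1-r)}\Bigr)$$ is the rate given by the Zyablov bound. Fix $0<\rho\le1$. In the Light Bulb Problem one is given $n\ge2$ bit strings of length $L$, all of whose bits are independent and uniform, except that for one unknown pair of distinct indices $a,b$ the strings $X_a,X_b$ are correlated: independently for each position $k$, $\Pr((X_a)_k=(X_b)_k)=\frac{1+\rho}{2}$ and $\Pr((X_a)_k\ne(X_b)_k)=\frac{1-\rho}{2}$. The task is to output $\{a,b\}$. Algorithms are deterministic programs of a random access machine with logarithmic cost that has random access to the input bits. A deterministic algorithm solves the problem in time $T(n)$ if there is a constant $c$ (depending on $\rho$) such that for all $n\ge2$ and all $L\ge c\log^2n$ it halts within time $T(n)$ on every input and, for every pair $a\ne b$, outputs $\{a,b\}$ with probability at least $1-1/n^2$ over the random instance. Constants and the $o(1)$ terms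 below (as $n\to\infty$) may depend on $\rho$. (1) Suppose that $\kappa_Z(\frac{1-\rho}{2})\ge\frac12$, or that $H_2\bigl(1-\kappa_Z(\frac{1-\rho}{2})\bigr)\frac{4\ln2}{\rho^2}\ge1$. Then there is a deterministic algorithm that solves the Light Bulb Problem in time $$O(n\,\mathrm{polylog}\,n)\cdot 2^{H_2\left(1-\kappa_Z\left(\frac{1-\rho}{2}\right)\right)\frac{4\ln2\,\log n}{\rho^2}(1+o(1))}.$$ (2) For every $0<\rho\le 1$, put $m=\lceil 4\ln2\,\log n/\rho^2\rceil$ and $d=\lceil(1-\rho)m/2\rceil$. There are a deterministic preprocessing program, which is given only $n,m,d$ and not the instance, and a deterministic algorithm that starts from the memory left by it, such that the preprocessing takes time $O(n^{2.773/\rho^2})$ and generates the decoding lookup table of a code of block length $m$ produced by Gilbert's greedy procedure (starting from $S=\{0,1\}^m$, repeatedly pick some $x\in S$ as a codeword and remove from $S$ all words at Hamming distance at most $d$ from $x$, until $S$ is empty); the table maps each word within distance $\lfloor(d-1)/2\rfloor$ (or $0$ if $d=0$) of a codeword to that codeword and every other word to a special symbol. After this one-time preprocessing the algorithm solves the Light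 Bulb Problem in time $$O(n\,\mathrm{polylog}\,n)\cdot 2^{H_2\left(H_2\left(\frac{1-\rho}{2}\right)\right)\frac{4\ln2\,\log n}{\rho^2}(1+o(1))}.$$ -/

import Mathlib

namespace LightBulb

/-! ### Entropy and the Zyablov rate -/

/-- The binary entropy function with logarithms to base `2`. -/
noncomputable def H2 (p : ℝ) : ℝ := Real.binEntropy p / Real.log 2

/-- The inverse of `H2`, with values in `[0, 1/2]` (used for arguments in `[0, 1]`). -/
noncomputable def H2inv (y : ℝ) : ℝ := Function.invFunOn H2 (Set.Icc 0 (1 / 2)) y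

/-- The rate given by the Zyablov bound at relative distance `δ`:
the supremum of `r (1 - δ / H2⁻¹(1 - r))` over `0 < r < 1 - H2 δ`. -/
noncomputable def kappaZ (δ : ℝ) : ℝ :=
  sSup ((fun r : ℝ => r * (1 - δ / H2inv (1 - r))) '' Set.Ioo 0 (1 - H2 δ))

/-! ### Random access machines with logarithmic cost -/

/-- The arithmetic operations of the machine; `sub` is truncated and `div` rounds down. -/
inductive Op where
  | add | sub | mul | div

def Op.eval : Op → ℕ → ℕ → ℕ
  | .add, x, y => x + y
  | .sub, x, y => x - y
  | .mul, x, y => x * y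
  | .div, x, y => x / y

/-- Programs of a random access machine. It has registers and a memory, both indexed by the
natural numbers and holding natural numbers; a register of the program text is named by its
index, memory is addressed indirectly. `read r i k` puts the `k`-th bit of the `i`-th input string
into `r`, where `i` and `k` are taken from registers. -/
inductive Cmd where
  | const (r k : ℕ)
  | arith (o : Op) (r a b : ℕ)
  | load (r a : ℕ)
  | store (a r : ℕ)
  | read (r i k : ℕ)
  | seq (c₁ c₂ : Cmd)
  | ite (r : ℕ) (c₁ c₂ : Cmd)
  | loop (r : ℕ) (c : Cmd)

structure State where
  reg : ℕ → ℕ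
  mem : ℕ → ℕ

def State.setReg (s : State) (r v : ℕ) : State := ⟨Function.update s.reg r v, s.mem⟩

def State.setMem (s : State) (a v : ℕ) : State := ⟨s.reg, Function.update s.mem a v⟩

/-- `Exec inp c s t s'`: on the input `inp`, the program `c` started in the state `s` halts
in the state `s'` at total cost `t`. Every elementary step costs one plus the binary lengths
of the numbers and addresses that it handles (the logarithmic cost criterion). -/
inductive Exec (inp : ℕ → ℕ → ℕ) : Cmd → State → ℕ → State → Prop
  | const (s : State) (r k : ℕ) : Exec inp (.const r k) s (1 + k.size) (s.setReg r k)
  | arith (s : State) (o : Op) (r a b : ℕ) :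
      Exec inp (.arith o r a b) s (1 + (s.reg a).size + (s.reg b).size)
        (s.setReg r (o.eval (s.reg a) (s.reg b)))
  | load (s : State) (r a : ℕ) :
      Exec inp (.load r a) s (1 + (s.reg a).size + (s.mem (s.reg a)).size)
        (s.setReg r (s.mem (s.reg a)))
  | store (s : State) (a r : ℕ) :
      Exec inp (.store a r) s (1 + (s.reg a).size + (s.reg r).size)
        (s.setMem (s.reg a) (s.reg r))
  | read (s : State) (r i k : ℕ) :
      Exec inp (.read r i k) s (1 + (s.reg i).size + (s.reg k).size)
        (s.setReg r (inp (s.reg i) (s.reg k)))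
  | seq {c₁ c₂ : Cmd} {s s' s'' : State} {t t' : ℕ} :
      Exec inp c₁ s t s' → Exec inp c₂ s' t' s'' → Exec inp (.seq c₁ c₂) s (t + t') s''
  | ite_true {r : ℕ} {c₁ c₂ : Cmd} {s s' : State} {t : ℕ} :
      s.reg r ≠ 0 → Exec inp c₁ s t s' →
      Exec inp (.ite r c₁ c₂) s (1 + (s.reg r).size + t) s'
  | ite_false {r : ℕ} {c₁ c₂ : Cmd} {s s' : State} {t : ℕ} :
      s.reg r = 0 → Exec inp c₂ s t s' →
      Exec inp (.ite r c₁ c₂) s (1 + (s.reg r).size + t) s'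
  | loop_done {r : ℕ} {c : Cmd} {s : State} :
      s.reg r = 0 → Exec inp (.loop r c) s (1 + (s.reg r).size) s
  | loop_step {r : ℕ} {c : Cmd} {s s' s'' : State} {t t' : ℕ} :
      s.reg r ≠ 0 → Exec inp c s t s' → Exec inp (.loop r c) s' t' s'' →
      Exec inp (.loop r c) s (1 + (s.reg r).size + t + t') s''

/-- The machine is deterministic: the final state and the cost are determined. -/
theorem Exec.det {inp : ℕ → ℕ → ℕ} {c : Cmd} {s s₁ : State} {t₁ : ℕ}
    (h : Exec inp c s t₁ s₁) : ∀ {t₂ : ℕ} {s₂ : State}, Exec inp c s t₂ s₂ →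
      t₁ = t₂ ∧ s₁ = s₂ := by
  induction h with
  | const | arith | load | store | read => intro t₂ s₂ h₂; cases h₂; exact ⟨rfl, rfl⟩
  | seq _ _ ih₁ ih₂ =>
    intro t₂ s₂ h₂
    cases h₂ with
    | seq a b =>
      obtain ⟨rfl, rfl⟩ := ih₁ a
      obtain ⟨rfl, rfl⟩ := ih₂ b
      exact ⟨rfl, rfl⟩
  | ite_true hr _ ih =>
    intro t₂ s₂ h₂
    cases h₂ with
    | ite_true _ a => obtain ⟨rfl, rfl⟩ := ih a; exact ⟨rfl, rfl⟩
    | ite_false h0 _ => exact absurd h0 hr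
  | ite_false hr _ ih =>
    intro t₂ s₂ h₂
    cases h₂ with
    | ite_true h0 _ => exact absurd hr h0
    | ite_false _ a => obtain ⟨rfl, rfl⟩ := ih a; exact ⟨rfl, rfl⟩
  | loop_done hr =>
    intro t₂ s₂ h₂
    cases h₂ with
    | loop_done _ => exact ⟨rfl, rfl⟩
    | loop_step h0 _ _ => exact absurd hr h0
  | loop_step hr _ _ ih₁ ih₂ =>
    intro t₂ s₂ h₂
    cases h₂ with
    | loop_done h0 => exact absurd h0 hr
    | loop_step _ a b =>
      obtain ⟨rfl, rfl⟩ := ih₁ a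
      obtain ⟨rfl, rfl⟩ := ih₂ b
      exact ⟨rfl, rfl⟩

/-- The initial state: the arguments stand in the registers `0, 1, …`, all other registers
are zero, and the memory is `mem`. -/
def initState (args : List ℕ) (mem : ℕ → ℕ) : State := ⟨fun r => args.getD r 0, mem⟩

/-! ### The Light Bulb Problem -/

/-- The law of one bit that is `true` with probability `(1 - ρ) / 2`; for `ρ = 0` a fair coin. -/
noncomputable def bitLaw (ρ : ℝ) : MeasureTheory.Measure Bool :=
  ENNReal.ofReal ((1 - ρ) / 2) • MeasureTheory.Measure.dirac true +
    ENNReal.ofReal ((1 + ρ) / 2) • MeasureTheory.Measure.dirac false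

/-- The joint law of the bits that `n` strings have at one position: independent fair coins,
except that the bit of the string `b` is that of the string `a`, flipped with probability
`(1 - ρ) / 2` independently of everything else. -/
noncomputable def columnLaw (ρ : ℝ) {n : ℕ} (a b : Fin n) :
    MeasureTheory.Measure (Fin n → Bool) :=
  ((MeasureTheory.Measure.pi fun _ : Fin n => bitLaw 0).prod (bitLaw ρ)).map
    fun p => Function.update p.1 b (xor (p.1 a) p.2)

/-- `n` strings of length `L`: `X k i` is the `k`-th bit of the `i`-th string. -/
abbrev Strings (n L : ℕ) : Type := Fin L → Fin n → Bool

/-- The law of a random instance with correlated pair `a`, `b`: the positions are independent. -/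
noncomputable def instanceLaw (ρ : ℝ) {n : ℕ} (a b : Fin n) (L : ℕ) :
    MeasureTheory.Measure (Strings n L) :=
  MeasureTheory.Measure.pi fun _ : Fin L => columnLaw ρ a b

/-- The input of the machine: random access to the bits of the strings. -/
def Strings.input {n L : ℕ} (X : Strings n L) (i k : ℕ) : ℕ :=
  if h : i < n ∧ k < L then (X ⟨k, h.2⟩ ⟨i, h.1⟩).toNat else 0

/-- On the instance `X`, the program `Q` started with memory `mem` halts with the (unordered)
pair `a`, `b` in the registers `0` and `1`. -/
def FindsPair (Q : Cmd) (mem : ℕ → ℕ) {n L : ℕ} (X : Strings n L) (a b : Fin n) : Prop :=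
  ∃ (t : ℕ) (s : State), Exec X.input Q (initState [n, L] mem) t s ∧
    ((s.reg 0 = a ∧ s.reg 1 = b) ∨ (s.reg 0 = b ∧ s.reg 1 = a))

/-- `Q`, started with memory `mem`, solves the Light Bulb Problem for `n` strings of length `L`
in time `T`: it halts within time `T` on every instance, and wherever the correlated pair is
placed, it finds that pair with probability at least `1 - 1 / n ^ 2` over the instance. -/
def Solves (Q : Cmd) (mem : ℕ → ℕ) (ρ : ℝ) (n L : ℕ) (T : ℝ) : Prop :=
  (∀ X : Strings n L, ∃ (t : ℕ) (s : State),
    Exec X.input Q (initState [n, L] mem) t s ∧ (t : ℝ) ≤ T) ∧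
  ∀ a b : Fin n, a ≠ b →
    1 - 1 / (n : ℝ) ^ 2 ≤ (instanceLaw ρ a b L).real {X | FindsPair Q mem X a b}

/-- `C n (log n) ^ k * 2 ^ (e (4 ln 2 log n / ρ ^ 2) (1 + ε))`, with `log` to base `2`. -/
noncomputable def timeBound (ρ e C : ℝ) (k : ℕ) (ε : ℝ) (n : ℕ) : ℝ :=
  C * (n * Real.logb 2 n ^ k) *
    (2 : ℝ) ^ (e * (4 * Real.log 2 * Real.logb 2 n / ρ ^ 2) * (1 + ε))

/-! ### Gilbert's greedy code and its decoding table -/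

/-- The pairs `(S, C)` that Gilbert's greedy procedure can reach: start with all words in `S` and
no codeword in `C`; pick any `x ∈ S`, add it to `C` and remove the ball of radius `d` around `x`
from `S`. -/
inductive GilbertRun (m d : ℕ) : Set (Fin m → Bool) → Set (Fin m → Bool) → Prop
  | start : GilbertRun m d Set.univ ∅
  | pick {S C : Set (Fin m → Bool)} (x : Fin m → Bool) : GilbertRun m d S C → x ∈ S →
      GilbertRun m d (S \ {y | hammingDist x y ≤ d}) (insert x C)

/-- A code that Gilbert's greedy procedure can produce: no word is left. -/
def IsGilbertCode (m d : ℕ) (C : Set (Fin m → Bool)) : Prop := GilbertRun m d ∅ C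

/-- The word of length `m` with binary code `v`. -/
def word (m v : ℕ) : Fin m → Bool := fun i => v.testBit i

/-- The memory cells `0, …, 2 ^ m - 1` hold the unique-decoding table of `C` with the decoding
radius `(d - 1) / 2`, rounded down (radius `0` for `d = 0`): the cell of a word within this radius
of a codeword `w` holds the code of `w` plus one, the cell of any other word holds `0`. -/
def IsDecodingTable (m d : ℕ) (C : Set (Fin m → Bool)) (mem : ℕ → ℕ) : Prop :=
  ∀ v < 2 ^ m,
    (∀ w < 2 ^ m, word m w ∈ C → hammingDist (word m v) (word m w) ≤ (d - 1) / 2 →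
      mem v = w + 1) ∧
    ((∀ c ∈ C, (d - 1) / 2 < hammingDist (word m v) c) → mem v = 0)

/-- The block length `4 ln 2 log n / ρ ^ 2`, rounded up. -/
noncomputable def blockLength (ρ : ℝ) (n : ℕ) : ℕ :=
  ⌈4 * Real.log 2 * Real.logb 2 n / ρ ^ 2⌉₊

/-- The distance `(1 - ρ) m / 2` for the block length `m`, rounded up. -/
noncomputable def codeDistance (ρ : ℝ) (n : ℕ) : ℕ :=
  ⌈(1 - ρ) * blockLength ρ n / 2⌉₊

end LightBulb

/-! The search itself uses no code at all. Put δ = (1 - ρ)/2 and let ℓ be the binary length of n.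
Take 5ℓ consecutive blocks of k = ℓ + 3 positions. For each block, hash all strings by their bits in
it, then look up every string again after adding each error pattern of weight at most t = ⌊kp/q⌋,
where p/q ≥ 2δ is rational. In one block the correlated strings differ in δk positions on average,
so by Markov they differ in more than t positions with probability at most 1/2. A third string
agrees with X_b on the block with total probability at most n 2^(-k) ≤ 1/8. So a block is good with
probability at least 3/8, and since the blocks are independent, none is good with probability at
most (5/8)^(5ℓ) ≤ n^(-3). Every candidate pair is verified on the first Aℓ positions; by Hoeffding
and a union bound all these tests are right except with probability n^(-3). When both hold, the
program outputs the correct pair (`GoodInstance.output`, `one_sub_le_measureReal_goodInstance`).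

The cost is n times the number of patterns, up to logarithmic factors. With x = p/q ≤ 1/2 there are
at most 2^(H2(x) k) patterns (`patternCount_le_rpow`). If H2(δ) ≤ 1/2, then x can be taken between
2δ and 4δ, concavity gives H2(x) ≤ 4 H2(δ), and since 4 ln 2/ρ² ≥ 2, an exponent coefficient e ≥ 2
H2(δ) pays for the patterns. If instead e · 4 ln 2/ρ² ≥ 1, the time bound has room for all 2^k
patterns. This dichotomy is `exists_pattern_weight`. Both claims reduce to it through the chord
bound 2x ≤ H2(x) on [0, 1/2]: for the Zyablov rate because κ_Z(δ) ≤ 1 - H2(δ) (`kappaZ_le`), and for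
the Gilbert exponent either at x = H2(δ) or, when H2(δ) ≥ 1/2, at x = 1 - H2(δ) ≥ ρ²/(8 ln 2)
(`one_le_exponent`). No o(1) term is needed.

The preprocessing is a separate construction. The greedy choices are arranged so that the code stays
linear: a word x far from the code C may be followed by all the rest of the coset C ⊕ x
(`GreedyLinear.extend`). Each such round doubles the code, so m + 1 rounds suffice, and a table of
nearest codewords is maintained in place (`runs_updateCode`). The cost is 2^m times a polynomial in
the logarithm, and 4 ln 2 < 2.773 leaves a power of n that absorbs it. The only thing the search
needs to know of the table is that its entries are short numbers.

Costs are handled by counting elementary steps on numbers of at most B bits, each of cost at most 2B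
+ 1 (`Runs`), with B quadratic in the binary length of n. -/

namespace LightBulb

/-! ### A program logic with costs -/

infixr:60 ";;" => Cmd.seq

@[simp] theorem State.reg_setReg (s : State) (r v x : ℕ) :
    (s.setReg r v).reg x = if x = r then v else s.reg x := by
  simp [State.setReg, Function.update_apply]

@[simp] theorem State.mem_setReg (s : State) (r v : ℕ) : (s.setReg r v).mem = s.mem := rfl

@[simp] theorem State.reg_setMem (s : State) (a v : ℕ) : (s.setMem a v).reg = s.reg := rfl

theorem State.mem_setMem (s : State) (a v x : ℕ) :
    (s.setMem a v).mem x = if x = a then v else s.mem x := by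
  simp [State.setMem, Function.update_apply]

/-- All registers and memory cells hold numbers of at most `B` bits. -/
structure Bounded (B : ℕ) (s : State) : Prop where
  reg : ∀ r, s.reg r < 2 ^ B
  mem : ∀ a, s.mem a < 2 ^ B

theorem Bounded.setReg {B : ℕ} {s : State} (h : Bounded B s) (r : ℕ) {v : ℕ} (hv : v < 2 ^ B) :
    Bounded B (s.setReg r v) :=
  ⟨fun x => by rw [State.reg_setReg]; split <;> [exact hv; exact h.reg x], h.mem⟩

theorem Bounded.setMem {B : ℕ} {s : State} (h : Bounded B s) (a : ℕ) {v : ℕ} (hv : v < 2 ^ B) :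
    Bounded B (s.setMem a v) :=
  ⟨h.reg, fun x => by rw [State.mem_setMem]; split <;> [exact hv; exact h.mem x]⟩

/-- From the state `s`, if it is `B`-bounded, the program `c` halts after at most `T` elementary
steps on numbers of at most `B` bits, in a `B`-bounded state that satisfies `Q`. -/
def Runs (B : ℕ) (inp : ℕ → ℕ → ℕ) (c : Cmd) (s : State) (T : ℕ) (Q : State → Prop) : Prop :=
  Bounded B s → ∃ (t : ℕ) (s' : State),
    Exec inp c s t s' ∧ t ≤ T * (2 * B + 1) ∧ Bounded B s' ∧ Q s'

variable {B : ℕ} {inp : ℕ → ℕ → ℕ} {c c₁ c₂ : Cmd} {s : State} {T T' T₁ T₂ : ℕ}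
  {Q Q' R : State → Prop}

theorem Runs.mono (h : Runs B inp c s T Q) (hT : T ≤ T') (hQ : ∀ s', Q s' → Q' s') :
    Runs B inp c s T' Q' := fun hs => by
  obtain ⟨t, s', he, ht, hb, hq⟩ := h hs
  exact ⟨t, s', he, ht.trans (Nat.mul_le_mul_right _ hT), hb, hQ s' hq⟩

theorem Runs.seq (h₁ : Runs B inp c₁ s T₁ R) (h₂ : ∀ s', R s' → Runs B inp c₂ s' T₂ Q) :
    Runs B inp (c₁ ;; c₂) s (T₁ + T₂) Q := fun hs => by
  obtain ⟨t, s', he, ht, hb, hq⟩ := h₁ hs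
  obtain ⟨t', s'', he', ht', hb', hq'⟩ := h₂ s' hq hb
  exact ⟨t + t', s'', .seq he he', by rw [add_mul]; omega, hb', hq'⟩

theorem Runs.ite {r : ℕ} (h₁ : s.reg r ≠ 0 → Runs B inp c₁ s T Q)
    (h₂ : s.reg r = 0 → Runs B inp c₂ s T Q) :
    Runs B inp (.ite r c₁ c₂) s (T + 1) Q := fun hs => by
  have hsz : (s.reg r).size ≤ B := Nat.size_le.2 (hs.reg r)
  by_cases h : s.reg r = 0
  · obtain ⟨t, s', he, ht, hb, hq⟩ := h₂ h hs
    exact ⟨_, s', .ite_false h he, by rw [add_mul]; omega, hb, hq⟩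
  · obtain ⟨t, s', he, ht, hb, hq⟩ := h₁ h hs
    exact ⟨_, s', .ite_true h he, by rw [add_mul]; omega, hb, hq⟩

/-- A loop with an invariant indexed by the number of remaining iterations. -/
theorem Runs.loop {r : ℕ} (I : ℕ → State → Prop)
    (h0 : ∀ s, I 0 s → s.reg r = 0)
    (hstep : ∀ v s, I (v + 1) s → s.reg r ≠ 0 ∧ Runs B inp c s T (I v)) (N : ℕ) :
    ∀ s, I N s → Runs B inp (.loop r c) s (N * (T + 1) + 1) (I 0) := by
  induction N with
  | zero =>
    intro s hI hs
    have hsz : (s.reg r).size ≤ B := Nat.size_le.2 (hs.reg r)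
    exact ⟨_, s, .loop_done (h0 s hI), by omega, hs, hI⟩
  | succ N ih =>
    intro s hI hs
    have hsz : (s.reg r).size ≤ B := Nat.size_le.2 (hs.reg r)
    obtain ⟨hr, h⟩ := hstep N s hI
    obtain ⟨t, s', he, ht, hb, hq⟩ := h hs
    obtain ⟨t', s'', he', ht', hb', hq'⟩ := ih s' hq hb
    refine ⟨_, s'', .loop_step hr he he', ?_, hb', hq'⟩
    have : ((N + 1) * (T + 1) + 1) * (2 * B + 1)
        = (N * (T + 1) + 1) * (2 * B + 1) + T * (2 * B + 1) + (2 * B + 1) := by ring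
    omega

/-! ### Frames -/

/-- Whether `c` contains an instruction that writes to the register `x`. -/
def Cmd.writes (x : ℕ) : Cmd → Bool
  | .const r _ | .arith _ r _ _ | .load r _ | .read r _ _ => x == r
  | .store _ _ => false
  | .seq c₁ c₂ | .ite _ c₁ c₂ => c₁.writes x || c₂.writes x
  | .loop _ c => c.writes x

/-- Whether `c` contains an instruction that writes to the memory. -/
def Cmd.stores : Cmd → Bool
  | .const _ _ | .arith _ _ _ _ | .load _ _ | .read _ _ _ => false
  | .store _ _ => true
  | .seq c₁ c₂ | .ite _ c₁ c₂ => c₁.stores || c₂.stores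
  | .loop _ c => c.stores

/-- `s'` differs from `s` only where `c` can write. -/
structure Frame (c : Cmd) (s s' : State) : Prop where
  reg : ∀ x, c.writes x = false → s'.reg x = s.reg x
  mem : c.stores = false → s'.mem = s.mem

theorem Exec.frame {t : ℕ} {s' : State} (h : Exec inp c s t s') : Frame c s s' := by
  induction h with
  | const | arith | load | read =>
    exact ⟨fun x hx => by simp_all [Cmd.writes], fun _ => rfl⟩
  | store => exact ⟨fun x hx => rfl, fun h => by simp [Cmd.stores] at h⟩
  | seq _ _ ih₁ ih₂ =>
    refine ⟨fun x hx => ?_, fun h => ?_⟩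
    · simp only [Cmd.writes, Bool.or_eq_false_iff] at hx
      rw [ih₂.reg x hx.2, ih₁.reg x hx.1]
    · simp only [Cmd.stores, Bool.or_eq_false_iff] at h
      rw [ih₂.mem h.2, ih₁.mem h.1]
  | ite_true _ _ ih =>
    refine ⟨fun x hx => ?_, fun h => ?_⟩
    · simp only [Cmd.writes, Bool.or_eq_false_iff] at hx
      exact ih.reg x hx.1
    · simp only [Cmd.stores, Bool.or_eq_false_iff] at h
      exact ih.mem h.1
  | ite_false _ _ ih =>
    refine ⟨fun x hx => ?_, fun h => ?_⟩
    · simp only [Cmd.writes, Bool.or_eq_false_iff] at hx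
      exact ih.reg x hx.2
    · simp only [Cmd.stores, Bool.or_eq_false_iff] at h
      exact ih.mem h.2
  | loop_done => exact ⟨fun _ _ => rfl, fun _ => rfl⟩
  | loop_step _ _ _ ih₁ ih₂ =>
    refine ⟨fun x hx => ?_, fun h => ?_⟩
    · rw [ih₂.reg x hx, ih₁.reg x hx]
    · rw [ih₂.mem h, ih₁.mem h]

/-- Specifications only have to mention what a program changes. What it leaves alone is read off the
program text by `rfl` or `decide`. -/
theorem Runs.frame (h : Runs B inp c s T Q) :
    Runs B inp c s T fun s' => Q s' ∧ Frame c s s' := fun hs => by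
  obtain ⟨t, s', he, ht, hb, hq⟩ := h hs
  exact ⟨t, s', he, ht, hb, hq, he.frame⟩

/-- Brings the bound inside `Runs` into the context, for instance to bound a number because it
stands in a register. -/
theorem Runs.of_bounded (h : Bounded B s → Runs B inp c s T Q) : Runs B inp c s T Q :=
  fun hs => h hs hs

/-! ### Loop-free programs -/

/-- The effect of a loop-free program. -/
def Cmd.eval (inp : ℕ → ℕ → ℕ) : Cmd → State → State
  | .const r k, s => s.setReg r k
  | .arith o r a b, s => s.setReg r (o.eval (s.reg a) (s.reg b))
  | .load r a, s => s.setReg r (s.mem (s.reg a))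
  | .store a r, s => s.setMem (s.reg a) (s.reg r)
  | .read r i k, s => s.setReg r (inp (s.reg i) (s.reg k))
  | .seq c₁ c₂, s => c₂.eval inp (c₁.eval inp s)
  | .ite r c₁ c₂, s => if s.reg r = 0 then c₂.eval inp s else c₁.eval inp s
  | .loop _ _, s => s

/-- The number of steps of a loop-free program. -/
def Cmd.steps : Cmd → ℕ
  | .seq c₁ c₂ => c₁.steps + c₂.steps
  | .ite _ c₁ c₂ => max c₁.steps c₂.steps + 1
  | .loop _ _ => 0
  | _ => 1

/-- The program is loop-free and keeps every number below `2 ^ B`. -/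
def Cmd.Safe (B : ℕ) (inp : ℕ → ℕ → ℕ) : Cmd → State → Prop
  | .const _ k, _ => k < 2 ^ B
  | .arith .add _ a b, s => s.reg a + s.reg b < 2 ^ B
  | .arith .mul _ a b, s => s.reg a * s.reg b < 2 ^ B
  | .read _ i k, s => inp (s.reg i) (s.reg k) < 2 ^ B
  | .seq c₁ c₂, s => c₁.Safe B inp s ∧ c₂.Safe B inp (c₁.eval inp s)
  | .ite r c₁ c₂, s => (s.reg r ≠ 0 → c₁.Safe B inp s) ∧ (s.reg r = 0 → c₂.Safe B inp s)
  | .loop _ _, _ => False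
  | _, _ => True

theorem runs_eval (c : Cmd) : ∀ s, c.Safe B inp s →
    Runs B inp c s c.steps fun s' => s' = c.eval inp s := by
  induction c with
  | const r k =>
    intro s h hs
    have := Nat.size_le.2 h
    exact ⟨_, _, .const s r k, by simp only [Cmd.steps]; omega, hs.setReg r h, rfl⟩
  | arith o r a b =>
    intro s h hs
    have ha := Nat.size_le.2 (hs.reg a)
    have hb := Nat.size_le.2 (hs.reg b)
    refine ⟨_, _, .arith s o r a b, by simp only [Cmd.steps]; omega, hs.setReg r ?_, rfl⟩
    cases o with
    | add => exact h
    | mul => exact h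
    | sub => exact (Nat.sub_le _ _).trans_lt (hs.reg a)
    | div => exact (Nat.div_le_self _ _).trans_lt (hs.reg a)
  | load r a =>
    intro s h hs
    have ha := Nat.size_le.2 (hs.reg a)
    have hb := Nat.size_le.2 (hs.mem (s.reg a))
    exact ⟨_, _, .load s r a, by simp only [Cmd.steps]; omega, hs.setReg r (hs.mem _), rfl⟩
  | store a r =>
    intro s h hs
    have ha := Nat.size_le.2 (hs.reg a)
    have hb := Nat.size_le.2 (hs.reg r)
    exact ⟨_, _, .store s a r, by simp only [Cmd.steps]; omega, hs.setMem _ (hs.reg _), rfl⟩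
  | read r i k =>
    intro s h hs
    have ha := Nat.size_le.2 (hs.reg i)
    have hb := Nat.size_le.2 (hs.reg k)
    exact ⟨_, _, .read s r i k, by simp only [Cmd.steps]; omega, hs.setReg _ h, rfl⟩
  | seq c₁ c₂ ih₁ ih₂ =>
    intro s h
    refine (ih₁ s h.1).seq ?_
    rintro s' rfl
    exact ih₂ _ h.2
  | ite r c₁ c₂ ih₁ ih₂ =>
    intro s h
    refine Runs.ite (fun h0 => ?_) (fun h0 => ?_)
    · exact (ih₁ s (h.1 h0)).mono (le_max_left _ _) (fun s' hs' => by simp [Cmd.eval, h0, hs'])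
    · exact (ih₂ s (h.2 h0)).mono (le_max_right _ _) (fun s' hs' => by simp [Cmd.eval, h0, hs'])
  | loop r c => exact fun s h => h.elim

/-- Run a loop-free program, with the bound on the initial state at hand. -/
theorem Runs.straight (hT : c.steps ≤ T) (hsafe : Bounded B s → c.Safe B inp s)
    (hQ : Q (c.eval inp s)) : Runs B inp c s T Q :=
  fun hs => (runs_eval c s (hsafe hs)).mono hT (fun _ h => h ▸ hQ) hs

/-! ### Counting loops -/

/-- The register that holds constants for a moment. -/
abbrev tmp : ℕ := 99

def decr (r : ℕ) : Cmd := .const tmp 1 ;; .arith .sub r r tmp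

def incr (r : ℕ) : Cmd := .const tmp 1 ;; .arith .add r r tmp

def move (r a : ℕ) : Cmd := .const tmp 0 ;; .arith .add r a tmp

/-- Run `c` with the values `N - 1, …, 0` in the register `r`, which holds `N` at first. -/
def countdown (r : ℕ) (c : Cmd) : Cmd := .loop r (decr r ;; c)

/-- A counting loop with an invariant indexed by the number of completed iterations. -/
theorem Runs.countdown {r N : ℕ} (I : ℕ → State → Prop) (hB : 1 < 2 ^ B)
    (hw : c.writes r = false) (hr : r ≠ tmp) (hN : s.reg r = N) (h0 : I 0 s)
    (hI : ∀ j s u, I j s → I j ((s.setReg tmp 1).setReg r u))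
    (hc : ∀ j < N, ∀ s', Frame (countdown r c) s s' → s'.reg r = N - (j + 1) → I j s' →
      Runs B inp c s' T (I (j + 1))) :
    Runs B inp (countdown r c) s (N * (T + 3) + 1) fun s' =>
      I N s' ∧ Frame (LightBulb.countdown r c) s s' := by
  have main := Runs.loop (B := B) (inp := inp) (r := r) (c := decr r ;; c) (T := 2 + T)
    (fun v s' => v ≤ N ∧ s'.reg r = v ∧ I (N - v) s' ∧ Frame (LightBulb.countdown r c) s s')
    (fun s' h => h.2.1)
    (fun v s' ⟨hv, hrv, hIv, hF⟩ => by
      refine ⟨by omega, ?_⟩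
      have hd : Runs B inp (decr r) s' 2 fun s'' => s'' = (s'.setReg tmp 1).setReg r v := by
        refine Runs.straight le_rfl (fun _ => ⟨hB, trivial⟩) ?_
        simp [decr, Cmd.eval, Op.eval, hrv, hr]
      refine hd.seq ?_
      rintro _ rfl
      have hF' : Frame (LightBulb.countdown r c) s ((s'.setReg tmp 1).setReg r v) := by
        refine ⟨fun x hx => ?_, fun h => hF.mem h⟩
        have hx' := hx
        simp only [LightBulb.countdown, decr, Cmd.writes, Bool.or_eq_false_iff] at hx'
        have h1 : x ≠ tmp := by simpa using hx'.1.1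
        have h2 : x ≠ r := by simpa using hx'.1.2
        simp [h1, h2, hF.reg x hx]
      have := hc (N - (v + 1)) (by omega) _ hF'
        (by rw [State.reg_setReg, if_pos rfl]; omega) (hI _ _ _ hIv)
      refine this.frame.mono le_rfl ?_
      rintro s'' ⟨h1, h2⟩
      refine ⟨by omega, ?_, ?_, ?_⟩
      · rw [h2.reg r hw]; simp
      · have e : N - v = N - (v + 1) + 1 := by omega
        rw [e]; exact h1
      · refine ⟨fun x hx => ?_, fun h => ?_⟩
        · rw [h2.reg x, hF'.reg x hx]
          simp only [LightBulb.countdown, Cmd.writes, Bool.or_eq_false_iff] at hx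
          exact hx.2
        · rw [h2.mem, hF'.mem h]
          simpa [LightBulb.countdown, Cmd.stores, decr] using h)
    N s ⟨le_rfl, hN, by simpa using h0, ⟨fun _ _ => rfl, fun _ => rfl⟩⟩
  refine main.mono (by ring_nf; omega) ?_
  rintro s' ⟨-, -, h1, h2⟩
  exact ⟨by simpa using h1, h2⟩

end LightBulb

namespace LightBulb

/-! ### Bit words -/

/-- The number of ones among the lowest `m` binary digits of `v`. -/
def wt (m v : ℕ) : ℕ := ((Finset.range m).filter fun i => v.testBit i).card

theorem wt_le (m v : ℕ) : wt m v ≤ m := by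
  simpa [wt] using Finset.card_filter_le (Finset.range m) fun i => v.testBit i

theorem wt_succ (m v : ℕ) : wt (m + 1) v = wt m v + v / 2 ^ m % 2 := by
  have h : v.testBit m = decide (v / 2 ^ m % 2 = 1) := Nat.testBit_eq_decide_div_mod_eq
  rw [wt, Finset.range_add_one, Finset.filter_insert]
  rcases Nat.mod_two_eq_zero_or_one (v / 2 ^ m) with h2 | h2
  · rw [h2] at h
    simp [h, h2, wt]
  · rw [h2] at h
    simp [h, h2, wt]

theorem wt_zero_right (m : ℕ) : wt m 0 = 0 := by simp [wt]

theorem hammingDist_word (m v w : ℕ) :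
    hammingDist (word m v) (word m w) = wt m (v ^^^ w) := by
  rw [hammingDist, wt, Finset.card_filter, Finset.card_filter,
    ← Fin.sum_univ_eq_sum_range (fun i => if (v ^^^ w).testBit i = true then 1 else 0)]
  refine Finset.sum_congr rfl fun i _ => ?_
  by_cases h : v.testBit i = w.testBit i <;> simp [word, h]

theorem xor_mod_two_pow_succ (x y j : ℕ) :
    (x ^^^ y) % 2 ^ (j + 1) = (x ^^^ y) % 2 ^ j + (x ^^^ y) / 2 ^ j % 2 * 2 ^ j := by
  rw [pow_succ, Nat.mod_mul, mul_comm (2 ^ j)]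

/-- The machine has no bitwise operations. A digit of an exclusive or is the parity of a sum, and
parities can be computed by halving and subtracting. -/
theorem xor_div_two_pow_mod_two (x y j : ℕ) :
    (x ^^^ y) / 2 ^ j % 2 = (x / 2 ^ j + y / 2 ^ j) % 2 := by
  have h : ((x ^^^ y) / 2 ^ j) = (x / 2 ^ j) ^^^ (y / 2 ^ j) := by
    simp only [← Nat.shiftRight_eq_div_pow, Nat.shiftRight_xor_distrib]
  rw [h, Nat.xor_mod_two_eq]

/-- The number whose binary digits are the bits `off, …, off + K - 1` of the string `i`. -/
def readBits (inp : ℕ → ℕ → ℕ) (i off : ℕ) : ℕ → ℕ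
  | 0 => 0
  | K + 1 => readBits inp i off K + inp i (off + K) * 2 ^ K

theorem readBits_lt {inp : ℕ → ℕ → ℕ} (hinp : ∀ i k, inp i k ≤ 1) (i off K : ℕ) :
    readBits inp i off K < 2 ^ K := by
  induction K with
  | zero => simp [readBits]
  | succ K ih =>
    rw [readBits, pow_succ]
    have := Nat.mul_le_mul_right (2 ^ K) (hinp i (off + K))
    omega

theorem testBit_readBits {inp : ℕ → ℕ → ℕ} (hinp : ∀ i k, inp i k ≤ 1) (i off K p : ℕ) :
    (readBits inp i off K).testBit p = decide (p < K ∧ inp i (off + p) = 1) := by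
  induction K with
  | zero => simp [readBits]
  | succ K ih =>
    rw [readBits, add_comm, mul_comm, Nat.testBit_two_pow_mul_add _ (readBits_lt hinp i off K), ih]
    split
    · have : p < K + 1 := by omega
      simp [*]
    · rcases Nat.lt_or_ge K p with h | h
      · have h1 : ¬ p < K + 1 := by omega
        have h2 : inp i (off + K) / 2 ^ (p - K) = 0 := by
          have := hinp i (off + K)
          have h3 : 2 ^ 1 ≤ 2 ^ (p - K) := Nat.pow_le_pow_right (by omega) (by omega)
          exact Nat.div_eq_of_lt (by omega)
        simp [h1, Nat.testBit_eq_decide_div_mod_eq, h2]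
      · have : p = K := by omega
        subst this
        have := hinp i (off + p)
        rcases Nat.le_one_iff_eq_zero_or_eq_one.1 this with h | h <;> simp [h]

/-- The number of positions among `off, …, off + K - 1` where the strings `i` and `j` differ. -/
def mismatches (inp : ℕ → ℕ → ℕ) (i j off K : ℕ) : ℕ :=
  ((Finset.range K).filter fun p => inp i (off + p) ≠ inp j (off + p)).card

theorem wt_xor_readBits {inp : ℕ → ℕ → ℕ} (hinp : ∀ i k, inp i k ≤ 1) (i j off K : ℕ) :
    wt K (readBits inp i off K ^^^ readBits inp j off K) = mismatches inp i j off K := by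
  rw [wt, mismatches]
  congr 1
  refine Finset.filter_congr fun p hp => ?_
  have hp' := Finset.mem_range.1 hp
  have h1 := hinp i (off + p)
  have h2 := hinp j (off + p)
  rw [Nat.testBit_xor, testBit_readBits hinp, testBit_readBits hinp]
  rcases Nat.le_one_iff_eq_zero_or_eq_one.1 h1 with h | h <;>
    rcases Nat.le_one_iff_eq_zero_or_eq_one.1 h2 with h' | h' <;> simp [h, h', hp']

/-! ### Subroutines -/

variable {B : ℕ} {inp : ℕ → ℕ → ℕ} {s : State}

/-- Add the next binary digit of the exclusive or of the registers `40` and `41` to the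
exclusive or (in `43`) and to the weight (in `44`); the register `45` holds the power of two. -/
def xorStep : Cmd :=
  .arith .add 46 40 41 ;; .const tmp 2 ;; .arith .div 47 46 tmp ;; .arith .add 47 47 47 ;;
  .arith .sub 46 46 47 ;; .arith .add 44 44 46 ;; .arith .mul 46 46 45 ;; .arith .add 43 43 46 ;;
  .arith .add 45 45 45 ;; .arith .div 40 40 tmp ;; .arith .div 41 41 tmp

/-- The exclusive or of the registers `a`, `b`, taken as words with as many bits as `k` says,
is put into the register `43`, and its weight into the register `44`. -/
def xorWeight (a b k : ℕ) : Cmd :=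
  (move 40 a ;; move 41 b ;; move 42 k ;; .const 43 0 ;; .const 44 0 ;; .const 45 1) ;;
  countdown 42 xorStep

/-- The subroutines keep their scratch values in registers from 40 on, so callers that work below 40
find their registers unchanged. -/
theorem runs_xorWeight {a b k K : ℕ} (ha : a < 40) (hb : b < 40) (hk : k < 40)
    (hK : s.reg k = K) (hx : s.reg a < 2 ^ K) (hy : s.reg b < 2 ^ K) (hB : K + 2 ≤ B) :
    Runs B inp (xorWeight a b k) s (14 * K + 10) fun s' =>
      s'.reg 43 = s.reg a ^^^ s.reg b ∧ s'.reg 44 = wt K (s.reg a ^^^ s.reg b) ∧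
      (∀ x < 40, s'.reg x = s.reg x) ∧ s'.mem = s.mem := by
  set x := s.reg a with hxd
  set y := s.reg b with hyd
  -- Two spare bits are needed, for the power of two in register 45, which reaches 2 ^ K, and for
  -- the sum of two words.
  have hKB : 2 ^ (K + 2) ≤ 2 ^ B := Nat.pow_le_pow_right (by omega) hB
  rw [pow_add] at hKB
  have hKp : 1 ≤ 2 ^ K := Nat.one_le_two_pow
  have hKK : K < 2 ^ K := Nat.lt_two_pow_self
  have hfr : ∀ s', Frame (xorWeight a b k) s s' →
      (∀ x < 40, s'.reg x = s.reg x) ∧ s'.mem = s.mem := by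
    intro s' h
    refine ⟨fun x hx => h.reg x ?_, h.mem rfl⟩
    simp [xorWeight, move, countdown, decr, xorStep, tmp, Cmd.writes]
    omega
  suffices h : Runs B inp (xorWeight a b k) s (14 * K + 10) fun s' =>
      s'.reg 43 = x ^^^ y ∧ s'.reg 44 = wt K (x ^^^ y) from
    h.frame.mono le_rfl fun s' h => ⟨h.1.1, h.1.2, hfr s' h.2⟩
  refine Runs.mono (T := 9 + (K * (11 + 3) + 1)) (Q := fun s' =>
      s'.reg 43 = x ^^^ y ∧ s'.reg 44 = wt K (x ^^^ y)) ?_ (by omega) (fun _ h => h)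
  have ha' : a ≠ tmp ∧ a ≠ 40 ∧ a ≠ 41 ∧ a ≠ 42 := by simp [tmp]; omega
  have hb' : b ≠ tmp ∧ b ≠ 40 ∧ b ≠ 41 ∧ b ≠ 42 := by simp [tmp]; omega
  have hk' : k ≠ tmp ∧ k ≠ 40 ∧ k ≠ 41 ∧ k ≠ 42 := by simp [tmp]; omega
  refine Runs.seq (R := fun s' => s'.reg 40 = x ∧ s'.reg 41 = y ∧ s'.reg 42 = K ∧
    s'.reg 43 = 0 ∧ s'.reg 44 = 0 ∧ s'.reg 45 = 1) ?_ ?_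
  · refine Runs.straight (by simp [Cmd.steps, move]) (fun hs => ?_) ?_
    · simp [Cmd.Safe, move, Cmd.eval, Op.eval, ha', hb', hk', hK]
      omega
    · simp [move, Cmd.eval, Op.eval, ha', hb', hk', hK, ← hxd, ← hyd]
  · rintro s₁ ⟨h40, h41, h42, h43, h44, h45⟩
    refine (Runs.countdown (T := 11) (fun j s' => s'.reg 40 = x / 2 ^ j ∧ s'.reg 41 = y / 2 ^ j ∧
      s'.reg 43 = (x ^^^ y) % 2 ^ j ∧ s'.reg 44 = wt j (x ^^^ y) ∧ s'.reg 45 = 2 ^ j)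
      (by omega) rfl (by decide) h42 ?_ ?_ ?_).mono le_rfl ?_
    · simp [h40, h41, h43, h44, h45, wt, Nat.mod_one]
    · rintro j s u h
      simpa using h
    · rintro j hj s' - - ⟨h40, h41, h43, h44, h45⟩
      have hx' := (Nat.div_le_self x (2 ^ j)).trans_lt hx
      have hy' := (Nat.div_le_self y (2 ^ j)).trans_lt hy
      -- The next digit, as the sum minus twice its half.
      have e : (x / 2 ^ j + y / 2 ^ j) - ((x / 2 ^ j + y / 2 ^ j) / 2 + (x / 2 ^ j + y / 2 ^ j) / 2)
          = (x ^^^ y) / 2 ^ j % 2 := by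
        rw [xor_div_two_pow_mod_two]; omega
      have hj1 : 2 ^ (j + 1) ≤ 2 ^ K := Nat.pow_le_pow_right (by omega) hj
      rw [pow_succ] at hj1
      have hb1 : (x ^^^ y) / 2 ^ j % 2 ≤ 1 := by omega
      have hb2 := Nat.mul_le_mul_right (2 ^ j) hb1
      have hz : (x ^^^ y) % 2 ^ j < 2 ^ j := Nat.mod_lt _ (by positivity)
      have hw := wt_le j (x ^^^ y)
      refine Runs.straight (by simp [Cmd.steps, xorStep]) (fun hs => ?_) ?_
      · simp [Cmd.Safe, xorStep, Cmd.eval, Op.eval, h40, h41, h43, h44, h45, e]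
        omega
      · have e₂ := xor_mod_two_pow_succ x y j
        rw [pow_succ, mul_two] at e₂
        simp [xorStep, Cmd.eval, Op.eval, h40, h41, h43, h44, h45, e, e₂,
          wt_succ, pow_succ, Nat.div_div_eq_div_mul, mul_two]
    · rintro s' ⟨⟨-, -, h1, h2, -⟩, -⟩
      exact ⟨by rw [h1, Nat.mod_eq_of_lt (Nat.xor_lt_two_pow hx hy)], h2⟩

def readStep (a : ℕ) : Cmd :=
  .read 54 a 51 ;; .arith .mul 54 54 53 ;; .arith .add 52 52 54 ;; .arith .add 53 53 53 ;; incr 51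

/-- Read as many bits as the register `k` says of the string in the register `a`, from the
position in the register `o` on, and put the number with these binary digits into `52`. -/
def readWord (a o k : ℕ) : Cmd :=
  (move 51 o ;; move 55 k ;; .const 52 0 ;; .const 53 1) ;; countdown 55 (readStep a)

theorem runs_readWord {a o k K : ℕ} (hinp : ∀ i k, inp i k ≤ 1)
    (ha : a < 40) (ho : o < 40) (hk : k < 40)
    (hK : s.reg k = K) (hB : K + 2 ≤ B) (hoB : s.reg o + K < 2 ^ B) :
    Runs B inp (readWord a o k) s (9 * K + 7) fun s' =>
      s'.reg 52 = readBits inp (s.reg a) (s.reg o) K ∧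
      (∀ x < 40, s'.reg x = s.reg x) ∧ s'.mem = s.mem := by
  have hKB : 2 ^ (K + 2) ≤ 2 ^ B := Nat.pow_le_pow_right (by omega) hB
  rw [pow_add] at hKB
  have hKp : 1 ≤ 2 ^ K := Nat.one_le_two_pow
  have hKK : K < 2 ^ K := Nat.lt_two_pow_self
  have hfr : ∀ s', Frame (readWord a o k) s s' →
      (∀ x < 40, s'.reg x = s.reg x) ∧ s'.mem = s.mem := by
    intro s' h
    refine ⟨fun x hx => h.reg x ?_, h.mem rfl⟩
    simp [readWord, move, countdown, decr, readStep, incr, tmp, Cmd.writes]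
    omega
  set i := s.reg a with hi
  suffices h : Runs B inp (readWord a o k) s (9 * K + 7) fun s' =>
      s'.reg 52 = readBits inp i (s.reg o) K from
    h.frame.mono le_rfl fun s' h => ⟨h.1, hfr s' h.2⟩
  refine Runs.mono (T := 6 + (K * (6 + 3) + 1)) (Q := fun s' =>
      s'.reg 52 = readBits inp i (s.reg o) K) ?_ (by omega) (fun _ h => h)
  have ha' : a ≠ tmp ∧ a ≠ 51 ∧ a ≠ 52 ∧ a ≠ 53 ∧ a ≠ 54 ∧ a ≠ 55 := by simp [tmp]; omega
  have ho' : o ≠ tmp ∧ o ≠ 51 := by simp [tmp]; omega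
  have hk' : k ≠ tmp ∧ k ≠ 51 := by simp [tmp]; omega
  refine Runs.seq (R := fun s' => s'.reg a = i ∧ s'.reg 51 = s.reg o ∧ s'.reg 52 = 0 ∧
    s'.reg 53 = 1 ∧ s'.reg 55 = K) ?_ ?_
  · refine Runs.straight (by simp [Cmd.steps, move]) (fun hs => ?_) ?_
    · simp [Cmd.Safe, move, Cmd.eval, Op.eval, ho', hk', hK]
      omega
    · simp [move, Cmd.eval, Op.eval, ha', ho', hk', hK, ← hi]
  · rintro s₁ ⟨h40, h51, h52, h53, h55⟩
    refine (Runs.countdown (T := 6) (fun j s' => s'.reg a = i ∧ s'.reg 51 = s.reg o + j ∧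
      s'.reg 52 = readBits inp i (s.reg o) j ∧ s'.reg 53 = 2 ^ j)
      (by omega) rfl (by decide) h55 ?_ ?_ ?_).mono le_rfl ?_
    · simp [h40, h51, h52, h53, readBits]
    · rintro j s u h
      simpa [ha'] using h
    · rintro j hj s' - - ⟨h40, h51, h52, h53⟩
      have hj1 : 2 ^ (j + 1) ≤ 2 ^ K := Nat.pow_le_pow_right (by omega) hj
      rw [pow_succ] at hj1
      have hb := hinp i (s.reg o + j)
      have hb2 := Nat.mul_le_mul_right (2 ^ j) hb
      have hz := readBits_lt hinp i (s.reg o) j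
      refine Runs.straight (by simp [Cmd.steps, readStep, incr]) (fun hs => ?_) ?_
      · simp [Cmd.Safe, readStep, incr, Cmd.eval, Op.eval, h40, h51, h52, h53]
        omega
      · simp [readStep, incr, Cmd.eval, Op.eval, h40, h51, h52, h53, ha', readBits, pow_succ,
          mul_two, add_assoc]
    · rintro s' ⟨⟨-, -, h1, -⟩, -⟩
      exact h1

/-- Put two to the power that the register `a` holds into the register `r`. -/
def powTwo (r a : ℕ) : Cmd :=
  (move 60 a ;; .const r 1) ;; countdown 60 (.arith .add r r r)

theorem runs_powTwo {r a K : ℕ} (ha : a < 40) (hr : r < 40)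
    (hK : s.reg a = K) (hB : K + 2 ≤ B) :
    Runs B inp (powTwo r a) s (4 * K + 4) fun s' =>
      s'.reg r = 2 ^ K ∧ (∀ x < 40, x ≠ r → s'.reg x = s.reg x) ∧ s'.mem = s.mem := by
  have hKB : 2 ^ (K + 2) ≤ 2 ^ B := Nat.pow_le_pow_right (by omega) hB
  rw [pow_add] at hKB
  have hKp : 1 ≤ 2 ^ K := Nat.one_le_two_pow
  have hKK : K < 2 ^ K := Nat.lt_two_pow_self
  have hfr : ∀ s', Frame (powTwo r a) s s' →
      (∀ x < 40, x ≠ r → s'.reg x = s.reg x) ∧ s'.mem = s.mem := by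
    intro s' h
    refine ⟨fun x hx hxr => h.reg x ?_, h.mem rfl⟩
    simp [powTwo, move, countdown, decr, tmp, Cmd.writes]
    omega
  suffices h : Runs B inp (powTwo r a) s (4 * K + 4) fun s' => s'.reg r = 2 ^ K from
    h.frame.mono le_rfl fun s' h => ⟨h.1, hfr s' h.2⟩
  refine Runs.mono (T := 3 + (K * (1 + 3) + 1)) (Q := fun s' => s'.reg r = 2 ^ K) ?_ (by omega)
    (fun _ h => h)
  have ha' : a ≠ tmp ∧ a ≠ 60 := by simp [tmp]; omega
  have hr' : r ≠ tmp ∧ r ≠ 60 := by simp [tmp]; omega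
  have hr60 : 60 ≠ r := by omega
  refine Runs.seq (R := fun s' => s'.reg 60 = K ∧ s'.reg r = 1) ?_ ?_
  · refine Runs.straight (by simp [Cmd.steps, move]) (fun hs => ?_) ?_
    · simp [Cmd.Safe, move, Cmd.eval, ha', hK]
      omega
    · simp [move, Cmd.eval, Op.eval, ha', hK, hr60]
  · rintro s₁ ⟨h60, h1⟩
    refine (Runs.countdown (T := 1) (fun j s' => s'.reg r = 2 ^ j)
      (by omega) (by simp [Cmd.writes, hr60]) (by decide) h60 ?_ ?_ ?_).mono le_rfl ?_
    · simp [h1]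
    · rintro j s u h
      simpa [hr'] using h
    · rintro j hj s' - - h
      have hj1 : 2 ^ (j + 1) ≤ 2 ^ K := Nat.pow_le_pow_right (by omega) hj
      rw [pow_succ] at hj1
      refine Runs.straight (by simp [Cmd.steps]) (fun hs => ?_) ?_
      · simp [Cmd.Safe, h]
        omega
      · simp [Cmd.eval, Op.eval, h, pow_succ, mul_two]
    · rintro s' ⟨h1, -⟩
      exact h1

end LightBulb

namespace LightBulb

/-! ### Linear codes reached by the greedy procedure -/

theorem wt_xor_triangle (m u v w : ℕ) : wt m (u ^^^ w) ≤ wt m (v ^^^ u) + wt m (v ^^^ w) := by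
  rw [← hammingDist_word, ← hammingDist_word, ← hammingDist_word,
    hammingDist_comm (word m v) (word m u)]
  exact hammingDist_triangle _ _ _

theorem word_injOn {m v w : ℕ} (hv : v < 2 ^ m) (hw : w < 2 ^ m) (h : word m v = word m w) :
    v = w := by
  refine Nat.eq_of_testBit_eq fun i => ?_
  by_cases hi : i < m
  · exact congrFun h ⟨i, hi⟩
  · have hi' : 2 ^ m ≤ 2 ^ i := Nat.pow_le_pow_right (by omega) (by omega)
    rw [Nat.testBit_lt_two_pow (by omega), Nat.testBit_lt_two_pow (by omega)]

theorem exists_word (m : ℕ) (y : Fin m → Bool) : ∃ v < 2 ^ m, word m v = y := by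
  have hinj : Function.Injective (fun v : Fin (2 ^ m) => word m v) :=
    fun v w h => Fin.ext (word_injOn v.2 w.2 h)
  have hbij := (Fintype.bijective_iff_injective_and_card _).2 ⟨hinj, by simp⟩
  obtain ⟨v, hv⟩ := hbij.2 y
  exact ⟨v, v.2, hv⟩

/-- The words at distance more than `d` from the code `C`. -/
def farWords (m d : ℕ) (C : Finset ℕ) : Set (Fin m → Bool) :=
  {y | ∀ c ∈ C, d < hammingDist (word m c) y}

/-- A linear code of minimum distance more than `d` that the greedy procedure can reach; the
words are given by their binary codes. -/
structure GreedyLinear (m d : ℕ) (C : Finset ℕ) : Prop where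
  zero_mem : 0 ∈ C
  lt : ∀ c ∈ C, c < 2 ^ m
  xor_mem : ∀ b ∈ C, ∀ c ∈ C, b ^^^ c ∈ C
  lt_wt : ∀ c ∈ C, c ≠ 0 → d < wt m c
  run : GilbertRun m d (farWords m d C) (word m '' (C : Set ℕ))

theorem greedyLinear_zero (m d : ℕ) : GreedyLinear m d {0} := by
  refine ⟨by simp, by simp, by simp, by simp, ?_⟩
  have h := GilbertRun.pick (word m 0) (GilbertRun.start (m := m) (d := d)) trivial
  convert h using 1
  · ext y; simp [farWords]
  · simp

/-- The code spanned by the linear code `C` and the word `x`. -/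
def extend (C : Finset ℕ) (x : ℕ) : Finset ℕ := C ∪ C.image (· ^^^ x)

theorem extend_zero (C : Finset ℕ) : extend C 0 = C := by simp [extend]

theorem xor_xor_comm (v c x : ℕ) : v ^^^ (c ^^^ x) = (v ^^^ x) ^^^ c := by
  rw [Nat.xor_comm c x, Nat.xor_assoc]

/-- The coset of x can be picked word by word. A word b ⊕ x differs from a codeword by x plus a
codeword, which has weight more than d since x is far. It differs from an earlier pick of the coset
by a nonzero codeword. Hence no pick removes a later one, and the enlarged linear code is still
reachable greedily. -/
theorem GreedyLinear.extend {m d x : ℕ} {C : Finset ℕ} (h : GreedyLinear m d C) (hx : x < 2 ^ m)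
    (hfar : ∀ c ∈ C, d < wt m (x ^^^ c)) : GreedyLinear m d (extend C x) := by
  -- `T` is the part of the coset, shifted back into `C`, that has already been picked.
  have hrun : ∀ T ⊆ C, GilbertRun m d (farWords m d (C ∪ T.image (· ^^^ x)))
      (word m '' ((C ∪ T.image (· ^^^ x) : Finset ℕ) : Set ℕ)) := by
    intro T
    induction T using Finset.induction_on with
    | empty => intro _; simpa using h.run
    | insert b T hb ih =>
      intro hT
      have hbC : b ∈ C := hT (Finset.mem_insert_self _ _)
      have hTC : T ⊆ C := fun _ h => hT (Finset.mem_insert_of_mem h)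
      have hmem : word m (b ^^^ x) ∈ farWords m d (C ∪ T.image (· ^^^ x)) := by
        intro c hc
        rw [hammingDist_word]
        rcases Finset.mem_union.1 hc with hc | hc
        · have := hfar _ (h.xor_mem _ hbC _ hc)
          rwa [show c ^^^ (b ^^^ x) = x ^^^ (b ^^^ c) by
            rw [xor_xor_comm, Nat.xor_comm c x, Nat.xor_assoc, Nat.xor_comm c b]]
        · obtain ⟨c', hc', rfl⟩ := Finset.mem_image.1 hc
          have e : (c' ^^^ x) ^^^ (b ^^^ x) = c' ^^^ b := by
            rw [xor_xor_comm, Nat.xor_assoc c' x x, Nat.xor_self, Nat.xor_zero]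
          simp only [e]
          refine h.lt_wt _ (h.xor_mem _ (hTC hc') _ hbC) fun h0 => ?_
          have : c' = b := by simpa using h0
          exact hb (this ▸ hc')
      have := GilbertRun.pick _ (ih hTC) hmem
      convert this using 1
      · ext y
        simp only [farWords, Finset.image_insert, Set.mem_ofPred_eq, Set.mem_sdiff, Finset.mem_union,
          Finset.mem_insert, not_le]
        constructor
        · exact fun H => ⟨fun c hc => H c (by tauto), H _ (by tauto)⟩
        · rintro ⟨H1, H2⟩ c (hc | rfl | hc)
          · exact H1 c (Or.inl hc)
          · exact H2
          · exact H1 c (Or.inr hc)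
      · rw [Finset.image_insert, Finset.union_insert, Finset.coe_insert, Set.image_insert_eq]
  have hmem : ∀ c, c ∈ LightBulb.extend C x ↔ c ∈ C ∨ c ^^^ x ∈ C := by
    intro c
    simp only [LightBulb.extend, Finset.mem_union, Finset.mem_image]
    refine or_congr_right ⟨?_, fun hc => ⟨_, hc, by simp⟩⟩
    rintro ⟨c', hc', rfl⟩
    simpa [Nat.xor_assoc] using hc'
  refine ⟨(hmem 0).2 (Or.inl h.zero_mem), fun c hc => ?_, fun b hb c hc => ?_,
    fun c hc h0 => ?_, hrun C subset_rfl⟩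
  · rcases (hmem c).1 hc with hc | hc
    · exact h.lt c hc
    · have := Nat.xor_lt_two_pow (h.lt _ hc) hx
      simpa [Nat.xor_assoc] using this
  · rw [hmem]
    rcases (hmem b).1 hb with hb | hb <;> rcases (hmem c).1 hc with hc | hc
    · exact Or.inl (h.xor_mem _ hb _ hc)
    · right
      have := h.xor_mem _ hb _ hc
      rwa [← Nat.xor_assoc] at this
    · right
      have := h.xor_mem _ hb _ hc
      rwa [Nat.xor_assoc, Nat.xor_comm x c, ← Nat.xor_assoc] at this
    · left
      have := h.xor_mem _ hb _ hc
      rwa [xor_xor_comm, Nat.xor_assoc b x x, Nat.xor_self, Nat.xor_zero] at this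
  · rcases (hmem c).1 hc with hc | hc
    · exact h.lt_wt c hc h0
    · have := hfar _ hc
      rwa [xor_xor_comm, Nat.xor_self, Nat.zero_xor] at this

/-- If the code met its translate, x would itself be a codeword and so not far from the code. The
doubling is what bounds the number of rounds. -/
theorem GreedyLinear.card_extend {m d x : ℕ} {C : Finset ℕ} (h : GreedyLinear m d C)
    (hfar : ∀ c ∈ C, d < wt m (x ^^^ c)) : (LightBulb.extend C x).card = 2 * C.card := by
  rw [LightBulb.extend, Finset.card_union_of_disjoint, Finset.card_image_of_injective, two_mul]
  · intro a b hab
    exact Nat.xor_left_injective hab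
  · rw [Finset.disjoint_left]
    intro c hc hc'
    obtain ⟨b, hb, rfl⟩ := Finset.mem_image.1 hc'
    have h1 := h.xor_mem _ hb _ hc
    rw [← Nat.xor_assoc, Nat.xor_self, Nat.zero_xor] at h1
    have h2 := hfar _ h1
    rw [Nat.xor_self, wt_zero_right] at h2
    omega

/-- `N v` is a word of the code `C` that is nearest to `v`. -/
def NearestIn (m : ℕ) (C : Finset ℕ) (N : ℕ → ℕ) (v : ℕ) : Prop :=
  N v ∈ C ∧ ∀ c ∈ C, wt m (v ^^^ N v) ≤ wt m (v ^^^ c)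

theorem GreedyLinear.isGilbertCode {m d : ℕ} {C : Finset ℕ} {N : ℕ → ℕ} (h : GreedyLinear m d C)
    (hN : ∀ v < 2 ^ m, NearestIn m C N v) (hcov : ∀ v < 2 ^ m, wt m (v ^^^ N v) ≤ d) :
    IsGilbertCode m d (word m '' (C : Set ℕ)) := by
  have : farWords m d C = ∅ := by
    refine Set.eq_empty_of_forall_notMem fun y hy => ?_
    obtain ⟨v, hv, rfl⟩ := exists_word m y
    have h1 := hy _ (hN v hv).1
    rw [hammingDist_word, Nat.xor_comm] at h1
    have := hcov v hv
    omega
  have h1 := h.run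
  rwa [this] at h1

/-- If some codeword lies within the decoding radius of v, so does the nearest one. Their distance
is then at most d - 1 (at most 0 if d = 0), so they coincide. It therefore suffices to test the
nearest codeword alone. -/
theorem GreedyLinear.isDecodingTable {m d : ℕ} {C : Finset ℕ} {N mem : ℕ → ℕ}
    (h : GreedyLinear m d C) (hN : ∀ v < 2 ^ m, NearestIn m C N v)
    (hmem : ∀ v < 2 ^ m, mem v = if wt m (v ^^^ N v) ≤ (d - 1) / 2 then N v + 1 else 0) :
    IsDecodingTable m d (word m '' (C : Set ℕ)) mem := by
  refine fun v hv => ⟨fun w hw hwC hvw => ?_, fun hfar => ?_⟩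
  · obtain ⟨c, hc, hcw⟩ := hwC
    obtain rfl := word_injOn (h.lt c hc) hw hcw
    rw [hammingDist_word] at hvw
    obtain ⟨h1, h2⟩ := hN v hv
    have h3 := h2 c hc
    rw [hmem v hv, if_pos (by omega)]
    by_contra hne
    have h4 := h.lt_wt _ (h.xor_mem _ h1 _ hc) fun h0 => hne (by
      have : N v = c := by simpa using h0
      rw [this])
    have := wt_xor_triangle m (N v) v c
    omega
  · rw [hmem v hv, if_neg]
    have := hfar _ ⟨N v, (hN v hv).1, rfl⟩
    rw [hammingDist_word] at this
    omega

end LightBulb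

namespace LightBulb

/-! ### The preprocessing program

The register `1` holds the block length `m`, the register `2` the distance `d`, the register `3`
the number `2 ^ m`. The cell `v` holds the codeword nearest to `v`. -/

variable {B : ℕ} {inp : ℕ → ℕ → ℕ} {s : State}

def findFarStep : Cmd :=
  .load 7 5 ;; xorWeight 5 7 1 ;; .arith .sub 8 44 2 ;; .ite 8 (move 6 5) (.const tmp 0)

/-- Put a word at distance more than `d` from the code into the register `6`, or zero. -/
def findFar : Cmd := (.const 6 0 ;; move 5 3) ;; countdown 5 findFarStep

/-- By translation, a word of the coset C ⊕ x nearest to v is N(v ⊕ x) ⊕ x, where N is the table of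
nearest words. It replaces the entry of v only if it is strictly closer. -/
def updateStep : Cmd :=
  xorWeight 5 6 1 ;; .load 7 43 ;; xorWeight 7 6 1 ;; move 7 43 ;; xorWeight 5 7 1 ;;
  (move 8 44 ;; .load 9 5) ;; xorWeight 5 9 1 ;;
  .arith .sub 8 44 8 ;; .ite 8 (.store 5 7) (.const tmp 0)

/-- Pass to the code spanned by the old code and the word in the register `6`. -/
def updateCode : Cmd := move 5 3 ;; countdown 5 updateStep

def decodeStep : Cmd :=
  .load 7 5 ;; xorWeight 5 7 1 ;; .arith .sub 8 44 10 ;; .ite 8 (.const 7 0) (incr 7) ;; .store 5 7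

/-- Replace the nearest codewords by the entries of the decoding table. -/
def finishTable : Cmd :=
  (.const tmp 1 ;; .arith .sub 10 2 tmp ;; .const tmp 2 ;; .arith .div 10 10 tmp ;; move 5 3) ;;
  countdown 5 decodeStep

def preprocess : Cmd :=
  powTwo 3 1 ;; (move 4 1 ;; incr 4) ;; countdown 4 (findFar ;; updateCode) ;; finishTable

/-- A word is far from the code exactly if it is far from its nearest codeword. Zero can stand for
"no far word", since it belongs to the code. -/
theorem runs_findFar {m d : ℕ} {C : Finset ℕ} (hC : GreedyLinear m d C) (hB : m + 2 ≤ B)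
    (h1 : s.reg 1 = m) (h2 : s.reg 2 = d) (h3 : s.reg 3 = 2 ^ m)
    (hN : ∀ v < 2 ^ m, NearestIn m C s.mem v) :
    Runs B inp findFar s (2 ^ m * (14 * m + 18) + 4) fun s' =>
      (s'.reg 6 < 2 ^ m ∧ (s'.reg 6 = 0 ∨ d < wt m (s'.reg 6 ^^^ s.mem (s'.reg 6))) ∧
      ∀ v < 2 ^ m, d < wt m (v ^^^ s.mem v) → d < wt m (s'.reg 6 ^^^ s.mem (s'.reg 6))) ∧
      Frame findFar s s' := by
  have hKB : 2 ^ (m + 2) ≤ 2 ^ B := Nat.pow_le_pow_right (by omega) hB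
  rw [pow_add] at hKB
  have hKp : 1 ≤ 2 ^ m := Nat.one_le_two_pow
  refine Runs.frame ?_
  refine Runs.mono (T := 3 + (2 ^ m * ((14 * m + 15) + 3) + 1)) ?_ (by ring_nf; omega) fun _ h => h
  refine Runs.seq (R := fun s' => s'.reg 1 = m ∧ s'.reg 2 = d ∧ s'.reg 5 = 2 ^ m ∧ s'.reg 6 = 0 ∧
    s'.mem = s.mem) ?_ ?_
  · refine Runs.straight (by simp [Cmd.steps, move]) (fun hs => ?_) ?_
    · simp [Cmd.Safe, move, Cmd.eval, h3]
      omega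
    · simp [move, Cmd.eval, Op.eval, h1, h2, h3]
  · rintro s₁ ⟨g1, g2, g5, g6, gm⟩
    refine (Runs.countdown (fun j s' => s'.reg 6 < 2 ^ m ∧
      (s'.reg 6 = 0 ∨ d < wt m (s'.reg 6 ^^^ s.mem (s'.reg 6))) ∧
      ∀ v < 2 ^ m, 2 ^ m - j ≤ v → d < wt m (v ^^^ s.mem v) →
        d < wt m (s'.reg 6 ^^^ s.mem (s'.reg 6)))
      (by omega) rfl (by decide) g5 ?_ ?_ ?_).mono le_rfl ?_
    · exact ⟨by omega, Or.inl g6, fun v hv hv' => by omega⟩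
    · rintro j s u h
      simpa using h
    · rintro j hj s' hf k5 ⟨i1, i2, i3⟩
      have k1 : s'.reg 1 = m := by rw [hf.reg 1 rfl, g1]
      have k2 : s'.reg 2 = d := by rw [hf.reg 2 rfl, g2]
      have km : s'.mem = s.mem := by rw [hf.mem rfl, gm]
      set v := s'.reg 5 with hv
      have hvm : v < 2 ^ m := by omega
      have hNv := hC.lt _ (hN v hvm).1
      refine Runs.mono (T := 1 + ((14 * m + 10) + 4)) ?_ (by omega) fun _ h => h
      refine Runs.seq (R := fun t => t = s'.setReg 7 (s.mem v)) ?_ ?_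
      · refine Runs.straight (by simp [Cmd.steps]) (fun hs => trivial) ?_
        simp [Cmd.eval, km, ← hv]
      rintro _ rfl
      refine Runs.seq (runs_xorWeight (K := m) (by omega) (by omega) (by omega) (by simpa using k1)
        (by simpa using hvm) (by simpa using hNv) hB) ?_
      rintro t ⟨-, t44, tr, -⟩
      have t2 : t.reg 2 = d := by rw [tr 2 (by omega)]; simpa using k2
      have t5 : t.reg 5 = v := by rw [tr 5 (by omega)]; simp [hv]
      have t6 : t.reg 6 = s'.reg 6 := by rw [tr 6 (by omega)]; simp
      simp only [State.reg_setReg, ↓reduceIte, Nat.reduceEqDiff, ← hv] at t44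
      by_cases hd : d < wt m (v ^^^ s.mem v)
      · have hne : wt m (v ^^^ s.mem v) - d ≠ 0 := by omega
        refine Runs.straight (by simp [Cmd.steps, move]) (fun hs => ?_) ?_
        · simp [Cmd.Safe, move, Cmd.eval, Op.eval, t44, t2, t5]
          omega
        · simp only [Cmd.eval, Op.eval, t44, t2, t5, move, State.reg_setReg, ↓reduceIte, hne]
          simp [hvm, hd]
      · have hz : wt m (v ^^^ s.mem v) - d = 0 := by omega
        refine Runs.straight (by simp [Cmd.steps, move]) (fun hs => ?_) ?_
        · simp [Cmd.Safe, move, Cmd.eval, Op.eval, t44, t2, t5]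
          omega
        · simp only [Cmd.eval, Op.eval, t44, t2, State.reg_setReg, ↓reduceIte, hz]
          simp only [tmp, Nat.reduceEqDiff, ↓reduceIte, t6]
          refine ⟨i1, i2, fun w hw hjw hdw => ?_⟩
          rcases Nat.eq_or_lt_of_le hjw with h | h
          · have : w = v := by omega
            subst this
            exact absurd hdw hd
          · exact i3 w hw (by omega) hdw
    · rintro s' ⟨⟨i1, i2, i3⟩, -⟩
      exact ⟨i1, i2, fun v hv => i3 v hv (by omega)⟩

/-- The table is changed in place, so the entry of v ⊕ x may be old or new when v is treated. The
invariant covers both: each entry lies in the extended code and is at least as near as every word of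
the old one, and the candidate for v needs no more. The word x need not be far from the code, so x =
0 is covered as well. -/
theorem runs_updateCode {m x : ℕ} {C : Finset ℕ} (hC : ∀ c ∈ extend C x, c < 2 ^ m)
    (hB : m + 2 ≤ B)
    (h1 : s.reg 1 = m) (h3 : s.reg 3 = 2 ^ m) (h6 : s.reg 6 = x) (hx : x < 2 ^ m)
    (hN : ∀ v < 2 ^ m, NearestIn m C s.mem v) :
    Runs B inp updateCode s (2 ^ m * (56 * m + 52) + 3) fun s' =>
      (∀ v < 2 ^ m, NearestIn m (extend C x) s'.mem v) ∧ Frame updateCode s s' := by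
  have hKB : 2 ^ (m + 2) ≤ 2 ^ B := Nat.pow_le_pow_right (by omega) hB
  rw [pow_add] at hKB
  have hKp : 1 ≤ 2 ^ m := Nat.one_le_two_pow
  have hKK : m < 2 ^ m := Nat.lt_two_pow_self
  refine Runs.frame ?_
  refine Runs.mono (T := 2 + (2 ^ m * ((56 * m + 49) + 3) + 1)) ?_ (by ring_nf; omega) fun _ h => h
  refine Runs.seq (R := fun s' => s'.reg 1 = m ∧ s'.reg 6 = x ∧ s'.reg 5 = 2 ^ m ∧
    s'.mem = s.mem) ?_ ?_
  · refine Runs.straight (by simp [Cmd.steps, move]) (fun hs => ?_) ?_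
    · simp [Cmd.Safe, move, Cmd.eval, h3]
      omega
    · simp [move, Cmd.eval, Op.eval, h1, h3, h6]
  rintro s₁ ⟨g1, g6, g5, gm⟩
  refine (Runs.countdown (fun j s' => ∀ v < 2 ^ m, s'.mem v ∈ extend C x ∧
    (∀ c ∈ C, wt m (v ^^^ s'.mem v) ≤ wt m (v ^^^ c)) ∧
    (2 ^ m - j ≤ v → ∀ c ∈ extend C x, wt m (v ^^^ s'.mem v) ≤ wt m (v ^^^ c)))
    (by omega) rfl (by decide) g5 ?_ ?_ ?_).mono le_rfl ?_
  · intro v hv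
    rw [gm]
    exact ⟨Finset.mem_union_left _ (hN v hv).1, (hN v hv).2, by omega⟩
  · rintro j s u h
    simpa using h
  · rintro j hj s' hf k5 hI
    have k1 : s'.reg 1 = m := by rw [hf.reg 1 rfl, g1]
    have k6 : s'.reg 6 = x := by rw [hf.reg 6 rfl, g6]
    set v := s'.reg 5 with hv
    set N := s'.mem with hNd
    have hvm : v < 2 ^ m := by omega
    have hum : v ^^^ x < 2 ^ m := Nat.xor_lt_two_pow hvm hx
    obtain ⟨hv1, hv2, -⟩ := hI v hvm
    obtain ⟨hu1, hu2, -⟩ := hI _ hum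
    have hNu := hC _ hu1
    have hNv := hC _ hv1
    set cand := N (v ^^^ x) ^^^ x with hcand
    have hcl : cand < 2 ^ m := Nat.xor_lt_two_pow hNu hx
    have hce : cand ∈ extend C x := by
      rw [extend, Finset.mem_union, Finset.mem_image] at hu1 ⊢
      rcases hu1 with h | ⟨c, hc, hc'⟩
      · exact Or.inr ⟨_, h, rfl⟩
      · left
        rw [hcand, ← hc']
        simpa using hc
    have hcw : wt m (v ^^^ cand) = wt m ((v ^^^ x) ^^^ N (v ^^^ x)) := by
      rw [hcand, xor_xor_comm]
    have hw1 := wt_le m (v ^^^ cand)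
    refine Runs.mono (T := (14 * m + 10) + (1 + ((14 * m + 10) + (2 + ((14 * m + 10) +
      (3 + ((14 * m + 10) + 3))))))) ?_ (by omega) fun _ h => h
    refine Runs.seq (runs_xorWeight (K := m) (by omega) (by omega) (by omega) k1
      hvm (by rw [k6]; exact hx) hB) ?_
    rintro t₁ ⟨a43, -, ar, am⟩
    refine Runs.seq (R := fun t => t = t₁.setReg 7 (N (v ^^^ x))) ?_ ?_
    · refine Runs.straight (by simp [Cmd.steps]) (fun hs => trivial) ?_
      simp [Cmd.eval, am, a43, k6, ← hNd, ← hv]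
    rintro _ rfl
    refine Runs.seq (runs_xorWeight (K := m) (by omega) (by omega) (by omega)
      (by simp [ar 1, k1]) (by simpa using hNu) (by simpa [ar 6, k6] using hx) hB) ?_
    rintro t₂ ⟨b43, -, br, bm⟩
    simp only [State.reg_setReg, ↓reduceIte, Nat.reduceEqDiff, ar 6 (by omega),
      k6, ← hcand, State.mem_setReg, am] at b43 bm
    refine Runs.seq (R := fun t => t = (t₂.setReg tmp 0).setReg 7 cand) ?_ ?_
    · refine Runs.straight (by simp [Cmd.steps, move]) (fun hs => ?_) ?_
      · simp [Cmd.Safe, move, Cmd.eval, b43]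
        omega
      · simp [move, Cmd.eval, Op.eval, b43]
    rintro _ rfl
    have b1 : t₂.reg 1 = m := by rw [br 1 (by omega)]; simp [ar 1, k1]
    have b5 : t₂.reg 5 = v := by rw [br 5 (by omega)]; simp [ar 5, hv]
    refine Runs.seq (runs_xorWeight (K := m) (by omega) (by omega) (by omega)
      (by simp [b1]) (by simpa [b5] using hvm) (by simpa using hcl) hB) ?_
    rintro t₃ ⟨-, c44, cr, cm⟩
    have c1 : t₃.reg 1 = m := by rw [cr 1 (by omega)]; simp [b1]
    have c5 : t₃.reg 5 = v := by rw [cr 5 (by omega)]; simp [b5]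
    have c7 : t₃.reg 7 = cand := by rw [cr 7 (by omega)]; simp
    simp only [State.reg_setReg, ↓reduceIte, tmp, Nat.reduceEqDiff, b5,
      State.mem_setReg, bm] at c44 cm
    refine Runs.seq (R := fun t => t.reg 1 = m ∧ t.reg 5 = v ∧ t.reg 7 = cand ∧
      t.reg 8 = wt m (v ^^^ cand) ∧ t.reg 9 = N v ∧ t.mem = N) ?_ ?_
    · refine Runs.straight (by simp [Cmd.steps, move]) (fun hs => ?_) ?_
      · simp [Cmd.Safe, move, Cmd.eval, c44]
        omega
      · simp [move, Cmd.eval, Op.eval, c1, c5, c7, c44, cm, ← hNd]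
    rintro t₄ ⟨d1, d5, d7, d8, d9, dm⟩
    refine Runs.seq (runs_xorWeight (K := m) (by omega) (by omega) (by omega)
      d1 (by rw [d5]; exact hvm) (by rw [d9]; exact hNv) hB) ?_
    rintro t₅ ⟨-, e44, er, em⟩
    have e5 : t₅.reg 5 = v := by rw [er 5 (by omega), d5]
    have e7 : t₅.reg 7 = cand := by rw [er 7 (by omega), d7]
    have e8 : t₅.reg 8 = wt m (v ^^^ cand) := by rw [er 8 (by omega), d8]
    rw [d5, d9] at e44
    rw [dm] at em
    -- What the entry of v must satisfy, whichever branch is taken: it competes with `C` through the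
    -- old entry and with the coset through the candidate.
    have key : ∀ M : ℕ → ℕ, (∀ w, w ≠ v → M w = N w) → M v ∈ extend C x →
        wt m (v ^^^ M v) ≤ wt m (v ^^^ N v) → wt m (v ^^^ M v) ≤ wt m (v ^^^ cand) →
        ∀ w < 2 ^ m, M w ∈ extend C x ∧ (∀ c ∈ C, wt m (w ^^^ M w) ≤ wt m (w ^^^ c)) ∧
        (2 ^ m - (j + 1) ≤ w → ∀ c ∈ extend C x, wt m (w ^^^ M w) ≤ wt m (w ^^^ c)) := by
      intro M hM hMv hM1 hM2 w hw
      by_cases hwv : w = v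
      · subst hwv
        refine ⟨hMv, fun c hc => hM1.trans (hv2 c hc), fun _ c hc => ?_⟩
        rw [extend, Finset.mem_union, Finset.mem_image] at hc
        rcases hc with hc | ⟨c, hc, rfl⟩
        · exact hM1.trans (hv2 c hc)
        · rw [hcw] at hM2
          simp only [xor_xor_comm v c x]
          exact hM2.trans (hu2 c hc)
      · rw [hM w hwv]
        obtain ⟨i1, i2, i3⟩ := hI w hw
        exact ⟨i1, i2, fun h => i3 (by omega)⟩
    by_cases hlt : wt m (v ^^^ cand) < wt m (v ^^^ N v)
    · have hne : wt m (v ^^^ N v) - wt m (v ^^^ cand) ≠ 0 := by omega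
      refine Runs.straight (by simp [Cmd.steps]) (fun hs => ?_) ?_
      · simp [Cmd.Safe, Cmd.eval, Op.eval, e44, e8]
      · simp only [Cmd.eval, Op.eval, e44, e8, State.reg_setReg, ↓reduceIte, hne,
          Nat.reduceEqDiff, e5, e7]
        refine key _ (fun w hw => ?_) ?_ ?_ ?_ <;>
          simp only [State.mem_setMem, State.mem_setReg, em, ↓reduceIte]
        · simp [hw]
        · exact hce
        · exact hlt.le
        · exact le_rfl
    · have hz : wt m (v ^^^ N v) - wt m (v ^^^ cand) = 0 := by omega
      refine Runs.straight (by simp [Cmd.steps]) (fun hs => ?_) ?_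
      · simp [Cmd.Safe, Cmd.eval, Op.eval, e44, e8]
      · simp only [Cmd.eval, Op.eval, e44, e8, State.reg_setReg, ↓reduceIte, hz]
        simp only [State.mem_setReg, em]
        exact key _ (fun w hw => rfl) hv1 le_rfl (by omega)
  · rintro s' ⟨hI, -⟩ v hv
    obtain ⟨i1, -, i3⟩ := hI v hv
    exact ⟨i1, i3 (by omega)⟩

theorem runs_finishTable {m d : ℕ} {C : Finset ℕ} (hC : GreedyLinear m d C) (hB : m + 2 ≤ B)
    (h1 : s.reg 1 = m) (h2 : s.reg 2 = d) (h3 : s.reg 3 = 2 ^ m)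
    (hN : ∀ v < 2 ^ m, NearestIn m C s.mem v) :
    Runs B inp finishTable s (2 ^ m * (14 * m + 19) + 7) fun s' =>
      ∀ v < 2 ^ m, s'.mem v =
        if wt m (v ^^^ s.mem v) ≤ (d - 1) / 2 then s.mem v + 1 else 0 := by
  have hKB : 2 ^ (m + 2) ≤ 2 ^ B := Nat.pow_le_pow_right (by omega) hB
  rw [pow_add] at hKB
  have hKp : 1 ≤ 2 ^ m := Nat.one_le_two_pow
  refine Runs.mono (T := 6 + (2 ^ m * ((14 * m + 16) + 3) + 1)) ?_ (by ring_nf; omega) fun _ h => h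
  refine Runs.seq (R := fun s' => s'.reg 1 = m ∧ s'.reg 10 = (d - 1) / 2 ∧ s'.reg 5 = 2 ^ m ∧
    s'.mem = s.mem) ?_ ?_
  · refine Runs.straight (by simp [Cmd.steps, move]) (fun hs => ?_) ?_
    · simp [Cmd.Safe, move, Cmd.eval, h3]
      omega
    · simp [move, Cmd.eval, Op.eval, h1, h2, h3]
  rintro s₁ ⟨g1, g10, g5, gm⟩
  refine (Runs.countdown (fun j s' => ∀ v < 2 ^ m, s'.mem v = if v < 2 ^ m - j then s.mem v else
      if wt m (v ^^^ s.mem v) ≤ (d - 1) / 2 then s.mem v + 1 else 0)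
    (by omega) rfl (by decide) g5 ?_ ?_ ?_).mono le_rfl ?_
  · intro v hv
    rw [gm, if_pos (by omega)]
  · rintro j s u h
    simpa using h
  · rintro j hj s' hf k5 hI
    have k1 : s'.reg 1 = m := by rw [hf.reg 1 rfl, g1]
    have k10 : s'.reg 10 = (d - 1) / 2 := by rw [hf.reg 10 rfl, g10]
    set v := s'.reg 5 with hv
    have hvm : v < 2 ^ m := by omega
    have km : s'.mem v = s.mem v := by rw [hI v hvm, if_pos (by omega)]
    have hNv := hC.lt _ (hN v hvm).1
    refine Runs.mono (T := 1 + ((14 * m + 10) + 5)) ?_ (by omega) fun _ h => h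
    refine Runs.seq (R := fun t => t = s'.setReg 7 (s.mem v)) ?_ ?_
    · refine Runs.straight (by simp [Cmd.steps]) (fun hs => trivial) ?_
      simp [Cmd.eval, km, ← hv]
    rintro _ rfl
    refine Runs.seq (runs_xorWeight (K := m) (by omega) (by omega) (by omega) (by simpa using k1)
      (by simpa using hvm) (by simpa using hNv) hB) ?_
    rintro t ⟨-, t44, tr, tm⟩
    have t10 : t.reg 10 = (d - 1) / 2 := by rw [tr 10 (by omega)]; simpa using k10
    have t5 : t.reg 5 = v := by rw [tr 5 (by omega)]; simp [hv]
    have t7 : t.reg 7 = s.mem v := by rw [tr 7 (by omega)]; simp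
    simp only [State.reg_setReg, ↓reduceIte, Nat.reduceEqDiff, ← hv,
      State.mem_setReg] at t44 tm
    refine Runs.straight (by simp [Cmd.steps, incr]) (fun hs => ?_) ?_
    · simp [Cmd.Safe, Cmd.eval, Op.eval, incr, t44, t10, t7]
      omega
    · intro w hw
      have hIw := hI w hw
      by_cases hd : wt m (v ^^^ s.mem v) ≤ (d - 1) / 2
      · have hz : wt m (v ^^^ s.mem v) - (d - 1) / 2 = 0 := by omega
        simp only [Cmd.eval, Op.eval, incr, t44, t10, State.reg_setReg, ↓reduceIte, hz,
          State.mem_setMem]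
        simp only [tmp, Nat.reduceEqDiff, ↓reduceIte, t5, t7, State.mem_setReg, tm]
        by_cases hwv : w = v
        · subst hwv
          rw [if_pos rfl, if_neg (by omega), if_pos hd]
        · rw [if_neg hwv, hIw]
          congr 1
          simp only [eq_iff_iff]
          omega
      · have hne : wt m (v ^^^ s.mem v) - (d - 1) / 2 ≠ 0 := by omega
        simp only [Cmd.eval, Op.eval, t44, t10, State.reg_setReg, ↓reduceIte, hne,
          State.mem_setMem]
        simp only [Nat.reduceEqDiff, ↓reduceIte, t5, State.mem_setReg, tm]
        by_cases hwv : w = v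
        · subst hwv
          rw [if_pos rfl, if_neg (by omega), if_neg hd]
        · rw [if_neg hwv, hIw]
          congr 1
          simp only [eq_iff_iff]
          omega
  · rintro s' ⟨hI, -⟩ v hv
    rw [hI v hv, if_neg (by omega)]

/-- Each round doubles the code or finds that every word is already within distance d of it. After m
+ 1 doublings the code would have more than 2 ^ m words, so covering must have been reached. -/
theorem runs_preprocess {m d : ℕ} (hB : m + 2 ≤ B)
    (h1 : s.reg 1 = m) (h2 : s.reg 2 = d) (hm : ∀ a, s.mem a = 0) :
    Runs B inp preprocess s (2 ^ m * (300 * (m + 1) ^ 2)) fun s' =>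
      ∃ K, IsGilbertCode m d K ∧ IsDecodingTable m d K s'.mem := by
  have hKB : 2 ^ (m + 2) ≤ 2 ^ B := Nat.pow_le_pow_right (by omega) hB
  rw [pow_add] at hKB
  have hKp : 1 ≤ 2 ^ m := Nat.one_le_two_pow
  have hKK : m < 2 ^ m := Nat.lt_two_pow_self
  refine Runs.mono (T := (4 * m + 4) + (4 + (((m + 1) * (((2 ^ m * (14 * m + 18) + 4) +
    (2 ^ m * (56 * m + 52) + 3)) + 3) + 1) + (2 ^ m * (14 * m + 19) + 7)))) ?_ ?_ fun _ h => h
  · refine Runs.seq (runs_powTwo (by omega) (by omega) h1 hB) ?_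
    rintro s₁ ⟨g3, gr, gm⟩
    refine Runs.seq (R := fun s' => s'.reg 1 = m ∧ s'.reg 2 = d ∧ s'.reg 3 = 2 ^ m ∧
      s'.reg 4 = m + 1 ∧ ∀ a, s'.mem a = 0) ?_ ?_
    · refine Runs.straight (by simp [Cmd.steps, move, incr]) (fun hs => ?_) ?_
      · simp [Cmd.Safe, move, incr, Cmd.eval, Op.eval, gr, h1]
        omega
      · simp [move, incr, Cmd.eval, Op.eval, gr, h1, h2, g3, gm, hm]
    rintro s₂ ⟨k1, k2, k3, k4, km⟩
    refine Runs.seq (Runs.countdown (fun j s' => ∃ C, GreedyLinear m d C ∧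
      (∀ v < 2 ^ m, NearestIn m C s'.mem v) ∧
      ((∀ v < 2 ^ m, wt m (v ^^^ s'.mem v) ≤ d) ∨ 2 ^ j ≤ C.card))
      (by omega) rfl (by decide) k4 ?_ ?_ ?_) ?_
    · refine ⟨{0}, greedyLinear_zero m d, fun v hv => ?_, Or.inr (by simp)⟩
      simp [NearestIn, km]
    · rintro j s u h
      simpa using h
    · rintro j hj s' hf - ⟨C, hC, hN, hcov⟩
      have e1 : s'.reg 1 = m := by rw [hf.reg 1 rfl, k1]
      have e2 : s'.reg 2 = d := by rw [hf.reg 2 rfl, k2]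
      have e3 : s'.reg 3 = 2 ^ m := by rw [hf.reg 3 rfl, k3]
      refine Runs.seq (runs_findFar hC hB e1 e2 e3 hN) ?_
      rintro t ⟨⟨hx, hx0, hxf⟩, htf⟩
      have f1 : t.reg 1 = m := by rw [htf.reg 1 rfl, e1]
      have f3 : t.reg 3 = 2 ^ m := by rw [htf.reg 3 rfl, e3]
      have fm : t.mem = s'.mem := htf.mem rfl
      set x := t.reg 6 with hxd
      by_cases hfar : d < wt m (x ^^^ s'.mem x)
      · have hfar' : ∀ c ∈ C, d < wt m (x ^^^ c) := fun c hc =>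
          hfar.trans_le ((hN x hx).2 c hc)
        have hC' := hC.extend hx hfar'
        refine (runs_updateCode hC'.lt hB f1 f3 rfl hx (by rwa [fm])).mono le_rfl ?_
        rintro t' ⟨hN', -⟩
        refine ⟨_, hC', hN', Or.inr ?_⟩
        rcases hcov with hcov | hcov
        · exact absurd (hcov x hx) (by omega)
        · rw [hC.card_extend hfar', pow_succ]
          omega
      -- Nothing is far: the update then runs with x = 0, for which the extension is `C` again.
      · have hx0' : x = 0 := hx0.resolve_right hfar
        have hcov' : ∀ v < 2 ^ m, wt m (v ^^^ s'.mem v) ≤ d := fun v hv => by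
          by_contra hd
          exact hfar (hxf v hv (by omega))
        refine (runs_updateCode (C := C) (by rw [← hxd, hx0', extend_zero]; exact hC.lt) hB f1 f3
          rfl hx (by rwa [fm])).mono le_rfl ?_
        rintro t' ⟨hN', -⟩
        rw [← hxd, hx0', extend_zero] at hN'
        refine ⟨C, hC, hN', Or.inl fun v hv => ?_⟩
        exact ((hN' v hv).2 _ (hN v hv).1).trans (hcov' v hv)
    · rintro s' ⟨⟨C, hC, hN, hcov⟩, hf⟩
      have e1 : s'.reg 1 = m := by rw [hf.reg 1 rfl, k1]
      have e2 : s'.reg 2 = d := by rw [hf.reg 2 rfl, k2]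
      have e3 : s'.reg 3 = 2 ^ m := by rw [hf.reg 3 rfl, k3]
      have hcov' : ∀ v < 2 ^ m, wt m (v ^^^ s'.mem v) ≤ d := by
        refine hcov.resolve_right fun h => ?_
        have hsub : C ⊆ Finset.range (2 ^ m) := fun c hc => Finset.mem_range.2 (hC.lt c hc)
        have := Finset.card_le_card hsub
        rw [Finset.card_range] at this
        rw [pow_succ] at h
        omega
      refine (runs_finishTable hC hB e1 e2 e3 hN).mono le_rfl fun t ht => ?_
      exact ⟨_, hC.isGilbertCode hN hcov', hC.isDecodingTable hN ht⟩
  · obtain ⟨M, hM⟩ : ∃ M, M = 2 ^ m := ⟨_, rfl⟩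
    rw [← hM] at hKp hKK ⊢
    nlinarith [Nat.mul_le_mul hKp (Nat.le_refl (m * m)), Nat.mul_le_mul hKp (Nat.le_refl m)]

end LightBulb

namespace LightBulb

/-! ### The search program

The register `2` holds the number `n` of strings, `5` the length `k` of a block, `6` the number
`2 ^ k`, `7` and `8` the number of positions compared and the number of mismatches allowed in a
comparison, `12` the number of error patterns, which stand in the first memory cells. The cell
`2 ^ k + h` holds `j + 1` for a string `j` whose current block is `h`. -/

variable {B : ℕ} {inp : ℕ → ℕ → ℕ} {s : State}

/-- Compare the strings in the registers `17` and `21`; output them if they are similar. -/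
def compareStrings : Cmd :=
  readWord 17 30 7 ;; move 22 52 ;; readWord 21 30 7 ;; move 23 52 ;; xorWeight 22 23 7 ;;
  .arith .sub 22 44 8 ;; .ite 22 (.const tmp 0) (move 0 17 ;; move 1 21)

/-- Compare the string `i` in the register `17` with `y - 1`, where the register `21` holds `y`,
if this is a different string. -/
def tryPair : Cmd :=
  (.arith .sub 22 21 2 ;; decr 21 ;; .arith .sub 23 17 21 ;; .arith .sub 24 21 17 ;;
    .arith .add 23 23 24) ;;
  .ite 22 (.const tmp 0) (.ite 23 compareStrings (.const tmp 0))

/-- A probed cell may hold a leftover of an earlier block or of the initial memory. This is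
harmless: `tryPair` rejects indices out of range, and every remaining pair is compared before it is
output. -/
def probeStep : Cmd :=
  .load 20 19 ;; xorWeight 18 20 5 ;; (.arith .add 20 6 43 ;; .load 21 20) ;; tryPair

/-- Look up the block of the string in the register `17` with all error patterns. -/
def probeString : Cmd :=
  readWord 17 16 5 ;; (move 18 52 ;; move 19 12) ;; countdown 19 probeStep

def insertString : Cmd :=
  readWord 17 16 5 ;; .arith .add 20 6 52 ;; move 21 17 ;; incr 21 ;; .store 20 21

/-- Process the block with the number in the register `14`. -/
def searchBlock : Cmd :=
  (.arith .mul 16 14 5 ;; move 17 2) ;; countdown 17 insertString ;;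
  move 17 2 ;; countdown 17 probeString

def patternStep : Cmd :=
  xorWeight 13 30 5 ;; .arith .sub 20 44 10 ;; .ite 20 (.const tmp 0) (.store 12 13 ;; incr 12)

def listPatterns : Cmd := move 13 6 ;; countdown 13 patternStep

def sizeLoop : Cmd := .loop 4 (.const tmp 2 ;; .arith .div 4 4 tmp ;; incr 3)

/-- The parameters, for `A ℓ` compared positions, `D ℓ` allowed mismatches and error patterns of
relative weight `p / q`. -/
def setParams (A D p q : ℕ) : Cmd :=
  .const tmp 3 ;; .arith .add 5 3 tmp ;; .const tmp A ;; .arith .mul 7 3 tmp ;;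
  .const tmp D ;; .arith .mul 8 3 tmp ;; .const tmp 5 ;; .arith .mul 9 3 tmp ;;
  .const tmp p ;; .arith .mul 10 5 tmp ;; .const tmp q ;; .arith .div 10 10 tmp ;;
  .const 12 0 ;; .const 30 0

def searchFrom (A D p q : ℕ) : Cmd :=
  (move 2 0 ;; move 4 0) ;; sizeLoop ;; setParams A D p q ;; powTwo 6 5 ;; listPatterns ;;
  move 14 9 ;; countdown 14 searchBlock

/-- Register `1` initially holds L, which is not bounded in terms of n. Clearing it is what makes
the starting state `Bounded`. -/
def search (A D p q : ℕ) : Cmd := .const 1 0 ;; searchFrom A D p q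

/-- The strings `i`, `j` are different and similar on the first `V` positions. -/
def Similar (inp : ℕ → ℕ → ℕ) (n V thr i j : ℕ) : Prop :=
  i < n ∧ j < n ∧ i ≠ j ∧ mismatches inp i j 0 V ≤ thr

/-- The registers `0` and `1` hold a pair of similar strings. -/
def Found (inp : ℕ → ℕ → ℕ) (n V thr : ℕ) (s : State) : Prop :=
  Similar inp n V thr (s.reg 0) (s.reg 1)

/-- The parameter registers of the search. -/
structure Params (n k V thr cnt : ℕ) (s : State) : Prop where
  r2 : s.reg 2 = n
  r5 : s.reg 5 = k
  r6 : s.reg 6 = 2 ^ k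
  r7 : s.reg 7 = V
  r8 : s.reg 8 = thr
  r12 : s.reg 12 = cnt
  r30 : s.reg 30 = 0

theorem Params.of_eq {n k V thr cnt : ℕ} {s s' : State} (h : Params n k V thr cnt s)
    (he : ∀ x ∈ [2, 5, 6, 7, 8, 12, 30], s'.reg x = s.reg x) : Params n k V thr cnt s' := by
  simp only [List.mem_cons, List.not_mem_nil, or_false, forall_eq_or_imp, forall_eq] at he
  obtain ⟨e2, e5, e6, e7, e8, e12, e30⟩ := he
  exact ⟨e2.trans h.r2, e5.trans h.r5, e6.trans h.r6, e7.trans h.r7, e8.trans h.r8,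
    e12.trans h.r12, e30.trans h.r30⟩

theorem Params.frame {n k V thr cnt : ℕ} {s s' : State} {c : Cmd} (h : Params n k V thr cnt s)
    (hf : Frame c s s') (hc : ∀ x ∈ [2, 5, 6, 7, 8, 12, 30], c.writes x = false) :
    Params n k V thr cnt s' :=
  h.of_eq fun x hx => hf.reg x (hc x hx)

theorem Params.of_lt {n k V thr cnt : ℕ} {s s' : State} (h : Params n k V thr cnt s)
    (he : ∀ x < 40, s'.reg x = s.reg x) : Params n k V thr cnt s' :=
  h.of_eq fun x hx => he x (by
    simp only [List.mem_cons, List.not_mem_nil, or_false] at hx; omega)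

/-- The output registers are only ever overwritten by another similar pair, so `Found` persists once
it holds. -/
theorem runs_compareStrings {n k V thr cnt i j : ℕ} (hinp : ∀ i k, inp i k ≤ 1) (hB : V + 2 ≤ B)
    (hp : Params n k V thr cnt s) (h17 : s.reg 17 = i) (h21 : s.reg 21 = j)
    (hi : i < n) (hj : j < n) (hij : i ≠ j) :
    Runs B inp compareStrings s (32 * V + 34) fun s' =>
      (Found inp n V thr s → Found inp n V thr s') ∧
      (Similar inp n V thr i j → Found inp n V thr s') := by
  have hVB : 2 ^ (V + 2) ≤ 2 ^ B := Nat.pow_le_pow_right (by omega) hB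
  rw [pow_add] at hVB
  have hVp : 1 ≤ 2 ^ V := Nat.one_le_two_pow
  have hVV : V < 2 ^ V := Nat.lt_two_pow_self
  refine Runs.of_bounded fun hbd => ?_
  have hni : i < 2 ^ B := h17 ▸ hbd.reg 17
  have hnj : j < 2 ^ B := h21 ▸ hbd.reg 21
  have hbi := readBits_lt hinp i 0 V
  have hbj := readBits_lt hinp j 0 V
  refine Runs.mono (T := (9 * V + 7) + (2 + ((9 * V + 7) + (2 + ((14 * V + 10) + 6))))) ?_
    (by omega) fun _ h => h
  refine Runs.seq (runs_readWord hinp (by omega) (by omega) (by omega) hp.r7 hB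
    (by rw [hp.r30]; omega)) ?_
  rintro t₁ ⟨a52, ar, -⟩
  rw [h17, hp.r30] at a52
  refine Runs.seq (R := fun t => t = (t₁.setReg tmp 0).setReg 22 (readBits inp i 0 V)) ?_ ?_
  · refine Runs.straight (by simp [Cmd.steps, move]) (fun hs => ?_) ?_
    · simp [Cmd.Safe, move, Cmd.eval, a52]
      omega
    · simp [move, Cmd.eval, Op.eval, a52]
  rintro _ rfl
  refine Runs.seq (runs_readWord (K := V) hinp (by omega) (by omega) (by omega)
    (by simp [ar, hp.r7]) hB (by simp [ar, hp.r30]; omega)) ?_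
  rintro t₂ ⟨b52, br, -⟩
  have b52' : t₂.reg 52 = readBits inp j 0 V := by rw [b52]; simp [ar, h21, hp.r30]
  have b22 : t₂.reg 22 = readBits inp i 0 V := by rw [br 22 (by omega)]; simp
  have bx : ∀ x < 40, x ≠ 22 → t₂.reg x = s.reg x := fun x hx hx' => by
    have : x ≠ tmp := by simp [tmp]; omega
    rw [br x hx, ← ar x hx]; simp [hx', this]
  refine Runs.seq (R := fun t => t = (t₂.setReg tmp 0).setReg 23 (readBits inp j 0 V)) ?_ ?_
  · refine Runs.straight (by simp [Cmd.steps, move]) (fun hs => ?_) ?_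
    · simp [Cmd.Safe, move, Cmd.eval, b52']
      omega
    · simp [move, Cmd.eval, Op.eval, b52']
  rintro _ rfl
  refine Runs.seq (runs_xorWeight (K := V) (by omega) (by omega) (by omega)
    (by simp [bx, hp.r7]) (by simpa [b22] using hbi) (by simpa using hbj) hB) ?_
  rintro t₃ ⟨-, c44, cr, -⟩
  have c44' : t₃.reg 44 = mismatches inp i j 0 V := by
    rw [c44, ← wt_xor_readBits hinp]; simp [b22]
  have cx : ∀ x < 40, x ≠ 22 → x ≠ 23 → t₃.reg x = s.reg x := fun x hx h1 h2 => by
    have : x ≠ tmp := by simp [tmp]; omega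
    rw [cr x hx, ← bx x hx h1]; simp [h2, this]
  have c8 : t₃.reg 8 = thr := by rw [cx 8 (by omega) (by omega) (by omega), hp.r8]
  have c17 : t₃.reg 17 = i := by rw [cx 17 (by omega) (by omega) (by omega), h17]
  have c21 : t₃.reg 21 = j := by rw [cx 21 (by omega) (by omega) (by omega), h21]
  have c0 : t₃.reg 0 = s.reg 0 := cx 0 (by omega) (by omega) (by omega)
  have c1 : t₃.reg 1 = s.reg 1 := cx 1 (by omega) (by omega) (by omega)
  by_cases hm : mismatches inp i j 0 V ≤ thr
  · have hz : mismatches inp i j 0 V - thr = 0 := by omega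
    refine Runs.straight (by simp [Cmd.steps, move]) (fun hs => ?_) ?_
    · simp [Cmd.Safe, move, Cmd.eval, Op.eval, c44', c8, c17, c21]
      omega
    · have : Similar inp n V thr i j := ⟨hi, hj, hij, hm⟩
      simp [Cmd.eval, Op.eval, move, c44', c8, hz, Found, c17, c21, this]
  · have hz : mismatches inp i j 0 V - thr ≠ 0 := by omega
    refine Runs.straight (by simp [Cmd.steps, move]) (fun hs => ?_) ?_
    · simp [Cmd.Safe, move, Cmd.eval, Op.eval, c44', c8, c17, c21]
      omega
    · have : ¬ Similar inp n V thr i j := fun h => hm h.2.2.2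
      simp [Cmd.eval, Op.eval, c44', c8, hz, Found, this, c0, c1]

theorem runs_tryPair {n k V thr cnt i y : ℕ} (hinp : ∀ i k, inp i k ≤ 1) (hB : V + 2 ≤ B)
    (hp : Params n k V thr cnt s) (h17 : s.reg 17 = i) (h21 : s.reg 21 = y) (hi : i < n) :
    Runs B inp tryPair s (32 * V + 42) fun s' =>
      (Found inp n V thr s → Found inp n V thr s') ∧
      (Similar inp n V thr i (y - 1) → Found inp n V thr s') := by
  have hVB : 2 ^ (V + 2) ≤ 2 ^ B := Nat.pow_le_pow_right (by omega) hB
  rw [pow_add] at hVB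
  have hVp : 1 ≤ 2 ^ V := Nat.one_le_two_pow
  refine Runs.of_bounded fun hbd => ?_
  have hni : i < 2 ^ B := h17 ▸ hbd.reg 17
  have hny : y < 2 ^ B := h21 ▸ hbd.reg 21
  refine Runs.mono (T := 6 + (((32 * V + 34) + 1) + 1)) ?_ (by omega) fun _ h => h
  -- Both tests use truncated subtraction: y - n vanishes exactly if y - 1 is the index of a string,
  -- and the sum of the two differences in register 23 vanishes exactly if that string is i.
  refine Runs.seq (R := fun t => Params n k V thr cnt t ∧ t.reg 17 = i ∧ t.reg 21 = y - 1 ∧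
    t.reg 22 = y - n ∧ t.reg 23 = (i - (y - 1)) + ((y - 1) - i) ∧ t.reg 0 = s.reg 0 ∧
    t.reg 1 = s.reg 1) ?_ ?_
  · refine Runs.straight (by simp [Cmd.steps, decr]) (fun hs => ?_) ?_
    · simp [Cmd.Safe, decr, Cmd.eval, Op.eval, h17, h21]
      omega
    · refine ⟨hp.of_eq ?_, ?_⟩
      · simp [decr, Cmd.eval, Op.eval]
      · simp [decr, Cmd.eval, Op.eval, h17, h21, hp.r2]
  rintro t ⟨tp, t17, t21, t22, t23, t0, t1⟩
  have hF : Found inp n V thr t ↔ Found inp n V thr s := by simp [Found, t0, t1]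
  have hskip : ¬ Similar inp n V thr i (y - 1) →
      Runs B inp (.const tmp 0) t (32 * V + 34) fun s' =>
      (Found inp n V thr s → Found inp n V thr s') ∧
      (Similar inp n V thr i (y - 1) → Found inp n V thr s') := by
    intro h
    refine Runs.straight (by simp [Cmd.steps]) (fun hs => by simp [Cmd.Safe]) ?_
    simp only [Found] at hF
    simp [Cmd.eval, Found, hF, h]
  refine Runs.ite (fun h => ?_) (fun h => Runs.ite (fun h' => ?_) (fun h' => ?_))
  · rw [t22] at h
    exact (hskip fun hs => by have := hs.2.1; omega).mono (by omega) fun _ h => h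
  · rw [t22] at h
    rw [t23] at h'
    rw [← hF]
    exact runs_compareStrings hinp hB tp t17 t21 hi (by omega) (by omega)
  · rw [t23] at h'
    exact hskip fun hs => hs.2.2.1 (by omega)

theorem runs_probeString {n k V thr cnt i off : ℕ} (hinp : ∀ i k, inp i k ≤ 1) (hB : V + 2 ≤ B)
    (hkB : k + 2 ≤ B) (hoff : off + k < 2 ^ B) (hp : Params n k V thr cnt s)
    (h16 : s.reg 16 = off) (h17 : s.reg 17 = i) (hi : i < n)
    (hlist : ∀ a < cnt, s.mem a < 2 ^ k) :
    Runs B inp probeString s (cnt * (32 * V + 14 * k + 58) + 9 * k + 12) fun s' =>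
      (Found inp n V thr s → Found inp n V thr s') ∧
      (∀ a < cnt, Similar inp n V thr i (s.mem (2 ^ k + (readBits inp i off k ^^^ s.mem a)) - 1) →
        Found inp n V thr s') := by
  have hKB : 2 ^ (k + 2) ≤ 2 ^ B := Nat.pow_le_pow_right (by omega) hkB
  rw [pow_add] at hKB
  have hKp : 1 ≤ 2 ^ k := Nat.one_le_two_pow
  refine Runs.of_bounded fun hbd => ?_
  have hcB : cnt < 2 ^ B := hp.r12 ▸ hbd.reg 12
  have hb := readBits_lt hinp i off k
  refine Runs.mono (T := (9 * k + 7) + (4 + (cnt * ((32 * V + 14 * k + 55) + 3) + 1))) ?_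
    (by ring_nf; omega) fun _ h => h
  refine Runs.seq (runs_readWord hinp (by omega) (by omega) (by omega) hp.r5 hkB
    (by rw [h16]; exact hoff)) ?_
  rintro t₁ ⟨a52, ar, am⟩
  rw [h17, h16] at a52
  refine Runs.seq (R := fun t => Params n k V thr cnt t ∧ t.reg 17 = i ∧
    t.reg 18 = readBits inp i off k ∧ t.reg 19 = cnt ∧ t.reg 0 = s.reg 0 ∧ t.reg 1 = s.reg 1 ∧
    t.mem = s.mem) ?_ ?_
  · have hp₁ := hp.of_lt ar
    refine Runs.straight (by simp [Cmd.steps, move]) (fun hs => ?_) ?_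
    · simp [Cmd.Safe, move, Cmd.eval, a52, hp₁.r12]
      omega
    · refine ⟨hp₁.of_eq ?_, ?_⟩
      · simp [move, Cmd.eval, Op.eval]
      · simp [move, Cmd.eval, Op.eval, a52, am, hp₁.r12, ar, h17]
  rintro t₂ ⟨bp, b17, b18, b19, b0, b1, bm⟩
  refine (Runs.countdown (fun j s' => (Found inp n V thr s → Found inp n V thr s') ∧
      (∀ a < cnt, cnt - j ≤ a →
        Similar inp n V thr i (s.mem (2 ^ k + (readBits inp i off k ^^^ s.mem a)) - 1) →
        Found inp n V thr s'))
      (by omega) rfl (by decide) b19 ?_ ?_ ?_).mono le_rfl ?_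
  · exact ⟨by simp [Found, b0, b1], fun a ha ha' => by omega⟩
  · rintro j s u h
    simpa [Found] using h
  · rintro j hj s' hf k19 ⟨i1, i2⟩
    have cp := bp.frame hf (by decide)
    have c17 : s'.reg 17 = i := by rw [hf.reg 17 rfl, b17]
    have c18 : s'.reg 18 = readBits inp i off k := by rw [hf.reg 18 rfl, b18]
    have cm : s'.mem = s.mem := by rw [hf.mem rfl, bm]
    set a := s'.reg 19 with ha
    have hac : a < cnt := by omega
    have hla := hlist a hac
    refine Runs.mono (T := 1 + ((14 * k + 10) + (2 + (32 * V + 42)))) ?_ (by omega) fun _ h => h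
    refine Runs.seq (R := fun t => t = s'.setReg 20 (s.mem a)) ?_ ?_
    · refine Runs.straight (by simp [Cmd.steps]) (fun hs => trivial) ?_
      simp [Cmd.eval, cm, ← ha]
    rintro _ rfl
    refine Runs.seq (runs_xorWeight (K := k) (by omega) (by omega) (by omega)
      (by simp [cp.r5]) (by simpa [c18] using hb) (by simpa using hla) hkB) ?_
    rintro t₃ ⟨d43, -, dr, dm⟩
    have d43' : t₃.reg 43 = readBits inp i off k ^^^ s.mem a := by rw [d43]; simp [c18]
    have dx : ∀ x < 40, x ≠ 20 → t₃.reg x = s'.reg x := fun x hx h => by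
      rw [dr x hx]; simp [h]
    have dp : Params n k V thr cnt t₃ := cp.of_eq fun x hx => dx x (by
      simp only [List.mem_cons, List.not_mem_nil, or_false] at hx; omega) (by
      simp only [List.mem_cons, List.not_mem_nil, or_false] at hx; omega)
    have hxl : readBits inp i off k ^^^ s.mem a < 2 ^ k := Nat.xor_lt_two_pow hb hla
    refine Runs.seq (R := fun t => Params n k V thr cnt t ∧ t.reg 17 = i ∧
      t.reg 21 = s.mem (2 ^ k + (readBits inp i off k ^^^ s.mem a)) ∧
      (Found inp n V thr t ↔ Found inp n V thr s')) ?_ ?_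
    · refine Runs.straight (by simp [Cmd.steps]) (fun hs => ?_) ?_
      · simp [Cmd.Safe, dp.r6, d43']
        omega
      · refine ⟨dp.of_eq (by simp [Cmd.eval, Op.eval]), ?_⟩
        simp [Cmd.eval, Op.eval, dp.r6, d43', dx, c17, dm, cm, Found]
    rintro t₄ ⟨ep, e17, e21, eF⟩
    refine (runs_tryPair hinp hB ep e17 e21 hi).mono le_rfl ?_
    rintro t₅ ⟨f1, f2⟩
    refine ⟨fun h => f1 (eF.2 (i1 h)), fun w hw hw' hS => ?_⟩
    by_cases hwa : w = a
    · subst hwa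
      exact f2 hS
    · exact f1 (eF.2 (i2 w hw (by omega) hS))
  · rintro s' ⟨⟨i1, i2⟩, -⟩
    exact ⟨i1, fun a ha => i2 a ha (by omega)⟩

theorem runs_insertString {n k V thr cnt j off : ℕ} (hinp : ∀ i k, inp i k ≤ 1)
    (hkB : k + 2 ≤ B) (hoff : off + k < 2 ^ B) (hp : Params n k V thr cnt s)
    (h16 : s.reg 16 = off) (h17 : s.reg 17 = j) (hj : j < n) :
    Runs B inp insertString s (9 * k + 13) fun s' =>
      ∀ a, s'.mem a = if a = 2 ^ k + readBits inp j off k then j + 1 else s.mem a := by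
  have hKB : 2 ^ (k + 2) ≤ 2 ^ B := Nat.pow_le_pow_right (by omega) hkB
  rw [pow_add] at hKB
  have hKp : 1 ≤ 2 ^ k := Nat.one_le_two_pow
  refine Runs.of_bounded fun hbd => ?_
  have hnB : n < 2 ^ B := hp.r2 ▸ hbd.reg 2
  have hb := readBits_lt hinp j off k
  refine Runs.mono (T := (9 * k + 7) + 6) ?_ (by omega) fun _ h => h
  refine Runs.seq (runs_readWord hinp (by omega) (by omega) (by omega) hp.r5 hkB
    (by rw [h16]; exact hoff)) ?_
  rintro t₁ ⟨a52, ar, am⟩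
  rw [h17, h16] at a52
  refine Runs.straight (by simp [Cmd.steps, move, incr]) (fun hs => ?_) ?_
  · simp [Cmd.Safe, move, incr, Cmd.eval, Op.eval, a52, ar, hp.r6, h17]
    omega
  · intro a
    simp [move, incr, Cmd.eval, Op.eval, a52, ar, hp.r6, h17, State.mem_setMem, am]

/-- All similar pairs that the table `τ` of the block at `off` and the error patterns of weight
at most `t` point to are taken into account. -/
def BlockDone (inp : ℕ → ℕ → ℕ) (n k V thr t off : ℕ) (s : State) : Prop :=
  ∃ τ : ℕ → ℕ, (∀ j < n, τ (readBits inp j off k) < n ∧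
      readBits inp (τ (readBits inp j off k)) off k = readBits inp j off k) ∧
    ∀ i < n, ∀ e < 2 ^ k, wt k e ≤ t →
      Similar inp n V thr i (τ (readBits inp i off k ^^^ e)) → Found inp n V thr s

/-- The first cells hold the error patterns of weight at most `t`. -/
def HasPatterns (k cnt t : ℕ) (s : State) : Prop :=
  cnt ≤ 2 ^ k ∧ (∀ a < cnt, s.mem a < 2 ^ k) ∧
    ∀ e < 2 ^ k, wt k e ≤ t → ∃ a < cnt, s.mem a = e

/-- Strings with equal blocks overwrite each other in the hash table, so a lookup only promises some
string with the given block. The patterns lie below cell 2 ^ k and the table from there on, so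
insertions leave the patterns intact. -/
theorem runs_searchBlock {n k V thr cnt t b : ℕ} (hinp : ∀ i k, inp i k ≤ 1) (hB : V + 2 ≤ B)
    (hkB : k + 2 ≤ B) (hoff : b * k + k < 2 ^ B) (hp : Params n k V thr cnt s)
    (h14 : s.reg 14 = b) (hlist : HasPatterns k cnt t s) :
    Runs B inp searchBlock s
      (n * (9 * k + 16) + n * (cnt * (32 * V + 14 * k + 58) + 9 * k + 15) + 7) fun s' =>
      (Found inp n V thr s → Found inp n V thr s') ∧ HasPatterns k cnt t s' ∧
      BlockDone inp n k V thr t (b * k) s' := by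
  have hKB : 2 ^ (k + 2) ≤ 2 ^ B := Nat.pow_le_pow_right (by omega) hkB
  rw [pow_add] at hKB
  have hKp : 1 ≤ 2 ^ k := Nat.one_le_two_pow
  refine Runs.of_bounded fun hbd => ?_
  have hnB : n < 2 ^ B := hp.r2 ▸ hbd.reg 2
  set off := b * k with hoffd
  refine Runs.mono (T := 3 + ((n * ((9 * k + 13) + 3) + 1) + (2 +
    (n * ((cnt * (32 * V + 14 * k + 58) + 9 * k + 12) + 3) + 1)))) ?_
    (by ring_nf; omega) fun _ h => h
  refine Runs.seq (R := fun u => Params n k V thr cnt u ∧ u.reg 16 = off ∧ u.reg 17 = n ∧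
    u.reg 0 = s.reg 0 ∧ u.reg 1 = s.reg 1 ∧ u.mem = s.mem) ?_ ?_
  · refine Runs.straight (by simp [Cmd.steps, move]) (fun hs => ?_) ?_
    · simp [Cmd.Safe, move, Cmd.eval, hp.r5, hp.r2, h14]
      omega
    · refine ⟨hp.of_eq (by simp [move, Cmd.eval, Op.eval]), ?_⟩
      simp [move, Cmd.eval, Op.eval, hp.r5, hp.r2, h14, hoffd]
  rintro s₁ ⟨ap, a16, a17, a0, a1, am⟩
  refine Runs.seq (Runs.countdown (fun j s' => (∀ a < 2 ^ k, s'.mem a = s.mem a) ∧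
      ∀ i < n, n - j ≤ i → ∃ y < n, s'.mem (2 ^ k + readBits inp i off k) = y + 1 ∧
        readBits inp y off k = readBits inp i off k)
      (by omega) rfl (by decide) a17 ?_ ?_ ?_) ?_
  · exact ⟨by simp [am], fun i hi hi' => by omega⟩
  · rintro j s u h
    simpa using h
  · rintro j hj s' hf k17 ⟨i1, i2⟩
    have bp := ap.frame hf (by decide)
    have b16 : s'.reg 16 = off := by rw [hf.reg 16 rfl, a16]
    refine (runs_insertString hinp hkB hoff bp b16 rfl (by omega)).mono le_rfl ?_
    intro s'' hm
    refine ⟨fun a ha => by rw [hm, if_neg (by omega), i1 a ha], fun i hi hi' => ?_⟩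
    by_cases he : readBits inp i off k = readBits inp (s'.reg 17) off k
    · exact ⟨s'.reg 17, by omega, by rw [hm, he, if_pos rfl], he.symm⟩
    · have hne : i ≠ s'.reg 17 := fun h => he (by rw [h])
      obtain ⟨y, hy, hy1, hy2⟩ := i2 i hi (by omega)
      exact ⟨y, hy, by rw [hm, if_neg (by omega), hy1], hy2⟩
  rintro s₂ ⟨⟨i1, i2⟩, hf⟩
  have bp := ap.frame hf (by decide)
  have b16 : s₂.reg 16 = off := by rw [hf.reg 16 rfl, a16]
  have b0 : s₂.reg 0 = s.reg 0 := by rw [hf.reg 0 rfl, a0]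
  have b1 : s₂.reg 1 = s.reg 1 := by rw [hf.reg 1 rfl, a1]
  obtain ⟨l1, l2, l3⟩ := hlist
  have hl2 : ∀ a < cnt, s₂.mem a < 2 ^ k := fun a ha => by
    rw [i1 a (by omega)]; exact l2 a ha
  have hl3 : ∀ e < 2 ^ k, wt k e ≤ t → ∃ a < cnt, s₂.mem a = e := fun e he hw => by
    obtain ⟨a, ha, h⟩ := l3 e he hw
    exact ⟨a, ha, by rw [i1 a (by omega), h]⟩
  refine Runs.seq (R := fun u => Params n k V thr cnt u ∧ u.reg 16 = off ∧ u.reg 17 = n ∧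
    u.reg 0 = s.reg 0 ∧ u.reg 1 = s.reg 1 ∧ u.mem = s₂.mem) ?_ ?_
  · refine Runs.straight (by simp [Cmd.steps, move]) (fun hs => ?_) ?_
    · simp [Cmd.Safe, move, Cmd.eval, bp.r2]
      omega
    · refine ⟨bp.of_eq (by simp [move, Cmd.eval, Op.eval]), ?_⟩
      simp [move, Cmd.eval, Op.eval, bp.r2, b16, b0, b1]
  rintro s₃ ⟨cp, c16, c17, c0, c1, cm⟩
  refine (Runs.countdown (fun j s' => (Found inp n V thr s → Found inp n V thr s') ∧
      ∀ i < n, n - j ≤ i → ∀ a < cnt,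
        Similar inp n V thr i (s₂.mem (2 ^ k + (readBits inp i off k ^^^ s₂.mem a)) - 1) →
        Found inp n V thr s')
      (by omega) rfl (by decide) c17 ?_ ?_ ?_).mono le_rfl ?_
  · exact ⟨by simp [Found, c0, c1], fun i hi hi' => by omega⟩
  · rintro j s u h
    simpa [Found] using h
  · rintro j hj s' hf' k17 ⟨j1, j2⟩
    have dp := cp.frame hf' (by decide)
    have d16 : s'.reg 16 = off := by rw [hf'.reg 16 rfl, c16]
    have dm : s'.mem = s₂.mem := by rw [hf'.mem rfl, cm]
    refine (runs_probeString hinp hB hkB hoff dp d16 rfl (by omega)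
      (by rw [dm]; exact hl2)).mono le_rfl ?_
    rintro s'' ⟨f1, f2⟩
    rw [dm] at f2
    refine ⟨fun h => f1 (j1 h), fun i hi hi' a ha hS => ?_⟩
    by_cases hii : i = s'.reg 17
    · subst hii
      exact f2 a ha hS
    · exact f1 (j2 i hi (by omega) a ha hS)
  · rintro s' ⟨⟨j1, j2⟩, hf'⟩
    have dm : s'.mem = s₂.mem := by rw [hf'.mem rfl, cm]
    -- The witness is the hash table itself; on block values that do not occur it may be anything.
    refine ⟨j1, ⟨l1, by rwa [dm], by rwa [dm]⟩, fun h => s₂.mem (2 ^ k + h) - 1,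
      fun j hj => ?_, fun i hi e he hw hS => ?_⟩
    · obtain ⟨y, hy, hy1, hy2⟩ := i2 j hj (by omega)
      simp only [hy1, Nat.add_sub_cancel]
      exact ⟨hy, hy2⟩
    · obtain ⟨a, ha, rfl⟩ := hl3 e he hw
      exact j2 i hi (by omega) a ha hS

end LightBulb

/-! ### Listing the error patterns, and the cost of the whole search -/

namespace LightBulb

variable {B : ℕ} {inp : ℕ → ℕ → ℕ} {s : State}

/-- The number of words of length `k` and weight at most `t`. -/
def patternCount (k t : ℕ) : ℕ := ((Finset.range (2 ^ k)).filter fun e => wt k e ≤ t).card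

theorem patternCount_le (k t : ℕ) : patternCount k t ≤ 2 ^ k := by
  simpa [patternCount] using Finset.card_filter_le (Finset.range (2 ^ k)) fun e => wt k e ≤ t

theorem runs_listPatterns {k t : ℕ} (hkB : k + 2 ≤ B) (h5 : s.reg 5 = k) (h6 : s.reg 6 = 2 ^ k)
    (h10 : s.reg 10 = t) (h12 : s.reg 12 = 0) (h30 : s.reg 30 = 0) :
    Runs B inp listPatterns s (2 ^ k * (14 * k + 18) + 3) fun s' =>
      (s'.reg 12 = patternCount k t ∧ HasPatterns k (patternCount k t) t s') ∧
      Frame listPatterns s s' := by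
  have hKB : 2 ^ (k + 2) ≤ 2 ^ B := Nat.pow_le_pow_right (by omega) hkB
  rw [pow_add] at hKB
  have hKp : 1 ≤ 2 ^ k := Nat.one_le_two_pow
  refine Runs.frame ?_
  refine Runs.mono (T := 2 + (2 ^ k * ((14 * k + 15) + 3) + 1)) ?_ (by ring_nf; omega) fun _ h => h
  refine Runs.seq (R := fun u => u.reg 5 = k ∧ u.reg 10 = t ∧ u.reg 12 = 0 ∧ u.reg 13 = 2 ^ k ∧
    u.reg 30 = 0) ?_ ?_
  · refine Runs.straight (by simp [Cmd.steps, move]) (fun hs => ?_) ?_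
    · simp [Cmd.Safe, move, Cmd.eval, h6]
      omega
    · simp [move, Cmd.eval, Op.eval, h5, h6, h10, h12, h30]
  rintro s₁ ⟨a5, a10, a12, a13, a30⟩
  refine (Runs.countdown (fun j s' =>
      s'.reg 12 = ((Finset.Ico (2 ^ k - j) (2 ^ k)).filter fun e => wt k e ≤ t).card ∧
      (∀ a < s'.reg 12, s'.mem a < 2 ^ k) ∧
      ∀ e < 2 ^ k, 2 ^ k - j ≤ e → wt k e ≤ t → ∃ a < s'.reg 12, s'.mem a = e)
      (by omega) rfl (by decide) a13 ?_ ?_ ?_).mono le_rfl ?_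
  · exact ⟨by simp [a12], by simp [a12], fun e he he' => by omega⟩
  · rintro j s u h
    simpa using h
  · rintro j hj s' hf k13 ⟨i1, i2, i3⟩
    have b5 : s'.reg 5 = k := by rw [hf.reg 5 rfl, a5]
    have b10 : s'.reg 10 = t := by rw [hf.reg 10 rfl, a10]
    have b30 : s'.reg 30 = 0 := by rw [hf.reg 30 rfl, a30]
    set v := s'.reg 13 with hv
    have hvk : v < 2 ^ k := by omega
    have hIco : Finset.Ico (2 ^ k - (j + 1)) (2 ^ k) = insert v (Finset.Ico (2 ^ k - j) (2 ^ k)) := by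
      ext e
      simp only [Finset.mem_Ico, Finset.mem_insert]
      omega
    have hvI : v ∉ (Finset.Ico (2 ^ k - j) (2 ^ k)).filter fun e => wt k e ≤ t := by
      simp only [Finset.mem_filter, Finset.mem_Ico]
      omega
    have hcard := Finset.card_filter_le (Finset.Ico (2 ^ k - j) (2 ^ k)) fun e => wt k e ≤ t
    rw [← i1, Nat.card_Ico] at hcard
    refine Runs.mono (T := (14 * k + 10) + 5) ?_ (by omega) fun _ h => h
    refine Runs.seq (runs_xorWeight (K := k) (by omega) (by omega) (by omega) b5 hvk
      (by rw [b30]; omega) hkB) ?_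
    rintro t₁ ⟨-, c44, cr, cm⟩
    rw [b30, Nat.xor_zero, ← hv] at c44
    have c10 : t₁.reg 10 = t := by rw [cr 10 (by omega), b10]
    have c12 : t₁.reg 12 = s'.reg 12 := cr 12 (by omega)
    have c13 : t₁.reg 13 = v := cr 13 (by omega)
    rw [hIco, Finset.filter_insert]
    by_cases hw : wt k v ≤ t
    · have hz : wt k v - t = 0 := by omega
      rw [if_pos hw, Finset.card_insert_of_notMem hvI]
      refine Runs.straight (by simp [Cmd.steps, incr]) (fun hs => ?_) ?_
      · simp [Cmd.Safe, incr, Cmd.eval, Op.eval, c44, c10, c12]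
        omega
      · simp only [Cmd.eval, Op.eval, incr, c44, c10, State.reg_setReg, ↓reduceIte, hz,
          State.mem_setReg, State.mem_setMem, State.reg_setMem, tmp, Nat.reduceEqDiff, c12, c13, cm]
        refine ⟨by rw [i1], fun a ha => ?_, fun e he hje hwe => ?_⟩
        · split
          · exact hvk
          · exact i2 a (by omega)
        · by_cases hev : e = v
          · exact ⟨s'.reg 12, by omega, by rw [if_pos rfl, hev]⟩
          · obtain ⟨a, ha, ha'⟩ := i3 e he (by omega) hwe
            exact ⟨a, by omega, by rw [if_neg (by omega), ha']⟩
    · have hz : wt k v - t ≠ 0 := by omega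
      rw [if_neg hw]
      refine Runs.straight (by simp [Cmd.steps, incr]) (fun hs => ?_) ?_
      · simp [Cmd.Safe, incr, Cmd.eval, Op.eval, c44, c10, c12]
        omega
      · simp only [Cmd.eval, Op.eval, c44, c10, State.reg_setReg, ↓reduceIte, hz,
          State.mem_setReg, tmp, Nat.reduceEqDiff, c12, cm]
        refine ⟨i1, i2, fun e he hje hwe => ?_⟩
        by_cases hev : e = v
        · subst hev
          exact absurd hwe hw
        · exact i3 e he (by omega) hwe
  · rintro s' ⟨⟨i1, i2, i3⟩, -⟩
    have e : s'.reg 12 = patternCount k t := by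
      rw [i1, patternCount, Nat.sub_self, Finset.range_eq_Ico]
    rw [e] at i2 i3
    exact ⟨e, patternCount_le k t, i2, fun x hx => i3 x hx (by omega)⟩

theorem runs_sizeLoop {n : ℕ} (hn : n.size + 2 ≤ B) (h3 : s.reg 3 = 0) (h4 : s.reg 4 = n) :
    Runs B inp sizeLoop s (5 * n.size + 1) fun s' => s'.reg 3 = n.size := by
  have hKB : 2 ^ (n.size + 2) ≤ 2 ^ B := Nat.pow_le_pow_right (by omega) hn
  rw [pow_add] at hKB
  have hKK : n.size < 2 ^ n.size := Nat.lt_two_pow_self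
  refine (Runs.loop (T := 4) (fun v s' => (s'.reg 4).size = v ∧ s'.reg 3 + v = n.size) ?_ ?_
    n.size s ⟨by rw [h4], by omega⟩).mono (by omega) ?_
  · exact fun s h => Nat.size_eq_zero.1 h.1
  · rintro v s' ⟨h1, h2⟩
    have hne : s'.reg 4 ≠ 0 := fun h => by simp [h] at h1
    refine ⟨hne, ?_⟩
    have hdiv : (s'.reg 4 / 2).size = v := by
      have h := Nat.size_bit (b := Nat.bodd (s'.reg 4)) (n := s'.reg 4 / 2) (by
        rwa [← Nat.div2_val, Nat.bit_bodd_div2])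
      rw [← Nat.div2_val, Nat.bit_bodd_div2, h1, Nat.div2_val] at h
      omega
    refine Runs.straight (by simp [Cmd.steps, incr]) (fun hs => ?_) ?_
    · simp [Cmd.Safe, incr, Cmd.eval]
      omega
    · simp [incr, Cmd.eval, Op.eval, hdiv]
      omega
  · rintro s' ⟨-, h⟩
    omega

/-- The number of steps of the search. -/
def searchSteps (ℓ n V cnt : ℕ) : ℕ :=
  5 * ℓ * (n * (9 * (ℓ + 3) + 16) + n * (cnt * (32 * V + 14 * (ℓ + 3) + 58) + 9 * (ℓ + 3) + 15)
    + 10) + 2 ^ (ℓ + 3) * (14 * (ℓ + 3) + 18) + 9 * ℓ + 43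

theorem runs_searchFrom {n A D p q : ℕ} (hinp : ∀ i k, inp i k ≤ 1)
    (hB : (A + D + p + q + 10) * (n.size + 3) ^ 2 ≤ B)
    (h0 : s.reg 0 = n) (h3 : s.reg 3 = 0) :
    Runs B inp (searchFrom A D p q) s
      (searchSteps n.size n (A * n.size) (patternCount (n.size + 3) ((n.size + 3) * p / q)))
      fun s' => ∀ b < 5 * n.size, BlockDone inp n (n.size + 3) (A * n.size) (D * n.size)
        ((n.size + 3) * p / q) (b * (n.size + 3)) s' := by
  obtain ⟨ℓ, hℓ⟩ : ∃ ℓ, ℓ = n.size := ⟨_, rfl⟩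
  rw [← hℓ] at hB ⊢
  set k := ℓ + 3 with hk
  set t := k * p / q with ht
  -- It suffices to bound the parameters by B itself. The block offsets, up to about 5 k ^ 2, are
  -- what makes a B quadratic in k convenient.
  have hBlt : B < 2 ^ B := Nat.lt_two_pow_self
  have hA0 : A ≤ A * k ^ 2 := Nat.le_mul_of_pos_right _ (by positivity)
  have hD0 : D ≤ D * k ^ 2 := Nat.le_mul_of_pos_right _ (by positivity)
  have hp0 : p ≤ p * k ^ 2 := Nat.le_mul_of_pos_right _ (by positivity)
  have hq0 : q ≤ q * k ^ 2 := Nat.le_mul_of_pos_right _ (by positivity)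
  have hkk : k ≤ k ^ 2 := Nat.le_self_pow (by omega) k
  have hkk3 : 3 * k ≤ k ^ 2 := by rw [pow_two]; exact Nat.mul_le_mul_right k (by omega)
  have hAl : A * ℓ ≤ A * k ^ 2 := Nat.mul_le_mul_left A (by omega)
  have hDl : D * ℓ ≤ D * k ^ 2 := Nat.mul_le_mul_left D (by omega)
  have hpk : k * p ≤ p * k ^ 2 := by rw [mul_comm]; exact Nat.mul_le_mul_left p hkk
  have hBe : (A + D + p + q + 10) * k ^ 2
      = A * k ^ 2 + D * k ^ 2 + p * k ^ 2 + q * k ^ 2 + 10 * k ^ 2 := by ring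
  rw [hBe] at hB
  have hoff : ∀ b < 5 * ℓ, b * k + k < 2 ^ B := fun b hb => by
    have : (b + 1) * k ≤ 5 * k * k := Nat.mul_le_mul_right k (by omega)
    have e : 5 * k * k = 5 * k ^ 2 := by ring
    have e' : (b + 1) * k = b * k + k := by ring
    omega
  set cnt := patternCount k t with hcnt
  have hkB : k + 2 ≤ B := by omega
  have hVB : A * ℓ + 2 ≤ B := by omega
  refine Runs.of_bounded fun hbd => ?_
  have hnB : n < 2 ^ B := h0 ▸ hbd.reg 0
  refine Runs.mono (T := 4 + ((5 * ℓ + 1) + (14 + ((4 * k + 4) + ((2 ^ k * (14 * k + 18) + 3) +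
    (2 + ((5 * ℓ) * ((n * (9 * k + 16) + n * (cnt * (32 * (A * ℓ) + 14 * k + 58) + 9 * k + 15) + 7)
     + 3) + 1))))))) ?_ 
    (by rw [searchSteps, ← hk]; simp only [add_assoc, Nat.reduceAdd]; omega) fun _ h => h
  refine Runs.seq (R := fun u => u.reg 2 = n ∧ u.reg 3 = 0 ∧ u.reg 4 = n) ?_ ?_
  · refine Runs.straight (by simp [Cmd.steps, move]) (fun hs => ?_) ?_
    · simp [Cmd.Safe, move, Cmd.eval, h0]
      omega
    · simp [move, Cmd.eval, Op.eval, h0, h3]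
  rintro s₁ ⟨a2, a3, a4⟩
  rw [hℓ]
  refine Runs.seq (runs_sizeLoop (n := n) (by omega) a3 a4).frame ?_
  rw [← hℓ]
  rintro s₂ ⟨b3, bf⟩
  have b2 : s₂.reg 2 = n := by rw [bf.reg 2 rfl, a2]
  refine Runs.seq (R := fun u => u.reg 2 = n ∧ u.reg 5 = k ∧ u.reg 7 = A * ℓ ∧ u.reg 8 = D * ℓ ∧
    u.reg 9 = 5 * ℓ ∧ u.reg 10 = t ∧ u.reg 12 = 0 ∧ u.reg 30 = 0) ?_ ?_
  · refine Runs.straight (by simp [Cmd.steps, setParams]) (fun hs => ?_) ?_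
    · simp only [Cmd.Safe, setParams, Cmd.eval, Op.eval, State.reg_setReg, ↓reduceIte, tmp,
        Nat.reduceEqDiff, b3, ← hk, mul_comm ℓ]
      refine ⟨?_, ?_, ?_, ?_, ?_, ?_, ?_, ?_, ?_, ?_, ?_, trivial, ?_, ?_⟩ <;> omega
    · simp [setParams, Cmd.eval, Op.eval, b2, b3, ← hk, mul_comm ℓ, ht]
  rintro s₃ ⟨c2, c5, c7, c8, c9, c10, c12, c30⟩
  refine Runs.seq (runs_powTwo (by omega) (by omega) c5 hkB) ?_
  rintro s₄ ⟨d6, dr, -⟩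
  refine Runs.seq (runs_listPatterns (t := t) hkB (by simp [dr, c5]) d6 (by simp [dr, c10])
    (by simp [dr, c12]) (by simp [dr, c30])) ?_
  rintro s₅ ⟨⟨e12, elist⟩, ef⟩
  have ep : Params n k (A * ℓ) (D * ℓ) cnt s₅ :=
    ⟨by rw [ef.reg 2 rfl, dr 2 (by omega) (by omega), c2],
     by rw [ef.reg 5 rfl, dr 5 (by omega) (by omega), c5], by rw [ef.reg 6 rfl, d6],
     by rw [ef.reg 7 rfl, dr 7 (by omega) (by omega), c7],
     by rw [ef.reg 8 rfl, dr 8 (by omega) (by omega), c8], e12,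
     by rw [ef.reg 30 rfl, dr 30 (by omega) (by omega), c30]⟩
  have e9 : s₅.reg 9 = 5 * ℓ := by rw [ef.reg 9 rfl, dr 9 (by omega) (by omega), c9]
  refine Runs.seq (R := fun u => Params n k (A * ℓ) (D * ℓ) cnt u ∧ u.reg 14 = 5 * ℓ ∧
    u.mem = s₅.mem) ?_ ?_
  · refine Runs.straight (by simp [Cmd.steps, move]) (fun hs => ?_) ?_
    · simp [Cmd.Safe, move, Cmd.eval, e9]
      omega
    · refine ⟨ep.of_eq (by simp [move, Cmd.eval, Op.eval]), ?_⟩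
      simp [move, Cmd.eval, Op.eval, e9]
  rintro s₆ ⟨fp, f14, fm⟩
  have flist : HasPatterns k cnt t s₆ := by
    simpa only [HasPatterns, fm] using elist
  refine (Runs.countdown (fun j s' => HasPatterns k cnt t s' ∧ ∀ b < 5 * ℓ, 5 * ℓ - j ≤ b →
      BlockDone inp n k (A * ℓ) (D * ℓ) t (b * k) s') (by omega) rfl (by decide) f14
      ?_ ?_ ?_).mono le_rfl ?_
  · exact ⟨flist, fun b hb hb' => by omega⟩
  · rintro j s u h
    simpa [HasPatterns, BlockDone, Found] using h
  · rintro j hj s' hf k14 ⟨i1, i2⟩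
    have gp := fp.frame hf (by decide)
    refine (runs_searchBlock hinp hVB hkB (hoff (s'.reg 14) (by omega)) gp rfl i1).mono le_rfl ?_
    rintro s'' ⟨j1, j2, j3⟩
    refine ⟨j2, fun b hb hb' => ?_⟩
    by_cases hbe : b = s'.reg 14
    · rw [hbe]; exact j3
    · obtain ⟨τ, h1, h2⟩ := i2 b hb (by omega)
      exact ⟨τ, h1, fun i hi e he hw hS => j1 (h2 i hi e he hw hS)⟩
  · rintro s' ⟨⟨-, i2⟩, -⟩ b hb
    exact i2 b hb (by omega)

theorem exec_search {n L A D p q : ℕ} {mem : ℕ → ℕ} (hinp : ∀ i k, inp i k ≤ 1)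
    (hB : (A + D + p + q + 10) * (n.size + 3) ^ 2 ≤ B) (hmem : ∀ a, mem a < 2 ^ B) :
    ∃ (t : ℕ) (s' : State), Exec inp (search A D p q) (initState [n, L] mem) t s' ∧
      t ≤ 2 + searchSteps n.size n (A * n.size)
        (patternCount (n.size + 3) ((n.size + 3) * p / q)) * (2 * B + 1) ∧
      ∀ b < 5 * n.size, BlockDone inp n (n.size + 3) (A * n.size) (D * n.size)
        ((n.size + 3) * p / q) (b * (n.size + 3)) s' := by
  set s₀ := (initState [n, L] mem).setReg 1 0 with hs₀
  have hnB : n < 2 ^ B := by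
    refine Nat.size_le.1 (le_trans ?_ hB)
    nlinarith [Nat.zero_le ((A + D + p + q) * (n.size + 3) ^ 2)]
  have hbd : Bounded B s₀ := by
    refine ⟨fun r => ?_, hmem⟩
    rw [hs₀, State.reg_setReg]
    split
    · positivity
    · rcases r with _ | _ | r
      · simpa [initState] using hnB
      · omega
      · simp [initState]
  obtain ⟨t, s', h1, h2, -, h4⟩ := runs_searchFrom (s := s₀) (B := B) hinp hB
    (by simp [hs₀, initState]) (by simp [hs₀, initState]) hbd
  exact ⟨_, s', .seq (.const _ 1 0) h1, by simp only [Nat.size_zero]; omega, h4⟩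

end LightBulb

namespace LightBulb

open MeasureTheory ProbabilityTheory

/-! ### The law of an instance -/

theorem isProbabilityMeasure_bitLaw {ρ : ℝ} (h0 : 0 ≤ ρ) (h1 : ρ ≤ 1) :
    IsProbabilityMeasure (bitLaw ρ) := by
  refine ⟨?_⟩
  simp only [bitLaw, Measure.coe_add, Measure.coe_smul, Pi.add_apply, Pi.smul_apply,
    measure_univ, smul_eq_mul, mul_one]
  rw [← ENNReal.ofReal_add (by linarith) (by linarith)]
  norm_num [← add_div]

instance : IsProbabilityMeasure (bitLaw 0) := isProbabilityMeasure_bitLaw le_rfl zero_le_one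

theorem isProbabilityMeasure_columnLaw {ρ : ℝ} (h0 : 0 ≤ ρ) (h1 : ρ ≤ 1) {n : ℕ} (a b : Fin n) :
    IsProbabilityMeasure (columnLaw ρ a b) := by
  have := isProbabilityMeasure_bitLaw h0 h1
  exact Measure.isProbabilityMeasure_map Measurable.of_discrete.aemeasurable

theorem measurePreserving_not : MeasurePreserving Bool.not (bitLaw 0) (bitLaw 0) := by
  refine ⟨Measurable.of_discrete, ?_⟩
  simp [bitLaw, Measure.map_add _ _ Measurable.of_discrete, Measure.map_dirac, add_comm]

theorem columnLaw_real_pair {ρ : ℝ} (h0 : 0 ≤ ρ) (h1 : ρ ≤ 1) {n : ℕ} {a b : Fin n} (hab : a ≠ b) :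
    (columnLaw ρ a b).real {x | x a ≠ x b} = (1 - ρ) / 2 := by
  have := isProbabilityMeasure_bitLaw h0 h1
  have hset : (fun p : (Fin n → Bool) × Bool => Function.update p.1 b (xor (p.1 a) p.2)) ⁻¹'
      {x | x a ≠ x b} = Set.univ ×ˢ {true} := by
    ext ⟨x, y⟩
    rcases hx : x a <;> rcases y <;> simp [hab, hx]
  rw [columnLaw, measureReal_def, Measure.map_apply Measurable.of_discrete .of_discrete, hset,
    Measure.prod_prod, measure_univ, one_mul]
  simp [bitLaw, ENNReal.toReal_ofReal (show 0 ≤ (1 - ρ) / 2 by linarith)]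

/-- Flipping the source bit of j preserves the law of the source bits and the noise, and it
exchanges agreement and disagreement of i and j: the bit of j is flipped because j ≠ b, and the bit
of i is not, because it depends on the source bit of j only if i = b and j = a. So both events have
probability 1/2. -/
theorem columnLaw_real_of_ne {ρ : ℝ} (h0 : 0 ≤ ρ) (h1 : ρ ≤ 1) {n : ℕ} {a b i j : Fin n}
    (hij : i ≠ j) (hjb : j ≠ b) (hib : i = b → j ≠ a) :
    (columnLaw ρ a b).real {x | x i ≠ x j} = 1 / 2 := by
  have := isProbabilityMeasure_bitLaw h0 h1
  have := isProbabilityMeasure_columnLaw h0 h1 a b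
  set f := fun p : (Fin n → Bool) × Bool => Function.update p.1 b (xor (p.1 a) p.2) with hf
  set ν := (Measure.pi fun _ : Fin n => bitLaw 0).prod (bitLaw ρ) with hν
  set E := f ⁻¹' {x | x i ≠ x j} with hE
  have hEν : (columnLaw ρ a b).real {x | x i ≠ x j} = ν.real E := by
    rw [columnLaw, measureReal_def, Measure.map_apply Measurable.of_discrete .of_discrete,
      measureReal_def]
  have hflip : MeasurePreserving
      (fun (x : Fin n → Bool) (l : Fin n) => (if l = j then Bool.not else id) (x l))
      (Measure.pi fun _ : Fin n => bitLaw 0) (Measure.pi fun _ : Fin n => bitLaw 0) := by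
    refine measurePreserving_pi (fun _ : Fin n => bitLaw 0) (fun _ => bitLaw 0)
      (f := fun l => if l = j then Bool.not else id) fun l => ?_
    split
    · exact measurePreserving_not
    · exact MeasurePreserving.id _
  have hflip' := hflip.prod (MeasurePreserving.id (bitLaw ρ))
  have hpre : (Prod.map (fun (x : Fin n → Bool) (l : Fin n) =>
      (if l = j then Bool.not else id) (x l)) id) ⁻¹' E = Eᶜ := by
    ext ⟨x, y⟩
    simp only [hE, hf, Set.mem_preimage, Prod.map_apply, Set.mem_ofPred_eq, id_eq, Set.mem_compl_iff,
      Function.update_apply, hjb, if_false, if_true]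
    by_cases hi : i = b
    · have ha : a ≠ j := fun h => hib hi h.symm
      simp only [hi, if_true, ha, if_false, id_eq]
      rcases x a <;> rcases x j <;> rcases y <;> simp
    · simp only [hi, if_false, hij, id_eq]
      rcases x i <;> rcases x j <;> simp
  have hm := hflip'.measure_preimage (s := E) (MeasurableSet.of_discrete.nullMeasurableSet)
  rw [hpre] at hm
  have hadd := measureReal_add_measureReal_compl (μ := ν) (s := E) .of_discrete
  have hm' : ν.real Eᶜ = ν.real E := by rw [measureReal_def, measureReal_def, hm]
  rw [hm', probReal_univ] at hadd
  rw [hEν]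
  linarith

/-- The event is symmetric in i and j, so the string whose bit is flipped can be chosen different
from b. -/
theorem columnLaw_real_other {ρ : ℝ} (h0 : 0 ≤ ρ) (h1 : ρ ≤ 1) {n : ℕ} {a b i j : Fin n}
    (hij : i ≠ j) (h : ¬ (i = a ∧ j = b ∨ i = b ∧ j = a)) :
    (columnLaw ρ a b).real {x | x i ≠ x j} = 1 / 2 := by
  by_cases hjb : j = b
  · have : {x : Fin n → Bool | x i ≠ x j} = {x | x j ≠ x i} := by
      ext x; exact ne_comm
    rw [this]
    exact columnLaw_real_of_ne h0 h1 hij.symm (fun h' => hij (h'.trans hjb.symm))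
      fun _ h' => h (Or.inl ⟨h', hjb⟩)
  · exact columnLaw_real_of_ne h0 h1 hij hjb fun hi hj => h (Or.inr ⟨hi, hj⟩)

/-! ### Independent positions -/

theorem measureReal_forall_mem {α : Type*} [MeasurableSpace α] {L : ℕ} (ν : Measure α)
    [IsProbabilityMeasure ν] (S : Finset (Fin L)) (E : Set α) :
    (Measure.pi fun _ : Fin L => ν).real {X | ∀ q ∈ S, X q ∈ E} = ν.real E ^ S.card := by
  have hset : {X : Fin L → α | ∀ q ∈ S, X q ∈ E} =
      Set.univ.pi fun q => if q ∈ S then E else Set.univ := by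
    ext X
    simp only [Set.mem_ofPred_eq, Set.mem_pi, Set.mem_univ, true_imp_iff]
    refine forall_congr' fun q => ?_
    split <;> simp_all
  rw [hset, measureReal_def, Measure.pi_pi, ENNReal.toReal_prod]
  have : ∀ q : Fin L, (ν (if q ∈ S then E else Set.univ)).toReal =
      if q ∈ S then ν.real E else 1 := fun q => by
    split <;> simp [measureReal_def]
  simp only [this, Finset.prod_ite_mem, Finset.univ_inter, Finset.prod_const]

open Classical in
theorem sum_indicator_eq_card {α : Type*} {L : ℕ} (S : Finset (Fin L)) (E : Set α) (X : Fin L → α) :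
    ∑ q ∈ S, E.indicator (fun _ => (1 : ℝ)) (X q) = ((S.filter fun q => X q ∈ E).card : ℝ) := by
  simp [Set.indicator_apply, Finset.sum_boole]

section Independent

variable {α : Type*} [Finite α] [MeasurableSpace α] [DiscreteMeasurableSpace α] {L : ℕ}
  (ν : Measure α) [IsProbabilityMeasure ν]

/-- The event `E` depends only on the coordinates in `S`. -/
def DependsOnCoords (S : Finset (Fin L)) (E : Set (Fin L → α)) : Prop :=
  ∀ X Y : Fin L → α, (∀ q ∈ S, X q = Y q) → X ∈ E → Y ∈ E

/-- An event that depends only on the coordinates in `S` is the preimage of its own image under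
restriction to `S`, so independence of disjoint families of coordinates applies. -/
theorem measureReal_inter_of_disjoint {S T : Finset (Fin L)} (hST : Disjoint S T)
    {E F : Set (Fin L → α)} (hE : DependsOnCoords S E) (hF : DependsOnCoords T F) :
    (Measure.pi fun _ : Fin L => ν).real (E ∩ F) =
      (Measure.pi fun _ : Fin L => ν).real E * (Measure.pi fun _ : Fin L => ν).real F := by
  have hpre : ∀ {S : Finset (Fin L)} {E : Set (Fin L → α)}, DependsOnCoords S E →
      (fun (X : Fin L → α) (i : S) => X i) ⁻¹' ((fun (X : Fin L → α) (i : S) => X i) '' E) = E := by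
    intro S E hE
    refine Set.Subset.antisymm ?_ (Set.subset_preimage_image _ _)
    rintro X ⟨Y, hY, hXY⟩
    exact hE Y X (fun q hq => congrFun hXY ⟨q, hq⟩) hY
  have hind := (iIndepFun_pi (μ := fun _ : Fin L => ν) (X := fun _ => id)
    fun _ => aemeasurable_id).indepFun_finset S T hST fun i => measurable_pi_apply i
  have := hind.measure_inter_preimage_eq_mul
    ((fun (X : Fin L → α) (i : S) => X i) '' E) ((fun (X : Fin L → α) (i : T) => X i) '' F)
    .of_discrete .of_discrete
  simp only [id_eq] at this
  rw [hpre hE, hpre hF] at this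
  simp only [measureReal_def, this, ENNReal.toReal_mul]

theorem integral_indicator_eval (E : Set α) (q : Fin L) :
    ∫ X, E.indicator (fun _ => (1 : ℝ)) (X q) ∂(Measure.pi fun _ : Fin L => ν) = ν.real E := by
  have h := integral_map (μ := Measure.pi fun _ : Fin L => ν) (φ := Function.eval q)
    (f := E.indicator fun _ => (1 : ℝ)) (Measurable.of_discrete).aemeasurable
    (Measurable.of_discrete).aestronglyMeasurable
  rw [(measurePreserving_eval (fun _ : Fin L => ν) q).map_eq,
    integral_indicator_const _ .of_discrete] at h
  simpa using h.symm

open Classical in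
-- Markov's inequality for the number of positions of `S` at which `E` occurs.
theorem mul_measureReal_card_ge_le (S : Finset (Fin L)) (E : Set α) (ε : ℝ) :
    ε * (Measure.pi fun _ : Fin L => ν).real {X | ε ≤ ((S.filter fun q => X q ∈ E).card : ℝ)}
      ≤ S.card * ν.real E := by
  have h := mul_meas_ge_le_integral_of_nonneg (μ := Measure.pi fun _ : Fin L => ν)
    (f := fun X => ∑ q ∈ S, E.indicator (fun _ => (1 : ℝ)) (X q))
    (Filter.Eventually.of_forall fun X => Finset.sum_nonneg fun q _ =>
      Set.indicator_nonneg (fun _ _ => zero_le_one) _) Integrable.of_finite ε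
  rw [integral_finsetSum _ fun q _ => Integrable.of_finite] at h
  simpa only [sum_indicator_eq_card, integral_indicator_eval, Finset.sum_const, nsmul_eq_mul] using h

open Classical in
-- Hoeffding's inequality: the centred indicators are independent and subgaussian with variance
-- proxy 1/4.
theorem measureReal_card_ge_le_exp (S : Finset (Fin L)) (E : Set α) {ε : ℝ} (hε : 0 ≤ ε) :
    (Measure.pi fun _ : Fin L => ν).real
        {X | S.card * ν.real E + ε ≤ ((S.filter fun q => X q ∈ E).card : ℝ)}
      ≤ Real.exp (-2 * ε ^ 2 / S.card) := by
  set μ := Measure.pi fun _ : Fin L => ν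
  set Y : Fin L → (Fin L → α) → ℝ := fun q X => E.indicator (fun _ => (1 : ℝ)) (X q) - ν.real E
    with hY
  have hind : iIndepFun Y μ :=
    iIndepFun_pi (μ := fun _ : Fin L => ν)
      (X := fun _ x => E.indicator (fun _ => (1 : ℝ)) x - ν.real E)
      fun _ => (Measurable.of_discrete).aemeasurable
  have hsub : ∀ q ∈ S, HasSubgaussianMGF (Y q) ((‖(1 : ℝ) - 0‖₊ / 2) ^ 2) μ := by
    intro q _
    have := hasSubgaussianMGF_of_mem_Icc (μ := μ) (a := 0) (b := 1)
      (X := fun X => E.indicator (fun _ => (1 : ℝ)) (X q))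
      (Measurable.of_discrete).aemeasurable (Filter.Eventually.of_forall fun X => by
        by_cases h : X q ∈ E <;> simp [h])
    simpa only [μ, integral_indicator_eval] using this
  have h := HasSubgaussianMGF.measure_sum_ge_le_of_iIndepFun hind hsub hε
  have hset : {X | S.card * ν.real E + ε ≤ ((S.filter fun q => X q ∈ E).card : ℝ)} =
      {X | ε ≤ ∑ q ∈ S, Y q X} := by
    ext X
    simp only [hY, Finset.sum_sub_distrib, sum_indicator_eq_card, Finset.sum_const, nsmul_eq_mul,
      Set.mem_ofPred_eq]
    constructor <;> intro h <;> linarith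
  rw [hset]
  refine h.trans (le_of_eq ?_)
  congr 1
  simp only [sub_zero, nnnorm_one, Finset.sum_const, nsmul_eq_mul, NNReal.coe_mul,
    NNReal.coe_natCast, NNReal.coe_pow, NNReal.coe_div, NNReal.coe_one, NNReal.coe_ofNat]
  rcases eq_or_ne (S.card : ℝ) 0 with h0 | h0
  · simp [h0]
  · field_simp

end Independent

end LightBulb

namespace LightBulb

open MeasureTheory ProbabilityTheory

/-! ### The search succeeds with high probability -/

/-- The positions `off, …, off + K - 1`. -/
def positions (L off K : ℕ) : Finset (Fin L) :=
  Finset.univ.filter fun q => off ≤ (q : ℕ) ∧ (q : ℕ) < off + K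

theorem card_positions {L off K : ℕ} (h : off + K ≤ L) : (positions L off K).card = K := by
  have : (positions L off K).map Fin.valEmbedding = Finset.Ico off (off + K) := by
    ext x
    simp only [positions, Finset.mem_map, Finset.mem_filter, Finset.mem_univ, true_and,
      Fin.valEmbedding_apply, Finset.mem_Ico]
    constructor
    · rintro ⟨q, hq, rfl⟩; exact hq
    · exact fun hx => ⟨⟨x, by omega⟩, hx, rfl⟩
  rw [← Finset.card_map Fin.valEmbedding, this, Nat.card_Ico]
  omega

theorem Strings.input_le_one {n L : ℕ} (X : Strings n L) (i k : ℕ) : X.input i k ≤ 1 := by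
  unfold Strings.input
  split
  · exact Bool.toNat_le _
  · omega

theorem mismatches_input {n L off K : ℕ} (X : Strings n L) (i j : Fin n) (h : off + K ≤ L) :
    mismatches X.input i j off K = ((positions L off K).filter fun q => X q i ≠ X q j).card := by
  symm
  refine Finset.card_bij (fun q _ => (q : ℕ) - off) ?_ ?_ ?_
  · intro q hq
    simp only [positions, Finset.mem_filter, Finset.mem_univ, true_and, Finset.mem_range] at hq ⊢
    refine ⟨by omega, ?_⟩
    have e : off + ((q : ℕ) - off) = q := by omega
    simp only [e, Strings.input, i.2, j.2, q.2, and_self, dite_true, Fin.eta]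
    intro h'
    rcases hx : X q i <;> rcases hy : X q j <;> simp_all
  · intro q hq q' hq' e
    simp only [positions, Finset.mem_filter, Finset.mem_univ, true_and] at hq hq'
    exact Fin.ext (by omega)
  · intro p hp
    simp only [Finset.mem_filter, Finset.mem_range] at hp
    refine ⟨⟨off + p, by omega⟩, ?_, by simp⟩
    simp only [positions, Finset.mem_filter, Finset.mem_univ, true_and]
    refine ⟨⟨by omega, by omega⟩, fun h' => hp.2 ?_⟩
    have : off + p < L := by omega
    simp only [Strings.input, i.2, j.2, this, and_self, dite_true, Fin.eta, h']

theorem mismatches_congr {n L off K : ℕ} {X Y : Strings n L} (h : off + K ≤ L)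
    (hXY : ∀ q ∈ positions L off K, X q = Y q) (i j : Fin n) :
    mismatches X.input i j off K = mismatches Y.input i j off K := by
  rw [mismatches_input X i j h, mismatches_input Y i j h]
  congr 1
  exact Finset.filter_congr fun q hq => by rw [hXY q hq]

/-- In the block at `off`, the strings `a` and `b` differ in at most `t` positions, and no other
string agrees with `b`. -/
def GoodBlock {n L : ℕ} (a b : Fin n) (k t off : ℕ) (X : Strings n L) : Prop :=
  mismatches X.input a b off k ≤ t ∧
    ∀ j : Fin n, j ≠ a → j ≠ b → mismatches X.input j b off k ≠ 0

/-- The first `V` positions tell `a` and `b` from all other pairs, and one of the first `N` blocks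
of length `k` is good. -/
def GoodInstance {n L : ℕ} (a b : Fin n) (V thr k t N : ℕ) (X : Strings n L) : Prop :=
  (∀ i j : Fin n, i ≠ j →
    (mismatches X.input i j 0 V ≤ thr ↔ (i = a ∧ j = b ∨ i = b ∧ j = a))) ∧
  ∃ β < N, GoodBlock a b k t (β * k) X

/-- In a good block, the table entry for the block of b is a or b, since no other string has that
block. If it is a, the string b finds it with the zero pattern. If it is b, the string a finds it
with the difference of the two blocks, whose weight is at most t. So some pair is found, and as it
passed the comparison it can only be the pair a, b. -/
theorem GoodInstance.output {n L : ℕ} {a b : Fin n} (hab : a ≠ b) {V thr k t N : ℕ}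
    {X : Strings n L} (hX : GoodInstance a b V thr k t N X) {s : State}
    (hs : ∀ β < N, BlockDone X.input n k V thr t (β * k) s) :
    (s.reg 0 = a ∧ s.reg 1 = b) ∨ (s.reg 0 = b ∧ s.reg 1 = a) := by
  obtain ⟨hV, β, hβ, hab', hother⟩ := hX
  obtain ⟨τ, hτ, hfound⟩ := hs β hβ
  have hinp := X.input_le_one
  have hab0 : (a : ℕ) ≠ b := fun h => hab (Fin.ext h)
  have hsim : Similar X.input n V thr a b := ⟨a.2, b.2, hab0, (hV a b hab).2 (Or.inl ⟨rfl, rfl⟩)⟩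
  have hsim' : Similar X.input n V thr b a :=
    ⟨b.2, a.2, hab0.symm, (hV b a hab.symm).2 (Or.inr ⟨rfl, rfl⟩)⟩
  obtain ⟨hy, hyb⟩ := hτ b b.2
  set h := fun i => readBits X.input i (β * k) k with hh
  have hlt : ∀ i, h i < 2 ^ k := fun i => readBits_lt hinp i (β * k) k
  have hcase : τ (h b) = a ∨ τ (h b) = b := by
    by_contra hne
    push Not at hne
    refine hother ⟨τ (h b), hy⟩ (fun e => hne.1 (congrArg Fin.val e))
      (fun e => hne.2 (congrArg Fin.val e)) ?_
    rw [← wt_xor_readBits hinp]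
    simp only [hh] at hyb ⊢
    rw [hyb, Nat.xor_self, wt_zero_right]
  have hF : Found X.input n V thr s := by
    rcases hcase with hc | hc
    · refine hfound b b.2 0 (by positivity) (by rw [wt_zero_right]; omega) ?_
      rw [Nat.xor_zero]
      change Similar X.input n V thr b (τ (h b))
      rwa [hc]
    · refine hfound a a.2 (h a ^^^ h b) (Nat.xor_lt_two_pow (hlt a) (hlt b))
        (by rw [wt_xor_readBits hinp]; exact hab') ?_
      change Similar X.input n V thr a (τ (h a ^^^ (h a ^^^ h b)))
      rwa [← Nat.xor_assoc, Nat.xor_self, Nat.zero_xor, hc]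
  obtain ⟨h0, h1, hne, hm⟩ := hF
  have := (hV ⟨s.reg 0, h0⟩ ⟨s.reg 1, h1⟩ (fun e => hne (congrArg Fin.val e))).1 hm
  simpa [Fin.ext_iff] using this

/-! ### Failure probabilities of blocks and comparisons -/

section Probability

variable {ρ : ℝ} {n L : ℕ} {a b : Fin n}

theorem isProbabilityMeasure_instanceLaw (h0 : 0 ≤ ρ) (h1 : ρ ≤ 1) :
    IsProbabilityMeasure (instanceLaw ρ a b L) := by
  have := isProbabilityMeasure_columnLaw h0 h1 a b
  unfold instanceLaw
  infer_instance

/-- The expected number of mismatches of a and b is at most (t + 1)/2, so Markov gives 1/2 for more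
than t of them. Each other string agrees with b on the block with probability 2 ^ (-k), and a union
bound over at most n strings adds 1/8. -/
theorem measureReal_not_goodBlock_le (h0 : 0 ≤ ρ) (h1 : ρ ≤ 1) (hab : a ≠ b) {k t off : ℕ}
    (hL : off + k ≤ L) (ht : (1 - ρ) * k ≤ t + 1) (hk : 8 * n ≤ 2 ^ k) :
    (instanceLaw ρ a b L).real {X | ¬ GoodBlock a b k t off X} ≤ 5 / 8 := by
  classical
  have := isProbabilityMeasure_columnLaw h0 h1 a b
  have := isProbabilityMeasure_instanceLaw (a := a) (b := b) (L := L) h0 h1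
  set μ := instanceLaw ρ a b L with hμ
  set S := positions L off k with hS
  have hSc : S.card = k := card_positions hL
  have hsub : {X : Strings n L | ¬ GoodBlock a b k t off X} ⊆
      {X | t < mismatches X.input a b off k} ∪
      ⋃ j ∈ (Finset.univ : Finset (Fin n)).filter (fun j => j ≠ a ∧ j ≠ b),
        {X | mismatches X.input j b off k = 0} := by
    intro X hX
    simp only [GoodBlock, Set.mem_ofPred_eq, not_and_or, not_le, not_forall, not_not] at hX
    rcases hX with hX | ⟨j, hja, hjb, hX⟩
    · exact Or.inl hX
    · refine Or.inr ?_
      simp only [Finset.mem_filter, Finset.mem_univ, true_and, Set.mem_iUnion]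
      exact ⟨j, ⟨hja, hjb⟩, hX⟩
  have hfirst : μ.real {X | t < mismatches X.input a b off k} ≤ 1 / 2 := by
    have h := mul_measureReal_card_ge_le (L := L) (columnLaw ρ a b) S {x | x a ≠ x b} (t + 1)
    rw [columnLaw_real_pair h0 h1 hab, hSc] at h
    have hset : {X : Strings n L | t < mismatches X.input a b off k} =
        {X | (t : ℝ) + 1 ≤ ((S.filter fun q => X q ∈ {x : Fin n → Bool | x a ≠ x b}).card : ℝ)} := by
      ext X
      rw [Set.mem_ofPred_eq, Set.mem_ofPred_eq, mismatches_input X a b hL, ← Nat.succ_le_iff]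
      norm_cast
    rw [hset, hμ, instanceLaw]
    set P := (Measure.pi fun _ : Fin L => columnLaw ρ a b).real
      {X | (t : ℝ) + 1 ≤ ((S.filter fun q => X q ∈ {x : Fin n → Bool | x a ≠ x b}).card : ℝ)}
    have htpos : (0 : ℝ) < t + 1 := by positivity
    have h' : ((t : ℝ) + 1) * P ≤ k * ((1 - ρ) / 2) := by convert h
    by_contra hP
    push Not at hP
    nlinarith
  have hsecond : ∀ j ∈ (Finset.univ : Finset (Fin n)).filter (fun j => j ≠ a ∧ j ≠ b),
      μ.real {X | mismatches X.input j b off k = 0} ≤ (1 / 2) ^ k := by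
    intro j hj
    simp only [Finset.mem_filter, Finset.mem_univ, true_and] at hj
    have hset : {X : Strings n L | mismatches X.input j b off k = 0} =
        {X | ∀ q ∈ S, X q ∈ {x : Fin n → Bool | x j ≠ x b}ᶜ} := by
      ext X
      rw [Set.mem_ofPred_eq, mismatches_input X j b hL, Finset.card_eq_zero,
        Finset.filter_eq_empty_iff]
      simp only [Set.mem_ofPred_eq, Set.mem_compl_iff]
      rfl
    rw [hset, hμ, instanceLaw, measureReal_forall_mem, hSc, probReal_compl_eq_one_sub .of_discrete,
      columnLaw_real_other h0 h1 hj.2 (by tauto)]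
    norm_num
  have hn : (n : ℝ) * (1 / 2) ^ k ≤ 1 / 8 := by
    have : (8 * n : ℝ) ≤ 2 ^ k := by exact_mod_cast hk
    rw [one_div, inv_pow, ← div_eq_mul_inv, div_le_iff₀ (by positivity)]
    linarith
  calc μ.real {X | ¬ GoodBlock a b k t off X} ≤ _ := measureReal_mono hsub
    _ ≤ _ := measureReal_union_le _ _
    _ ≤ 1 / 2 + ∑ j ∈ (Finset.univ : Finset (Fin n)).filter (fun j => j ≠ a ∧ j ≠ b),
        (1 / 2 : ℝ) ^ k := by
      refine add_le_add hfirst ((measureReal_biUnion_finset_le _ _).trans ?_)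
      exact Finset.sum_le_sum hsecond
    _ ≤ 1 / 2 + n * (1 / 2) ^ k := by
      rw [Finset.sum_const, nsmul_eq_mul]
      gcongr
      simpa using Finset.card_filter_le (Finset.univ : Finset (Fin n)) fun j => j ≠ a ∧ j ≠ b
    _ ≤ 5 / 8 := by linarith

/-- The blocks occupy disjoint positions, so the failure of the last one is independent of the
failures before it. -/
theorem measureReal_no_goodBlock_le (h0 : 0 ≤ ρ) (h1 : ρ ≤ 1) (hab : a ≠ b) {k t : ℕ}
    (ht : (1 - ρ) * k ≤ t + 1) (hk : 8 * n ≤ 2 ^ k) (N : ℕ) (hL : N * k ≤ L) :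
    (instanceLaw ρ a b L).real {X | ∀ β < N, ¬ GoodBlock a b k t (β * k) X} ≤ (5 / 8) ^ N := by
  have := isProbabilityMeasure_columnLaw h0 h1 a b
  have := isProbabilityMeasure_instanceLaw (a := a) (b := b) (L := L) h0 h1
  induction N with
  | zero => simp
  | succ N ih =>
    rw [add_mul, one_mul] at hL
    have hset : {X : Strings n L | ∀ β < N + 1, ¬ GoodBlock a b k t (β * k) X} =
        {X | ∀ β < N, ¬ GoodBlock a b k t (β * k) X} ∩ {X | ¬ GoodBlock a b k t (N * k) X} := by
      ext X
      simp only [Set.mem_ofPred_eq, Set.mem_inter_iff, Nat.lt_succ_iff_lt_or_eq]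
      constructor
      · exact fun h => ⟨fun β hβ => h β (Or.inl hβ), h N (Or.inr rfl)⟩
      · rintro ⟨h, h'⟩ β (hβ | rfl)
        · exact h β hβ
        · exact h'
    have hcongr : ∀ off, off + k ≤ L → ∀ X Y : Strings n L,
        (∀ q ∈ positions L off k, X q = Y q) → GoodBlock a b k t off Y →
        GoodBlock a b k t off X := by
      intro off hoff X Y hXY hY
      refine ⟨?_, fun j hja hjb => ?_⟩
      · rw [mismatches_congr hoff hXY]; exact hY.1
      · rw [mismatches_congr hoff hXY]; exact hY.2 j hja hjb
    rw [hset, instanceLaw, measureReal_inter_of_disjoint (columnLaw ρ a b)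
      (S := positions L 0 (N * k)) (T := positions L (N * k) k), pow_succ]
    · refine mul_le_mul (ih (by omega)) ?_ measureReal_nonneg (by positivity)
      exact measureReal_not_goodBlock_le h0 h1 hab hL ht hk
    · rw [Finset.disjoint_left]
      intro q hq hq'
      simp only [positions, Finset.mem_filter, Finset.mem_univ, true_and] at hq hq'
      omega
    · intro X Y hXY hX β hβ hY
      have hβk : (β + 1) * k ≤ N * k := Nat.mul_le_mul_right k hβ
      rw [add_mul, one_mul] at hβk
      refine hX β hβ (hcongr _ (by omega) X Y (fun q hq => hXY q ?_) hY)
      simp only [positions, Finset.mem_filter, Finset.mem_univ, true_and] at hq ⊢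
      omega
    · intro X Y hXY hX hY
      exact hX (hcongr _ hL X Y hXY hY)

/-- The comparison of `i` and `j` on the first `V` positions gives the wrong result. -/
def Misjudged (a b i j : Fin n) (V thr : ℕ) (X : Strings n L) : Prop :=
  ¬ (mismatches X.input i j 0 V ≤ thr ↔ (i = a ∧ j = b ∨ i = b ∧ j = a))

/-- Hoeffding is applied to the mismatches of the correlated pair and to the agreements of any other
pair. In both cases an error requires a deviation of order ℓ from the mean. -/
theorem measureReal_misjudged_le (h0 : 0 ≤ ρ) (h1 : ρ ≤ 1) (hab : a ≠ b) {A D ℓ : ℕ}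
    (hA : 0 < A) (hℓ : 0 < ℓ) (hD1 : (1 - ρ) / 2 * A ≤ D) (hD2 : (D : ℝ) ≤ A / 2)
    (hAD1 : 2 * (A : ℝ) ≤ (D - (1 - ρ) / 2 * A) ^ 2) (hAD2 : 2 * (A : ℝ) ≤ (A / 2 - D) ^ 2)
    (hL : A * ℓ ≤ L) {i j : Fin n} (hij : i ≠ j) :
    (instanceLaw ρ a b L).real {X | Misjudged a b i j (A * ℓ) (D * ℓ) X} ≤ Real.exp (-4 * ℓ) := by
  classical
  have := isProbabilityMeasure_columnLaw h0 h1 a b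
  have := isProbabilityMeasure_instanceLaw (a := a) (b := b) (L := L) h0 h1
  set S := positions L 0 (A * ℓ) with hS
  have hSc : S.card = A * ℓ := card_positions (by omega)
  have hA' : (0 : ℝ) < A := by exact_mod_cast hA
  have hℓ' : (0 : ℝ) < ℓ := by exact_mod_cast hℓ
  -- A deviation x ℓ over A ℓ positions has Hoeffding exponent 2 x ^ 2 ℓ / A, which is at least 4 ℓ.
  have hexp : ∀ x : ℝ, 2 * (A : ℝ) ≤ x ^ 2 →
      Real.exp (-2 * (x * ℓ) ^ 2 / ((A * ℓ : ℕ) : ℝ)) ≤ Real.exp (-4 * ℓ) := by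
    intro x hx
    refine Real.exp_le_exp.2 ?_
    push_cast
    rw [div_le_iff₀ (by positivity)]
    nlinarith [mul_le_mul_of_nonneg_right hx (sq_nonneg (ℓ : ℝ))]
  by_cases hpair : i = a ∧ j = b ∨ i = b ∧ j = a
  · have hν : (columnLaw ρ a b).real {x | x i ≠ x j} = (1 - ρ) / 2 := by
      rcases hpair with ⟨rfl, rfl⟩ | ⟨rfl, rfl⟩
      · exact columnLaw_real_pair h0 h1 hab
      · rw [← columnLaw_real_pair h0 h1 hab]
        congr 1
        ext x
        exact ne_comm
    have h := measureReal_card_ge_le_exp (L := L) (columnLaw ρ a b) S {x | x i ≠ x j}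
      (ε := (D - (1 - ρ) / 2 * A) * ℓ) (mul_nonneg (by linarith) hℓ'.le)
    rw [hν, hSc] at h
    refine le_trans (measureReal_mono ?_) (h.trans (hexp _ hAD1))
    intro X hX
    simp only [Misjudged, hpair, iff_true, not_le, Set.mem_ofPred_eq] at hX
    rw [mismatches_input X i j (by omega), ← hS] at hX
    have hX' : ((D * ℓ : ℕ) : ℝ) ≤ ((S.filter fun q => X q i ≠ X q j).card : ℝ) := by
      exact_mod_cast hX.le
    rw [Set.mem_ofPred_eq]
    push_cast at hX' ⊢
    simp only [Set.mem_ofPred_eq]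
    refine le_trans (le_of_eq ?_) (hX'.trans (le_of_eq ?_))
    · ring
    · congr!
  · have hν : (columnLaw ρ a b).real {x | x i ≠ x j}ᶜ = 1 / 2 := by
      rw [probReal_compl_eq_one_sub .of_discrete, columnLaw_real_other h0 h1 hij hpair]
      norm_num
    have h := measureReal_card_ge_le_exp (L := L) (columnLaw ρ a b) S {x | x i ≠ x j}ᶜ
      (ε := (A / 2 - D) * ℓ) (mul_nonneg (by linarith) hℓ'.le)
    rw [hν, hSc] at h
    refine le_trans (measureReal_mono ?_) (h.trans (hexp _ hAD2))
    intro X hX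
    simp only [Misjudged, hpair, iff_false, not_not, Set.mem_ofPred_eq] at hX
    rw [mismatches_input X i j (by omega), ← hS] at hX
    have hsum := Finset.card_filter_add_card_filter_not (s := S) (fun q => X q i ≠ X q j)
    rw [hSc] at hsum
    have hX' : ((A * ℓ : ℕ) : ℝ) - ((D * ℓ : ℕ) : ℝ) ≤
        ((S.filter fun q => ¬ (X q i ≠ X q j)).card : ℝ) := by
      rw [sub_le_iff_le_add]
      have hle : A * ℓ ≤ (S.filter fun q => ¬ (X q i ≠ X q j)).card + D * ℓ := by omega
      exact_mod_cast hle
    rw [Set.mem_ofPred_eq]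
    push_cast at hX' ⊢
    simp only [Set.mem_compl_iff, Set.mem_ofPred_eq]
    refine le_trans (le_of_eq ?_) (hX'.trans (le_of_eq ?_))
    · ring
    · congr!

/-- At most n ^ 2 ordered pairs are each misjudged with probability at most n ^ (-5), and no block
is good with probability at most n ^ (-3); together 2 / n ^ 3 ≤ 1 / n ^ 2. The compared positions
overlap the blocks, but a union bound needs no independence. -/
theorem one_sub_le_measureReal_goodInstance (h0 : 0 ≤ ρ) (h1 : ρ ≤ 1) (hn : 2 ≤ n) (hab : a ≠ b)
    {A D k t : ℕ}
    (hA : 0 < A) (hD1 : (1 - ρ) / 2 * A ≤ D) (hD2 : (D : ℝ) ≤ A / 2)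
    (hAD1 : 2 * (A : ℝ) ≤ (D - (1 - ρ) / 2 * A) ^ 2) (hAD2 : 2 * (A : ℝ) ≤ (A / 2 - D) ^ 2)
    (ht : (1 - ρ) * k ≤ t + 1) (hk : 8 * n ≤ 2 ^ k)
    (hL : A * n.size ≤ L) (hL' : 5 * n.size * k ≤ L) :
    1 - 1 / (n : ℝ) ^ 2 ≤ (instanceLaw ρ a b L).real
      {X | GoodInstance a b (A * n.size) (D * n.size) k t (5 * n.size) X} := by
  classical
  have := isProbabilityMeasure_instanceLaw (a := a) (b := b) (L := L) h0 h1
  set ℓ := n.size with hℓ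
  have hℓ0 : 0 < ℓ := Nat.size_pos.2 (by omega)
  have hnℓ : n < 2 ^ ℓ := Nat.lt_size_self n
  have hnR : (n : ℝ) ≤ 2 ^ ℓ := by exact_mod_cast hnℓ.le
  have hn2 : (2 : ℝ) ≤ n := by exact_mod_cast hn
  set G := {X : Strings n L | GoodInstance a b (A * ℓ) (D * ℓ) k t (5 * ℓ) X} with hG
  set pairs := (Finset.univ : Finset (Fin n × Fin n)).filter fun p => p.1 ≠ p.2 with hpairs
  have hsub : Gᶜ ⊆ (⋃ p ∈ pairs, {X | Misjudged a b p.1 p.2 (A * ℓ) (D * ℓ) X}) ∪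
      {X | ∀ β < 5 * ℓ, ¬ GoodBlock a b k t (β * k) X} := by
    intro X hX
    simp only [hG, GoodInstance, Set.mem_compl_iff, Set.mem_ofPred_eq, not_and_or, not_forall,
      not_exists] at hX
    rcases hX with ⟨i, j, hij, hX⟩ | hX
    · left
      simp only [Set.mem_iUnion]
      exact ⟨(i, j), by simpa [hpairs] using hij, hX⟩
    · right
      exact fun β hβ h => (hX β).elim (fun h' => h' hβ) fun h' => h' h
  -- From exp (-4) ≤ 2 ^ (-5) and n ≤ 2 ^ ℓ.
  have he4 : Real.exp (-4 * ℓ) ≤ (1 / n : ℝ) ^ 5 := by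
    have h32 : Real.exp (-4) ≤ (1 / 2) ^ 5 := by
      have h2 : (2.7 : ℝ) ≤ Real.exp 1 := by linarith [Real.exp_one_gt_d9]
      have h3 : (2.7 : ℝ) ^ 4 ≤ Real.exp 1 ^ 4 := by gcongr
      rw [← Real.exp_nat_mul] at h3
      rw [Real.exp_neg]
      norm_num at h3 ⊢
      rw [inv_le_comm₀ (Real.exp_pos _) (by norm_num)]
      linarith
    calc Real.exp (-4 * ℓ) = Real.exp (-4) ^ ℓ := by rw [← Real.exp_nat_mul, mul_comm]
      _ ≤ ((1 / 2) ^ 5) ^ ℓ := by gcongr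
      _ = (1 / 2 ^ ℓ) ^ 5 := by rw [← pow_mul, mul_comm, pow_mul, one_div_pow]
      _ ≤ (1 / n : ℝ) ^ 5 := by gcongr
  -- From (5/8) ^ 5 ≤ 1/8, which is the reason for taking five times ℓ blocks.
  have hblock : ((5 : ℝ) / 8) ^ (5 * ℓ) ≤ (1 / n : ℝ) ^ 3 := by
    calc ((5 : ℝ) / 8) ^ (5 * ℓ) = ((5 / 8) ^ 5) ^ ℓ := by rw [pow_mul]
      _ ≤ ((1 / 2) ^ 3) ^ ℓ := by gcongr; norm_num
      _ = (1 / 2 ^ ℓ) ^ 3 := by rw [← pow_mul, mul_comm, pow_mul, one_div_pow]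
      _ ≤ (1 / n : ℝ) ^ 3 := by gcongr
  have hpc : (pairs.card : ℝ) ≤ n ^ 2 := by
    have : pairs.card ≤ n ^ 2 := by
      refine (Finset.card_filter_le _ _).trans ?_
      simp [pow_two]
    exact_mod_cast this
  have hbad : (instanceLaw ρ a b L).real Gᶜ ≤ 1 / (n : ℝ) ^ 2 := by
    calc (instanceLaw ρ a b L).real Gᶜ ≤ _ := measureReal_mono hsub
      _ ≤ _ := measureReal_union_le _ _
      _ ≤ ∑ _p ∈ pairs, Real.exp (-4 * ℓ) + (5 / 8) ^ (5 * ℓ) := by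
        refine add_le_add ((measureReal_biUnion_finset_le _ _).trans (Finset.sum_le_sum ?_))
          (measureReal_no_goodBlock_le h0 h1 hab ht hk _ hL')
        intro p hp
        exact measureReal_misjudged_le h0 h1 hab hA hℓ0 hD1 hD2 hAD1 hAD2 hL
          (by simpa [hpairs] using hp)
      _ ≤ (n : ℝ) ^ 2 * (1 / n) ^ 5 + (1 / n) ^ 3 := by
        rw [Finset.sum_const, nsmul_eq_mul]
        gcongr
      _ = 2 / n * (1 / (n : ℝ) ^ 2) := by field_simp; norm_num
      _ ≤ 1 * (1 / (n : ℝ) ^ 2) := by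
        gcongr
        rw [div_le_one (by linarith)]
        exact hn2
      _ = _ := one_mul _
  have := probReal_compl_eq_one_sub (μ := instanceLaw ρ a b L) (s := G) .of_discrete
  linarith

end Probability

end LightBulb

namespace LightBulb

/-! ### Entropy -/

theorem H2_zero : H2 0 = 0 := by simp [H2]

theorem H2_half : H2 (1 / 2) = 1 := by
  have : Real.log 2 ≠ 0 := (Real.log_pos one_lt_two).ne'
  rw [H2, one_div, Real.binEntropy_two_inv, div_self this]

theorem H2_one_sub (x : ℝ) : H2 (1 - x) = H2 x := by simp [H2]

theorem H2_nonneg {x : ℝ} (h0 : 0 ≤ x) (h1 : x ≤ 1) : 0 ≤ H2 x :=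
  div_nonneg (Real.binEntropy_nonneg h0 h1) (Real.log_pos one_lt_two).le

theorem H2_le_one (x : ℝ) : H2 x ≤ 1 :=
  (div_le_one (Real.log_pos one_lt_two)).2 Real.binEntropy_le_log_two

/-- Concavity, together with H2(0) = 0. -/
theorem mul_H2_le {c y : ℝ} (hc0 : 0 ≤ c) (hc1 : c ≤ 1) (hy0 : 0 ≤ y) (hy1 : y ≤ 1) :
    c * H2 y ≤ H2 (c * y) := by
  have h := Real.strictConcave_binEntropy.concaveOn.2 (show (0 : ℝ) ∈ Set.Icc 0 1 by simp)
    (show y ∈ Set.Icc 0 1 from ⟨hy0, hy1⟩) (show 0 ≤ 1 - c by linarith) hc0 (by ring)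
  simp only [Real.binEntropy_zero, smul_eq_mul, mul_zero, zero_add] at h
  rw [H2, H2, ← mul_div_assoc]
  exact div_le_div_of_nonneg_right h (Real.log_pos one_lt_two).le

theorem two_mul_le_H2 {x : ℝ} (h0 : 0 ≤ x) (h1 : x ≤ 1 / 2) : 2 * x ≤ H2 x := by
  have h := mul_H2_le (c := 2 * x) (y := 1 / 2) (by linarith) (by linarith) (by norm_num)
    (by norm_num)
  rw [H2_half, mul_one] at h
  convert h using 2
  ring

/-- The estimates log(1 - ρ) ≥ 1 - 1/(1 - ρ) and log(1 + ρ) ≥ 2ρ/(2 + ρ) yield a gap of ρ²/6. The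
weaker constant 1/8 is just what `one_le_exponent` needs. -/
theorem binEntropy_le_log_two_sub {ρ : ℝ} (h0 : 0 < ρ) (h1 : ρ ≤ 1) :
    Real.binEntropy ((1 - ρ) / 2) ≤ Real.log 2 - ρ ^ 2 / 8 := by
  rcases h1.eq_or_lt with rfl | h1
  · norm_num
    linarith [Real.log_two_gt_d9]
  have e : Real.binEntropy ((1 - ρ) / 2) = Real.log 2
      - ((1 - ρ) * Real.log (1 - ρ) + (1 + ρ) * Real.log (1 + ρ)) / 2 := by
    rw [Real.binEntropy_eq_negMulLog_add_negMulLog_one_sub, Real.negMulLog, Real.negMulLog,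
      show 1 - (1 - ρ) / 2 = (1 + ρ) / 2 by ring, Real.log_div (by linarith) (by norm_num),
      Real.log_div (by linarith) (by norm_num)]
    ring
  have hl1 := Real.le_log_one_add_of_nonneg h0.le
  have hl2 : -ρ ≤ (1 - ρ) * Real.log (1 - ρ) := by
    have h := Real.one_sub_inv_le_log_of_pos (x := 1 - ρ) (by linarith)
    have h' := mul_le_mul_of_nonneg_left h (show 0 ≤ 1 - ρ by linarith)
    rw [mul_sub, mul_inv_cancel₀ (by linarith)] at h'
    linarith
  have hl3 : ρ + ρ ^ 2 / 3 ≤ (1 + ρ) * Real.log (1 + ρ) := by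
    refine le_trans ?_ (mul_le_mul_of_nonneg_left hl1 (by linarith))
    rw [← mul_div_assoc, le_div_iff₀ (by linarith)]
    nlinarith [mul_nonneg (sq_nonneg ρ) (show 0 ≤ 1 - ρ by linarith)]
  rw [e]
  nlinarith [sq_nonneg ρ]

/-- With y = H2((1 - ρ)/2) ≥ 1/2, symmetry and the chord bound give H2(y) = H2(1 - y) ≥ 2(1 - y) ≥
ρ²/(4 ln 2). -/
theorem one_le_exponent {ρ : ℝ} (h0 : 0 < ρ) (h1 : ρ ≤ 1) (h : 1 / 2 ≤ H2 ((1 - ρ) / 2)) :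
    1 ≤ H2 (H2 ((1 - ρ) / 2)) * (4 * Real.log 2 / ρ ^ 2) := by
  have hlog := Real.log_pos one_lt_two
  have hy : ρ ^ 2 / 8 ≤ (1 - H2 ((1 - ρ) / 2)) * Real.log 2 := by
    rw [sub_mul, H2, div_mul_cancel₀ _ hlog.ne']
    linarith [binEntropy_le_log_two_sub h0 h1]
  have hH := two_mul_le_H2 (x := 1 - H2 ((1 - ρ) / 2)) (by linarith [H2_le_one ((1 - ρ) / 2)])
    (by linarith)
  rw [H2_one_sub] at hH
  rw [← mul_div_assoc, le_div_iff₀ (by positivity)]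
  nlinarith

theorem H2inv_nonneg {y : ℝ} (h0 : 0 ≤ y) (h1 : y ≤ 1) : 0 ≤ H2inv y := by
  have hcont : ContinuousOn H2 (Set.Icc 0 (1 / 2)) :=
    (Real.binEntropy_continuous.div_const _).continuousOn
  have h := intermediate_value_Icc (show (0 : ℝ) ≤ 1 / 2 by norm_num) hcont
  rw [H2_zero, H2_half] at h
  exact (Function.invFunOn_mem (h ⟨h0, h1⟩)).1

/-- The quotient δ / H2inv (1 - r) is nonnegative, so every term of the supremum is at most r < 1 -
H2 δ. The right side is also nonnegative, which covers an empty index set. -/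
theorem kappaZ_le {δ : ℝ} (h0 : 0 ≤ δ) (h1 : δ ≤ 1) : kappaZ δ ≤ 1 - H2 δ := by
  refine Real.sSup_le ?_ (by linarith [H2_le_one δ])
  rintro _ ⟨r, ⟨hr0, hr1⟩, rfl⟩
  have hH := H2_nonneg h0 h1
  have := div_nonneg h0 (H2inv_nonneg (y := 1 - r) (by linarith) (by linarith))
  dsimp only
  nlinarith

/-! ### Counting error patterns -/

/-- The summands are the probabilities of words of k independent bits, each equal to one with
probability x. -/
theorem sum_wt_le_one {x : ℝ} (h0 : 0 ≤ x) (h1 : x ≤ 1) (k : ℕ) :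
    ∑ e ∈ Finset.range (2 ^ k), x ^ wt k e * (1 - x) ^ (k - wt k e) ≤ 1 := by
  have hinj : Set.InjOn (fun e : ℕ => (Finset.range k).filter fun i => e.testBit i)
      (Finset.range (2 ^ k) : Finset ℕ) := by
    intro e he e' he' h
    have he := Finset.mem_range.1 he
    have he' := Finset.mem_range.1 he'
    refine word_injOn he he' (funext fun i => ?_)
    have := Finset.ext_iff.1 h i
    simp only [Finset.mem_filter, Finset.mem_range, i.2, true_and] at this
    exact Bool.eq_iff_iff.2 this
  have h := Finset.sum_pow_mul_eq_add_pow x (1 - x) (Finset.range k)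
  rw [add_sub_cancel, one_pow] at h
  refine le_trans ?_ h.le
  have himg := Finset.sum_image (f := fun t : Finset ℕ =>
    x ^ t.card * (1 - x) ^ ((Finset.range k).card - t.card)) hinj
  simp only [Finset.card_range] at himg ⊢
  rw [show (∑ e ∈ Finset.range (2 ^ k), x ^ wt k e * (1 - x) ^ (k - wt k e)) = _ from himg.symm]
  refine Finset.sum_le_sum_of_subset_of_nonneg ?_ fun t _ _ => ?_
  · intro t ht
    obtain ⟨e, -, rfl⟩ := Finset.mem_image.1 ht
    exact Finset.mem_powerset.2 (Finset.filter_subset _ _)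
  · exact mul_nonneg (pow_nonneg h0 _) (pow_nonneg (by linarith) _)

theorem patternCount_zero_le (k : ℕ) : patternCount k 0 ≤ 1 := by
  refine Finset.card_le_one.2 fun e he e' he' => ?_
  simp only [Finset.mem_filter, Finset.mem_range, Nat.le_zero] at he he'
  refine word_injOn he.1 he'.1 (hammingDist_eq_zero.1 ?_)
  have h1 := wt_xor_triangle k e 0 e'
  rw [← hammingDist_word, Nat.zero_xor, Nat.zero_xor] at h1
  omega

/-- Under the product weights of `sum_wt_le_one` the mass of a word does not increase with its
weight, as x ≤ 1/2. So each word of weight at most x k has mass at least 2 ^ (-H2(x) k), and the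
total mass is at most one. -/
theorem patternCount_le_rpow {x : ℝ} (h0 : 0 ≤ x) (h1 : x ≤ 1 / 2) {k t : ℕ} (ht : (t : ℝ) ≤ x * k) :
    (patternCount k t : ℝ) ≤ (2 : ℝ) ^ (H2 x * k) := by
  rcases h0.eq_or_lt with rfl | h0
  · have : t = 0 := by
      rw [zero_mul] at ht
      exact_mod_cast le_antisymm ht (Nat.cast_nonneg t)
    subst this
    rw [H2_zero, zero_mul, Real.rpow_zero]
    exact_mod_cast patternCount_zero_le k
  have hx1 : 0 < 1 - x := by linarith
  have hterm : ∀ e ∈ (Finset.range (2 ^ k)).filter (fun e => wt k e ≤ t),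
      (2 : ℝ) ^ (-(H2 x * k)) ≤ x ^ wt k e * (1 - x) ^ (k - wt k e) := by
    intro e he
    have hw := (Finset.mem_filter.1 he).2
    have hwR : (wt k e : ℝ) ≤ x * k := le_trans (by exact_mod_cast hw) ht
    have hlog : Real.log x ≤ Real.log (1 - x) := Real.log_le_log h0 (by linarith)
    rw [← Real.exp_log (show 0 < x ^ wt k e * (1 - x) ^ (k - wt k e) by positivity),
      Real.log_mul (by positivity) (by positivity), Real.log_pow, Real.log_pow,
      Nat.cast_sub (wt_le k e), Real.rpow_def_of_pos two_pos, Real.exp_le_exp]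
    have hH : Real.log 2 * H2 x = -(x * Real.log x) - (1 - x) * Real.log (1 - x) := by
      rw [H2, mul_div_cancel₀ _ (Real.log_pos one_lt_two).ne',
        Real.binEntropy_eq_negMulLog_add_negMulLog_one_sub, Real.negMulLog, Real.negMulLog]
      ring
    have : Real.log 2 * -(H2 x * k) = -(Real.log 2 * H2 x) * k := by ring
    rw [this, hH]
    nlinarith
  have hsum : (patternCount k t : ℝ) * (2 : ℝ) ^ (-(H2 x * k)) ≤ 1 := by
    calc (patternCount k t : ℝ) * (2 : ℝ) ^ (-(H2 x * k))
        = ∑ _e ∈ (Finset.range (2 ^ k)).filter (fun e => wt k e ≤ t), (2 : ℝ) ^ (-(H2 x * k)) := by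
          rw [Finset.sum_const, nsmul_eq_mul, patternCount]
      _ ≤ ∑ e ∈ (Finset.range (2 ^ k)).filter (fun e => wt k e ≤ t),
          x ^ wt k e * (1 - x) ^ (k - wt k e) := Finset.sum_le_sum hterm
      _ ≤ ∑ e ∈ Finset.range (2 ^ k), x ^ wt k e * (1 - x) ^ (k - wt k e) :=
          Finset.sum_le_sum_of_subset_of_nonneg (Finset.filter_subset _ _) fun e _ _ =>
            mul_nonneg (pow_nonneg h0.le _) (pow_nonneg hx1.le _)
      _ ≤ 1 := sum_wt_le_one h0.le (by linarith) k
  rwa [Real.rpow_neg two_pos.le, ← div_eq_mul_inv, div_le_one (Real.rpow_pos_of_pos two_pos _)]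
    at hsum

/-! ### Sizes -/

theorem logb_le_size {n : ℕ} (hn : 2 ≤ n) : Real.logb 2 n ≤ n.size := by
  have h : (n : ℝ) ≤ 2 ^ n.size := by exact_mod_cast (Nat.lt_size_self n).le
  rw [Real.logb_le_iff_le_rpow one_lt_two (by positivity), Real.rpow_natCast]
  exact h

theorem one_le_logb {n : ℕ} (hn : 2 ≤ n) : 1 ≤ Real.logb 2 n := by
  rw [Real.le_logb_iff_rpow_le one_lt_two (by positivity), Real.rpow_one]
  exact_mod_cast hn

theorem two_pow_size_le {n : ℕ} (hn : 2 ≤ n) : 2 ^ n.size ≤ 2 * n := by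
  have h1 : 1 ≤ n.size := Nat.size_pos.2 (by omega)
  obtain ⟨j, hj⟩ : ∃ j, n.size = j + 1 := ⟨n.size - 1, by omega⟩
  have h : 2 ^ j ≤ n := Nat.lt_size.1 (by omega)
  rw [hj, pow_succ]
  omega

theorem size_le_logb_add_one {n : ℕ} (hn : 2 ≤ n) : (n.size : ℝ) ≤ Real.logb 2 n + 1 := by
  have h : (2 : ℝ) ^ n.size ≤ 2 * n := by exact_mod_cast two_pow_size_le hn
  have hn0 : (0 : ℝ) < n := by positivity
  have := Real.logb_le_logb_of_le one_lt_two (by positivity) h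
  rw [Real.logb_pow, Real.logb_mul two_ne_zero hn0.ne', Real.logb_self_eq_one one_lt_two] at this
  linarith

/-- A relative weight `p / q` of the error patterns for which the block of the pair is found with
probability at least one half, and for which there are few enough patterns. -/
theorem exists_pattern_weight {ρ e : ℝ} (h0 : 0 < ρ) (h1 : ρ ≤ 1)
    (he : 1 ≤ e * (4 * Real.log 2 / ρ ^ 2) ∨
      H2 ((1 - ρ) / 2) ≤ 1 / 2 ∧ 2 * H2 ((1 - ρ) / 2) ≤ e) :
    ∃ p q : ℕ, 0 < q ∧ (1 - ρ) * q ≤ p ∧ ∀ n : ℕ, 2 ≤ n →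
      (patternCount (n.size + 3) ((n.size + 3) * p / q) : ℝ) ≤
        256 * (2 : ℝ) ^ (e * (4 * Real.log 2 * Real.logb 2 n / ρ ^ 2)) := by
  rcases he with he | ⟨hδ2, he⟩
  -- The time bound leaves a factor n for the patterns, which pays for all 2 ^ k ≤ 16 n words.
  · refine ⟨1, 1, one_pos, by push_cast; linarith, fun n hn => ?_⟩
    have hlg := one_le_logb hn
    calc (patternCount (n.size + 3) ((n.size + 3) * 1 / 1) : ℝ) ≤ 2 ^ (n.size + 3) := by
          exact_mod_cast patternCount_le _ _
      _ = 8 * 2 ^ n.size := by rw [pow_add]; ring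
      _ ≤ 8 * (2 * n) := by
          gcongr
          exact_mod_cast two_pow_size_le hn
      _ ≤ 256 * (n : ℝ) := by linarith [(Nat.cast_nonneg n : (0 : ℝ) ≤ n)]
      _ = 256 * (2 : ℝ) ^ Real.logb 2 n := by
          rw [Real.rpow_logb two_pos (by norm_num) (by positivity)]
      _ ≤ _ := by
          gcongr
          · norm_num
          · have : e * (4 * Real.log 2 * Real.logb 2 n / ρ ^ 2)
                = e * (4 * Real.log 2 / ρ ^ 2) * Real.logb 2 n := by ring
            rw [this]
            nlinarith
  · set δ := (1 - ρ) / 2 with hδ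
    have hδ0 : 0 ≤ δ := by rw [hδ]; linarith
    have hδ4 : δ ≤ 1 / 4 := by
      have := two_mul_le_H2 hδ0 (by rw [hδ]; linarith)
      linarith
    -- The weight is rational because the program text contains only natural numbers. The lower
    -- bound 2δ serves Markov's inequality; the upper bounds 1/2 and 4δ serve the count.
    obtain ⟨p, q, hq, hp1, hp2, hp3⟩ : ∃ p q : ℕ, 0 < q ∧ 2 * δ ≤ (p : ℝ) / q ∧
        (p : ℝ) / q ≤ 1 / 2 ∧ (p : ℝ) / q ≤ 4 * δ := by
      rcases hδ0.eq_or_lt with h | h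
      · exact ⟨0, 1, one_pos, by simp [← h], by simp, by simp [← h]⟩
      rcases hδ4.eq_or_lt with h' | h'
      · exact ⟨1, 2, two_pos, by rw [h']; norm_num, by norm_num, by rw [h']; norm_num⟩
      · obtain ⟨r, hr1, hr2⟩ := exists_rat_btwn (show 2 * δ < min (1 / 2) (4 * δ) from
          lt_min (by linarith) (by linarith))
        have hr0 : (0 : ℚ) < r := by
          have : (0 : ℝ) < r := by linarith
          exact_mod_cast this
        have hr : ((r.num.toNat : ℕ) : ℝ) / (r.den : ℝ) = r := by
          have h2 : ((r.num.toNat : ℕ) : ℤ) = r.num := Int.toNat_of_nonneg (Rat.num_pos.2 hr0).le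
          have h3 : ((r.num.toNat : ℕ) : ℝ) = (r.num : ℝ) := by exact_mod_cast h2
          rw [h3]
          exact_mod_cast Rat.num_div_den r
        exact ⟨r.num.toNat, r.den, r.den_pos, by rw [hr]; exact hr1.le,
          by rw [hr]; exact hr2.le.trans (min_le_left _ _),
          by rw [hr]; exact hr2.le.trans (min_le_right _ _)⟩
    have hq' : (0 : ℝ) < q := by exact_mod_cast hq
    refine ⟨p, q, hq, ?_, fun n hn => ?_⟩
    · rw [le_div_iff₀ hq'] at hp1
      rw [show 1 - ρ = 2 * δ by rw [hδ]; ring]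
      exact hp1
    set x : ℝ := (p : ℝ) / q with hx
    have hx0 : 0 ≤ x := by positivity
    have hlg := one_le_logb hn
    have hsz := size_le_logb_add_one hn
    have hHδ := H2_nonneg hδ0 (by linarith)
    -- Concavity makes H2(y)/y decreasing, so H2(x) ≤ (x/δ) H2(δ) for x ≥ δ.
    have hHx : H2 x ≤ 4 * H2 δ := by
      rcases hδ0.eq_or_lt with h | h
      · have : x = 0 := le_antisymm (by rw [← h] at hp3; linarith) hx0
        rw [this, H2_zero]
        linarith
      · have hxp : 0 < x := by linarith
        have hm := mul_H2_le (c := δ / x) (y := x) (by positivity)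
          ((div_le_one hxp).2 (by linarith)) hx0 (by linarith)
        rw [div_mul_cancel₀ _ hxp.ne', div_mul_eq_mul_div, div_le_iff₀ hxp] at hm
        have : δ * H2 x ≤ δ * (4 * H2 δ) := by nlinarith
        exact le_of_mul_le_mul_left this h
    have ht : (((n.size + 3) * p / q : ℕ) : ℝ) ≤ x * ((n.size + 3 : ℕ) : ℝ) := by
      refine Nat.cast_div_le.trans (le_of_eq ?_)
      push_cast
      rw [hx]
      ring
    refine (patternCount_le_rpow hx0 hp2 ht).trans ?_
    -- The block length is at most log n + 4, and the extra 4 costs 16 H2(δ) ≤ 8 in the exponent.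
    have hpow : (256 : ℝ) = (2 : ℝ) ^ (8 : ℝ) := by norm_num
    rw [hpow, ← Real.rpow_add two_pos]
    refine Real.rpow_le_rpow_of_exponent_le one_le_two ?_
    have h4 : 4 * H2 δ ≤ e * (4 * Real.log 2 / ρ ^ 2) := by
      have hl : 2 ≤ 4 * Real.log 2 / ρ ^ 2 := by
        rw [le_div_iff₀ (by positivity)]
        nlinarith [Real.log_two_gt_d9]
      nlinarith
    have h5 : e * (4 * Real.log 2 * Real.logb 2 n / ρ ^ 2)
        = e * (4 * Real.log 2 / ρ ^ 2) * Real.logb 2 n := by ring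
    rw [h5]
    push_cast
    have hHx0 := H2_nonneg hx0 (by linarith)
    calc H2 x * (n.size + 3) ≤ 4 * H2 δ * (Real.logb 2 n + 4) := by
          refine mul_le_mul hHx ?_ (by positivity) (by linarith)
          linarith
      _ ≤ 8 + 4 * H2 δ * Real.logb 2 n := by nlinarith
      _ ≤ _ := by gcongr

end LightBulb

namespace LightBulb

/-! ### The search program solves the problem -/

theorem searchSteps_le {ℓ n A cnt : ℕ} (hn : 1 ≤ n) (h : 2 ^ (ℓ + 3) ≤ 16 * n) :
    searchSteps ℓ n (A * ℓ) cnt ≤ (160 * A + 1000) * (ℓ + 3) ^ 2 * (n * (cnt + 1)) := by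
  obtain ⟨k, hk⟩ : ∃ k, k = ℓ + 3 := ⟨_, rfl⟩
  obtain ⟨z, hz⟩ : ∃ z, z = n * (cnt + 1) := ⟨_, rfl⟩
  have hnz : n ≤ z := by rw [hz]; exact Nat.le_mul_of_pos_right _ (by omega)
  have hcz : n * cnt ≤ z := by rw [hz, mul_add]; omega
  have hzk : z ≤ z * k := Nat.le_mul_of_pos_right _ (by omega)
  have hkk : z * k ≤ z * k ^ 2 := Nat.mul_le_mul_left _ (Nat.le_self_pow two_ne_zero k)
  have hnk : n * k ≤ z * k := Nat.mul_le_mul_right k hnz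
  have hkz : k ≤ z * k := Nat.le_mul_of_pos_left k (by omega)
  have hinner : n * (9 * k + 16) + n * (cnt * (32 * (A * ℓ) + 14 * k + 58) + 9 * k + 15) + 10
      ≤ (32 * A + 131) * (z * k) := by
    have h1 : n * cnt * (32 * (A * ℓ) + 14 * k + 58) ≤ z * (32 * (A * k) + 72 * k) :=
      Nat.mul_le_mul hcz (by
        have := Nat.mul_le_mul_left A (show ℓ ≤ k by omega)
        omega)
    have h2 : z * (32 * (A * k) + 72 * k) = (32 * A + 72) * (z * k) := by ring
    have h3 : n * (9 * k + 16) + n * (cnt * (32 * (A * ℓ) + 14 * k + 58) + 9 * k + 15) + 10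
      = n * cnt * (32 * (A * ℓ) + 14 * k + 58) + 18 * (n * k) + 31 * n + 10 := by ring
    have h4 : (32 * A + 131) * (z * k) = (32 * A + 72) * (z * k) + 59 * (z * k) := by ring
    omega
  have h5 : 5 * ℓ * (n * (9 * k + 16) + n * (cnt * (32 * (A * ℓ) + 14 * k + 58) + 9 * k + 15) + 10)
      ≤ 5 * k * ((32 * A + 131) * (z * k)) := Nat.mul_le_mul (by omega) hinner
  have h6 : 5 * k * ((32 * A + 131) * (z * k)) = (160 * A + 655) * (z * k ^ 2) := by ring
  have h7 : 2 ^ k * (14 * k + 18) ≤ 16 * n * (20 * k) :=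
    Nat.mul_le_mul (by rw [hk]; exact h) (by omega)
  have h8 : 16 * n * (20 * k) = 320 * (n * k) := by ring
  have h9 : (160 * A + 1000) * k ^ 2 * (n * (cnt + 1))
      = (160 * A + 655) * (z * k ^ 2) + 345 * (z * k ^ 2) := by rw [hz]; ring
  rw [searchSteps, ← hk, h9]
  omega

/-- Source of the fourth power of the logarithm: two factors k come from the number of steps and two
from the bit length B = W k ^ 2. -/
theorem cost_le_of_steps_le {T S Z W k : ℕ} (hT : T ≤ 2 + S * (2 * (W * k ^ 2) + 1))
    (hS : S ≤ Z * k ^ 2) (hZ : 1 ≤ Z) (hk : 1 ≤ k) : T ≤ Z * (2 * W + 3) * k ^ 4 := by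
  have hk2 : 1 ≤ k ^ 2 := Nat.one_le_pow _ _ hk
  have hZk : 1 ≤ Z * k ^ 2 := Nat.mul_le_mul hZ hk2
  have h1 := Nat.mul_le_mul_right (2 * (W * k ^ 2) + 1) hS
  have h2 : 2 * (W * k ^ 2) + 3 ≤ (2 * W + 3) * k ^ 2 := by
    rw [add_mul, mul_assoc]
    omega
  calc T ≤ Z * k ^ 2 * (2 * (W * k ^ 2) + 1) + 2 * (Z * k ^ 2) := by omega
    _ = Z * k ^ 2 * (2 * (W * k ^ 2) + 3) := by ring
    _ ≤ Z * k ^ 2 * ((2 * W + 3) * k ^ 2) := Nat.mul_le_mul_left _ h2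
    _ = _ := by ring

/-- A threshold strictly between the two mismatch rates, with room to spare. -/
theorem exists_threshold {ρ : ℝ} (h0 : 0 < ρ) (h1 : ρ ≤ 1) :
    ∃ A D : ℕ, 0 < A ∧ (1 - ρ) / 2 * A ≤ D ∧ (D : ℝ) ≤ A / 2 ∧
      2 * (A : ℝ) ≤ (D - (1 - ρ) / 2 * A) ^ 2 ∧ 2 * (A : ℝ) ≤ (A / 2 - D) ^ 2 := by
  obtain ⟨r, hr1, hr2⟩ := exists_rat_btwn (show (1 - ρ) / 2 < 1 / 2 by linarith)
  have hr0 : (0 : ℚ) < r := by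
    have : (0 : ℝ) < r := by linarith
    exact_mod_cast this
  set num := r.num.toNat
  set den := r.den
  have hden : (0 : ℝ) < den := by exact_mod_cast r.den_pos
  have hr : (num : ℝ) = r * den := by
    have h2 : (num : ℤ) = r.num := Int.toNat_of_nonneg (Rat.num_pos.2 hr0).le
    have h3 : (num : ℝ) = (r.num : ℝ) := by exact_mod_cast h2
    rw [h3]
    exact_mod_cast (Rat.mul_den_eq_num r).symm
  set η := min ((r : ℝ) - (1 - ρ) / 2) (1 / 2 - r) with hη
  have hη0 : 0 < η := lt_min (by linarith) (by linarith)
  -- Scaling numerator and denominator by M multiplies A by M but the squared gaps by M ^ 2, so a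
  -- large M gives the required room.
  obtain ⟨M, hM⟩ := exists_nat_gt (2 / η ^ 2)
  have hMη : 2 ≤ η ^ 2 * M := by
    rw [div_lt_iff₀ (by positivity)] at hM
    linarith
  have hM0 : (0 : ℝ) < M := lt_trans (by positivity) hM
  have hAη : 2 * ((den : ℝ) * M) ≤ (η * (den * M)) ^ 2 := by
    have hd1 : (1 : ℝ) ≤ den := by exact_mod_cast r.den_pos
    have h1 : 2 * 1 ≤ η ^ 2 * M * den := mul_le_mul hMη hd1 zero_le_one (by positivity)
    calc 2 * ((den : ℝ) * M) = (2 * 1) * (den * M) := by ring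
      _ ≤ (η ^ 2 * M * den) * (den * M) := by gcongr
      _ = _ := by ring
  have hsq : ∀ x, η ≤ x → 2 * ((den : ℝ) * M) ≤ (x * (den * M)) ^ 2 := fun x hx =>
    hAη.trans (by gcongr)
  have hA0 : (0 : ℝ) < den * M := by positivity
  refine ⟨den * M, num * M, by exact_mod_cast hA0, ?_, ?_, ?_, ?_⟩ <;> push_cast <;> rw [hr]
  · nlinarith
  · nlinarith
  · convert hsq _ (min_le_left _ _) using 1
    ring
  · convert hsq _ (min_le_right _ _) using 1
    ring

theorem length_suffices {A n L : ℕ} (hn : 2 ≤ n) (hL : (2 * A + 50) * Real.logb 2 n ^ 2 ≤ L) :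
    A * n.size ≤ L ∧ 5 * n.size * (n.size + 3) ≤ L := by
  have hlg := one_le_logb hn
  have hsz := size_le_logb_add_one hn
  set lg := Real.logb 2 n
  have hA : (0 : ℝ) ≤ A := Nat.cast_nonneg A
  have h1 : (n.size : ℝ) ≤ 2 * lg := by linarith
  have h2 : (n.size : ℝ) + 3 ≤ 5 * lg := by linarith
  have h3 : lg ≤ lg ^ 2 := by rw [pow_two]; exact le_mul_of_one_le_left (by linarith) hlg
  have h4 : (A : ℝ) * n.size ≤ A * (2 * lg ^ 2) := by gcongr; linarith
  have h5 : (n.size : ℝ) * (n.size + 3) ≤ 2 * lg * (5 * lg) := by gcongr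
  have h6 : 0 ≤ (A : ℝ) * lg ^ 2 := by positivity
  constructor
  · have : ((A * n.size : ℕ) : ℝ) ≤ L := by
      push_cast
      linarith [sq_nonneg lg]
    exact_mod_cast this
  · have : ((5 * n.size * (n.size + 3) : ℕ) : ℝ) ≤ L := by
      push_cast
      linarith [sq_nonneg lg]
    exact_mod_cast this

/-- Common core of both claims. The initial memory may be arbitrary as long as its entries have
O(log ^ 2 n) bits, so the same program works on empty memory and after the preprocessing. -/
theorem exists_search_solves {ρ e : ℝ} (h0 : 0 < ρ) (h1 : ρ ≤ 1)
    (he : 1 ≤ e * (4 * Real.log 2 / ρ ^ 2) ∨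
      H2 ((1 - ρ) / 2) ≤ 1 / 2 ∧ 2 * H2 ((1 - ρ) / 2) ≤ e) (W : ℕ) :
    ∃ (Q : Cmd) (C c : ℝ), ∀ n : ℕ, 2 ≤ n → ∀ mem : ℕ → ℕ,
      (∀ x, mem x < 2 ^ (W * (n.size + 3) ^ 2)) → ∀ L : ℕ, c * Real.logb 2 n ^ 2 ≤ L →
        Solves Q mem ρ n L (timeBound ρ e C 4 0 n) := by
  obtain ⟨A, D, hA, hD1, hD2, hAD1, hAD2⟩ := exists_threshold h0 h1
  obtain ⟨p, q, hq, hpq, hcount⟩ := exists_pattern_weight h0 h1 he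
  have he0 : 0 ≤ e := by
    rcases he with he | ⟨-, he⟩
    · by_contra hneg
      push Not at hneg
      have : e * (4 * Real.log 2 / ρ ^ 2) ≤ 0 :=
        mul_nonpos_of_nonpos_of_nonneg hneg.le (by have := Real.log_pos one_lt_two; positivity)
      linarith
    · linarith [H2_nonneg (x := (1 - ρ) / 2) (by linarith) (by linarith)]
  set W' := W + (A + D + p + q + 10) with hW'
  refine ⟨search A D p q, ((160 * A + 1000) * (2 * W' + 3)) * 5 ^ 4 * 257, 2 * A + 50,
    fun n hn mem hmem L hL => ?_⟩
  have hlg := one_le_logb hn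
  have hsz := size_le_logb_add_one hn
  set lg := Real.logb 2 n with hlgd
  set k := n.size + 3 with hk
  set t := k * p / q with ht
  set cnt := patternCount k t with hcnt
  have hmem' : ∀ x, mem x < 2 ^ (W' * k ^ 2) := fun x => (hmem x).trans_le
    (Nat.pow_le_pow_right two_pos (Nat.mul_le_mul_right _ (by omega)))
  have hB : (A + D + p + q + 10) * k ^ 2 ≤ W' * k ^ 2 := Nat.mul_le_mul_right _ (by omega)
  have hkR : (k : ℝ) ≤ 5 * lg := by
    rw [hk]; push_cast; linarith
  have h2k : 2 ^ k ≤ 16 * n := by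
    have := two_pow_size_le hn
    rw [hk, pow_add]
    omega
  have hexec := fun X : Strings n L =>
    exec_search (L := L) (inp := X.input) X.input_le_one hB hmem'
  refine ⟨fun X => ?_, fun a b hab => ?_⟩
  · obtain ⟨T, s', hT, hTle, -⟩ := hexec X
    refine ⟨T, s', hT, ?_⟩
    have hE0 : 0 ≤ e * (4 * Real.log 2 * lg / ρ ^ 2) := by
      have := Real.log_pos one_lt_two
      positivity
    have hcnt' := hcount n hn
    rw [timeBound, add_zero, mul_one]
    set E := (2 : ℝ) ^ (e * (4 * Real.log 2 * lg / ρ ^ 2)) with hE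
    have hE1 : 1 ≤ E := Real.one_le_rpow one_le_two hE0
    have hnat : T ≤ (160 * A + 1000) * (n * (cnt + 1)) * (2 * W' + 3) * k ^ 4 := by
      refine cost_le_of_steps_le hTle ?_ (Nat.one_le_iff_ne_zero.2 (by positivity)) (by omega)
      refine (searchSteps_le (by omega) h2k).trans (le_of_eq ?_)
      ring
    have hcast : (T : ℝ) ≤ (160 * A + 1000) * (n * (cnt + 1)) * (2 * W' + 3) * (k : ℝ) ^ 4 := by
      exact_mod_cast hnat
    calc (T : ℝ) ≤ (160 * A + 1000) * (n * (cnt + 1)) * (2 * W' + 3) * (k : ℝ) ^ 4 := hcast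
      _ ≤ (160 * A + 1000) * (n * (256 * E + E)) * (2 * W' + 3) * (5 * lg) ^ 4 := by
        gcongr
      _ = _ := by ring
  · have hP := one_sub_le_measureReal_goodInstance (L := L) (t := t) h0.le h1 hn hab hA hD1 hD2
      hAD1 hAD2 (k := k) ?_ ?_ ?_ ?_
    · have := isProbabilityMeasure_instanceLaw (a := a) (b := b) (L := L) h0.le h1
      refine hP.trans (MeasureTheory.measureReal_mono fun X hX => ?_)
      obtain ⟨T, s', hT, -, hs⟩ := hexec X
      exact ⟨T, s', hT, GoodInstance.output hab hX hs⟩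
    · have hq' : (0 : ℝ) < q := by exact_mod_cast hq
      -- As t is k p / q rounded down, (1 - ρ) k ≤ k p / q < t + 1, which is the form needed for
      -- Markov's inequality.
      have hlt : k * p < (t + 1) * q := by
        rw [mul_comm (t + 1)]
        exact Nat.lt_mul_div_succ _ hq
      have hltR : (k : ℝ) * p < (t + 1) * q := by exact_mod_cast hlt
      refine le_of_mul_le_mul_right ?_ hq'
      calc (1 - ρ) * k * q = k * ((1 - ρ) * q) := by ring
        _ ≤ k * p := by gcongr
        _ ≤ _ := hltR.le
    · have := (Nat.lt_size_self n).le
      rw [hk, pow_add]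
      omega
    · exact (length_suffices hn hL).1
    · exact (length_suffices hn hL).2

theorem timeBound_mono {ρ e C C' : ℝ} (h : C ≤ C') {k n : ℕ} (hn : 2 ≤ n) (ε : ℝ) :
    timeBound ρ e C k ε n ≤ timeBound ρ e C' k ε n := by
  have := one_le_logb hn
  unfold timeBound
  gcongr

/-! ### The cost of the preprocessing -/

theorem logb_pow_four_le {γ : ℝ} (hγ : 0 < γ) {n : ℕ} :
    Real.logb 2 n ^ 4 ≤ (4 / (γ * Real.log 2)) ^ 4 * (n : ℝ) ^ γ := by
  have hlog := Real.log_pos one_lt_two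
  have hn : (0 : ℝ) ≤ n := Nat.cast_nonneg n
  have h := Real.log_le_rpow_div hn (show 0 < γ / 4 by positivity)
  have h' : Real.logb 2 n ≤ 4 / (γ * Real.log 2) * (n : ℝ) ^ (γ / 4) := by
    rw [Real.logb, div_le_iff₀ hlog]
    refine h.trans (le_of_eq ?_)
    field_simp
  have hpos : 0 ≤ Real.logb 2 n := div_nonneg (Real.log_natCast_nonneg n) hlog.le
  calc Real.logb 2 n ^ 4 ≤ (4 / (γ * Real.log 2) * (n : ℝ) ^ (γ / 4)) ^ 4 := by gcongr
    _ = _ := by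
      rw [mul_pow, ← Real.rpow_natCast ((n : ℝ) ^ (γ / 4)), ← Real.rpow_mul hn]
      norm_num

theorem exists_preprocess {ρ : ℝ} (h0 : 0 < ρ) :
    ∃ (W : ℕ) (C : ℝ), ∀ n : ℕ, 2 ≤ n → ∃ (t : ℕ) (s : State),
      Exec (fun _ _ => 0) preprocess
        (initState [n, blockLength ρ n, codeDistance ρ n] (fun _ => 0)) t s ∧
      (t : ℝ) ≤ C * (n : ℝ) ^ (2.773 / ρ ^ 2) ∧
      (∃ K : Set (Fin (blockLength ρ n) → Bool),
        IsGilbertCode (blockLength ρ n) (codeDistance ρ n) K ∧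
        IsDecodingTable (blockLength ρ n) (codeDistance ρ n) K s.mem) ∧
      ∀ x, s.mem x < 2 ^ (W * (n.size + 3) ^ 2) := by
  have hlog := Real.log_pos one_lt_two
  set K₀ := 4 * Real.log 2 / ρ ^ 2 with hK₀
  have hK₀0 : 0 ≤ K₀ := by positivity
  obtain ⟨W, hW⟩ := exists_nat_ge (K₀ + 3)
  -- The slack between 4 ln 2 = 2.7725… and 2.773 gives a positive power of n that absorbs the
  -- polylogarithmic factor.
  set γ := 2.773 / ρ ^ 2 - K₀ with hγd
  have hγ : 0 < γ := by
    rw [hγd, hK₀, ← sub_div]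
    refine div_pos ?_ (by positivity)
    linarith [Real.log_two_lt_d9]
  refine ⟨W, 600 * (K₀ + 2) ^ 2 * (50 * W + 1) * (4 / (γ * Real.log 2)) ^ 4, fun n hn => ?_⟩
  set m := blockLength ρ n with hm
  set d := codeDistance ρ n with hd
  set B := W * (n.size + 3) ^ 2 with hB
  have hlg := one_le_logb hn
  have hlgs := logb_le_size hn
  have hsz := size_le_logb_add_one hn
  set lg := Real.logb 2 n with hlgd
  have hmle : (m : ℝ) ≤ K₀ * lg + 1 := by
    have h := Nat.ceil_lt_add_one (a := 4 * Real.log 2 * lg / ρ ^ 2) (by positivity)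
    have e : 4 * Real.log 2 * lg / ρ ^ 2 = K₀ * lg := by rw [hK₀]; ring
    rw [hm, blockLength, ← hlgd]
    rw [e] at h ⊢
    exact h.le
  have hdm : d ≤ m := by
    rw [hd, codeDistance, Nat.ceil_le, ← hm]
    have : (0 : ℝ) ≤ m := Nat.cast_nonneg m
    nlinarith
  have hmB : m + 2 ≤ B := by
    have : ((m + 2 : ℕ) : ℝ) ≤ (B : ℝ) := by
      rw [hB]
      push_cast
      have hs0 : (1 : ℝ) ≤ n.size := by linarith
      have hW0 : (0 : ℝ) ≤ W := by linarith
      have h3 : (n.size : ℝ) ≤ ((n.size : ℝ) + 3) ^ 2 := by nlinarith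
      have h4 : K₀ * lg + 3 ≤ (K₀ + 3) * n.size := by nlinarith
      have h5 : (K₀ + 3) * n.size ≤ W * ((n.size : ℝ) + 3) ^ 2 :=
        mul_le_mul hW h3 (by linarith) hW0
      linarith
    exact_mod_cast this
  have hBlt : B < 2 ^ B := Nat.lt_two_pow_self
  have hW1 : 1 ≤ W := by
    have : (1 : ℝ) ≤ W := by linarith
    exact_mod_cast this
  have hsB : n.size ≤ B := by
    have h2 : n.size + 3 ≤ (n.size + 3) ^ 2 := Nat.le_self_pow two_ne_zero _
    have h3 := Nat.mul_le_mul_right ((n.size + 3) ^ 2) hW1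
    omega
  have hbd : Bounded B (initState [n, m, d] fun _ => 0) := by
    refine ⟨fun r => ?_, fun a => by simp [initState]⟩
    rcases r with _ | _ | _ | r
    · simpa [initState] using Nat.size_le.1 hsB
    · simp [initState]; omega
    · simp [initState]; omega
    · simp [initState]
  obtain ⟨t, s, ht, htle, hsb, K, hK1, hK2⟩ := runs_preprocess (B := B) (inp := fun _ _ => 0)
    (s := initState [n, m, d] fun _ => 0) (m := m) (d := d) hmB (by simp [initState])
    (by simp [initState]) (fun a => rfl) hbd
  refine ⟨t, s, ht, ?_, ⟨K, hK1, hK2⟩, hsb.mem⟩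
  have hcast : (t : ℝ) ≤ 2 ^ m * (300 * ((m : ℝ) + 1) ^ 2) * (2 * B + 1) := by exact_mod_cast htle
  have hn0 : (0 : ℝ) < n := by positivity
  have h2m : (2 : ℝ) ^ m ≤ 2 * (n : ℝ) ^ K₀ := by
    calc (2 : ℝ) ^ m = (2 : ℝ) ^ (m : ℝ) := (Real.rpow_natCast _ _).symm
      _ ≤ (2 : ℝ) ^ (lg * K₀ + 1) :=
        Real.rpow_le_rpow_of_exponent_le one_le_two (by linarith)
      _ = 2 * (n : ℝ) ^ K₀ := by
        rw [Real.rpow_add two_pos, Real.rpow_mul two_pos.le, hlgd,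
          Real.rpow_logb two_pos (by norm_num) hn0, Real.rpow_one, mul_comm]
  have hm1 : (m : ℝ) + 1 ≤ (K₀ + 2) * lg := by nlinarith
  have hB1 : 2 * (B : ℝ) + 1 ≤ (50 * W + 1) * lg ^ 2 := by
    rw [hB]
    push_cast
    have h3 : ((n.size : ℝ) + 3) ^ 2 ≤ (5 * lg) ^ 2 := by gcongr; linarith
    have hW0 : (0 : ℝ) ≤ W := Nat.cast_nonneg W
    nlinarith [mul_le_mul_of_nonneg_left h3 hW0]
  calc (t : ℝ) ≤ 2 ^ m * (300 * ((m : ℝ) + 1) ^ 2) * (2 * B + 1) := hcast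
    _ ≤ (2 * (n : ℝ) ^ K₀) * (300 * ((K₀ + 2) * lg) ^ 2) * ((50 * W + 1) * lg ^ 2) := by gcongr
    _ = 600 * (K₀ + 2) ^ 2 * (50 * W + 1) * (n : ℝ) ^ K₀ * lg ^ 4 := by ring
    _ ≤ 600 * (K₀ + 2) ^ 2 * (50 * W + 1) * (n : ℝ) ^ K₀ *
        ((4 / (γ * Real.log 2)) ^ 4 * (n : ℝ) ^ γ) := by
      gcongr
      exact logb_pow_four_le hγ
    _ = 600 * (K₀ + 2) ^ 2 * (50 * W + 1) * (4 / (γ * Real.log 2)) ^ 4 *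
        ((n : ℝ) ^ K₀ * (n : ℝ) ^ γ) := by ring
    _ = _ := by
      rw [← Real.rpow_add hn0, hγd, add_sub_cancel]

end LightBulb

/-! ### Both claims from the entropy dichotomy -/

open LightBulb Filter Topology in
theorem mainTheorem7 (ρ : ℝ) (hρ0 : 0 < ρ) (hρ1 : ρ ≤ 1) :
    ((1 / 2 ≤ kappaZ ((1 - ρ) / 2) ∨
        1 ≤ H2 (1 - kappaZ ((1 - ρ) / 2)) * (4 * Real.log 2 / ρ ^ 2)) →
      ∃ (Q : Cmd) (C c : ℝ) (k : ℕ) (ε : ℕ → ℝ), Tendsto ε atTop (𝓝 0) ∧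
        ∀ n : ℕ, 2 ≤ n → ∀ L : ℕ, c * Real.logb 2 n ^ 2 ≤ L →
          Solves Q (fun _ => 0) ρ n L
            (timeBound ρ (H2 (1 - kappaZ ((1 - ρ) / 2))) C k (ε n) n)) ∧
    ∃ (P Q : Cmd) (C c : ℝ) (k : ℕ) (ε : ℕ → ℝ), Tendsto ε atTop (𝓝 0) ∧
      ∀ n : ℕ, 2 ≤ n → ∃ (t : ℕ) (s : State),
        Exec (fun _ _ => 0) P
          (initState [n, blockLength ρ n, codeDistance ρ n] (fun _ => 0)) t s ∧
        (t : ℝ) ≤ C * (n : ℝ) ^ (2.773 / ρ ^ 2) ∧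
        (∃ K : Set (Fin (blockLength ρ n) → Bool),
          IsGilbertCode (blockLength ρ n) (codeDistance ρ n) K ∧
          IsDecodingTable (blockLength ρ n) (codeDistance ρ n) K s.mem) ∧
        ∀ L : ℕ, c * Real.logb 2 n ^ 2 ≤ L →
          Solves Q s.mem ρ n L
            (timeBound ρ (H2 (H2 ((1 - ρ) / 2))) C k (ε n) n) := by
  have hH0 := H2_nonneg (x := (1 - ρ) / 2) (by linarith) (by linarith)
  constructor
  · intro h
    have he : 1 ≤ H2 (1 - kappaZ ((1 - ρ) / 2)) * (4 * Real.log 2 / ρ ^ 2) ∨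
        H2 ((1 - ρ) / 2) ≤ 1 / 2 ∧ 2 * H2 ((1 - ρ) / 2) ≤ H2 (1 - kappaZ ((1 - ρ) / 2)) := by
      rcases h with h | h
      · right
        -- For κ ≥ 1/2 the number 1 - κ lies in [0, 1/2] and is at least H2(δ), so the chord bound
        -- gives H2(1 - κ) ≥ 2(1 - κ) ≥ 2 H2(δ).
        have hκ := kappaZ_le (δ := (1 - ρ) / 2) (by linarith) (by linarith)
        have := two_mul_le_H2 (x := 1 - kappaZ ((1 - ρ) / 2)) (by linarith) (by linarith)
        exact ⟨by linarith, by linarith⟩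
      · exact Or.inl h
    -- The memory is empty, so its entries have zero bits.
    obtain ⟨Q, C, c, hQ⟩ := exists_search_solves hρ0 hρ1 he 0
    exact ⟨Q, C, c, 4, fun _ => 0, tendsto_const_nhds, fun n hn L hL =>
      hQ n hn _ (fun _ => by positivity) L hL⟩
  · have he : 1 ≤ H2 (H2 ((1 - ρ) / 2)) * (4 * Real.log 2 / ρ ^ 2) ∨
        H2 ((1 - ρ) / 2) ≤ 1 / 2 ∧ 2 * H2 ((1 - ρ) / 2) ≤ H2 (H2 ((1 - ρ) / 2)) := by
      -- For small H2(δ) the chord bound applies at H2(δ) itself; otherwise the exponent alone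
      -- already allows a factor n.
      rcases le_total (H2 ((1 - ρ) / 2)) (1 / 2) with h | h
      · exact Or.inr ⟨h, two_mul_le_H2 hH0 h⟩
      · exact Or.inl (one_le_exponent hρ0 hρ1 h)
    obtain ⟨W, C₁, hP⟩ := exists_preprocess hρ0
    obtain ⟨Q, C₂, c, hQ⟩ := exists_search_solves hρ0 hρ1 he W
    refine ⟨preprocess, Q, max C₁ C₂, c, 4, fun _ => 0, tendsto_const_nhds, fun n hn => ?_⟩
    obtain ⟨t, s, h1, h2, h3, h4⟩ := hP n hn
    refine ⟨t, s, h1, h2.trans (by gcongr; exact le_max_left _ _), h3, fun L hL => ?_⟩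
    obtain ⟨h5, h6⟩ := hQ n hn s.mem h4 L hL
    refine ⟨fun X => ?_, h6⟩
    obtain ⟨t', s', h7, h8⟩ := h5 X
    exact ⟨t', s', h7, h8.trans (timeBound_mono (le_max_right _ _) hn _)⟩
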